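/- A \emph{list type} is a type built from $1$ (one element) by the constructors $\Sigma_1\times\Sigma_2$ (pairs), $\Sigma_1+\Sigma_2$ (disjoint union) and $\Sigma^*$ (finite lists). Every element of a list type is represented by a finite relational structure (possibly with empty universe), over a vocabulary that depends only on the type: - $1$: a one-element universe and no relations. - $\Sigma_1+\Sigma_2$: the structure of the element of $\Sigma_1$ or $\Sigma_2$; the vocabulary is the disjoint union of the two vocabularies (the relations of the other side are empty) plus a nullary relation telling which side is used. - $\Sigma_1\times\Sigma_2$: the disjoint union of the two structures, over the disjoint union of the two vocabularies plus a unary relation selecting the elements of the first structure. - $\Sigma^*$: the elements are the finite, possibly empty, lists $[A_1,\dots,A_n]$ of elements of $\Sigma$ that all have nonempty universe. The structure is the disjoint union of the structures of $A_1,\dots,A_n$ with shared vocabulary, where each nullary relation $R()$ of $\Sigma$ is replaced by a unary relation $R(x)$ that selects the $x$ belonging to a list item that satisfies $R()$, together with a binary relation $x\le y$ saying that the item of $x$ is at the same or an earlier position than the item of $y$. A function $f:\Sigma\to\Gamma$ between list types is a \emph{quantifier-free interpretation} if there are a quantifier-free formula $\varphi(x)$ over the vocabulary of $\Sigma$ and,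 for each relation name $R$ of arity $m\ge 0$ in the vocabulary of $\Gamma$, a quantifier-free formula $\varphi_R(x_1,\dots,x_m)$ over the vocabulary of $\Sigma$, such that for every $A\in\Sigma$ the structure of $f(A)$ is, up to isomorphism, the structure whose universe is the set of elements of $A$ that satisfy $\varphi$ and in which each $R$ is defined by $\varphi_R$. \textbf{Theorem.} A function $f:\Sigma\to\Gamma$ between list types is a quantifier-free interpretation if and only if it can be derived from the following prime functions (for all list types $\Gamma,\Sigma,\Delta,\Gamma_1,\Gamma_2$, where $\leftrightarrow$ means both directions) $$\begin{array}{ll} \Gamma\times\Sigma\leftrightarrow\Sigma\times\Gamma,\quad \Gamma+\Sigma\leftrightarrow\Sigma+\Gamma & \text{(commutativity)}\\ \Gamma\times(\Sigma\times\Delta)\leftrightarrow(\Gamma\times\Sigma)\times\Delta,\quad \Gamma+(\Sigma+\Delta)\leftrightarrow(\Gamma+\Sigma)+\Delta & \text{(associativity)}\\ \Gamma\times(\Sigma+\Delta)\leftrightarrow(\Gamma\times\Sigma)+(\Gamma\times\Delta) & \text{(distributivity)}\\ \Gamma_1\times\Gamma_2\to\Gamma_i,\quad \Gamma_i\to\Gamma_1+\Gamma_2\quad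 (i=1,2) & \text{(projections, co-projections)}\\ \Gamma+\Gamma\to\Gamma & \text{(co-diagonal)}\\ \Sigma^*\times\Sigma\to\Sigma^* & \text{(append)}\\ \Sigma^*\to\Sigma^* & \text{(reverse)}\\ \Sigma^{**}\to\Sigma^* & \text{(concat)}\\ \Sigma\to\Sigma\times\Gamma^*,\ x\mapsto(x,[\,]) & \text{(create empty)}\\ (\Sigma\times\Gamma)^*\to\Sigma^*\times\Gamma^* & \text{(list distribute)} \end{array}$$ by applying the following combinators: from $f:\Gamma\to\Sigma$ and $g:\Sigma\to\Delta$ derive the composition $\Gamma\to\Delta$; from $f_i:\Gamma_i\to\Sigma_i$ ($i=1,2$) derive $f_1\times f_2:\Gamma_1\times\Gamma_2\to\Sigma_1\times\Sigma_2$ and $f_1+f_2:\Gamma_1+\Gamma_2\to\Sigma_1+\Sigma_2$; from $f:\Gamma\to\Sigma$ derive $f^*:\Gamma^*\to\Sigma^*$, which applies $f$ to every list item. In append, list distribute and $f^*$, list items that would have an empty universe are omitted from the output list. -/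

import Mathlib

/-- List types: `1`, pairs, co-pairs and lists. -/
inductive ListType : Type
  | one : ListType
  | prod : ListType → ListType → ListType
  | sum : ListType → ListType → ListType
  | list : ListType → ListType

namespace ListType

/-- A set of elements, each of them with the universe of the structure that represents it. -/
structure Carrier : Type 1 where
  Elem : Type
  Univ : Elem → Type

/-- The elements of a list type, defined together with the universes of their structures, since the
items of a list are required to have a nonempty universe. -/
def carrier : ListType → Carrier
  | one => ⟨Unit, fun _ => Unit⟩
  | prod a b =>
      ⟨a.carrier.Elem × b.carrier.Elem, fun x => a.carrier.Univ x.1 ⊕ b.carrier.Univ x.2⟩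
  | sum a b =>
      ⟨a.carrier.Elem ⊕ b.carrier.Elem, fun x => Sum.elim a.carrier.Univ b.carrier.Univ x⟩
  | list a =>
      ⟨List {x : a.carrier.Elem // Nonempty (a.carrier.Univ x)},
        fun l => Σ i : Fin l.length, a.carrier.Univ (l.get i).1⟩

/-- The elements of a list type. -/
def Elem (a : ListType) : Type := a.carrier.Elem

/-- The universe of the structure that represents an element. -/
def Univ {a : ListType} (v : a.Elem) : Type := a.carrier.Univ v

/-- The relation names (with arities) in the vocabulary of a list type. -/
inductive Rel : ListType → ℕ → Type
  | sumLeft {a b : ListType} {n : ℕ} : Rel a n → Rel (sum a b) n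
  | sumRight {a b : ListType} {n : ℕ} : Rel b n → Rel (sum a b) n
  | sumTag {a b : ListType} : Rel (sum a b) 0
  | prodLeft {a b : ListType} {n : ℕ} : Rel a n → Rel (prod a b) n
  | prodRight {a b : ListType} {n : ℕ} : Rel b n → Rel (prod a b) n
  | prodFst {a b : ListType} : Rel (prod a b) 1
  | listNullary {a : ListType} : Rel a 0 → Rel (list a) 1
  | listItem {a : ListType} {n : ℕ} : Rel a (n + 1) → Rel (list a) (n + 1)
  | listLe {a : ListType} : Rel (list a) 2

/-- The interpretation of the relation names in the structure that represents an element. -/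
def Rel.Holds : {a : ListType} → {n : ℕ} → Rel a n → (v : a.Elem) → (Fin n → Univ v) → Prop
  | _, _, sumLeft R, Sum.inl x, xs => R.Holds x xs
  | _, _, sumLeft _, Sum.inr _, _ => False
  | _, _, sumRight _, Sum.inl _, _ => False
  | _, _, sumRight R, Sum.inr y, xs => R.Holds y xs
  | _, _, sumTag, Sum.inl _, _ => True
  | _, _, sumTag, Sum.inr _, _ => False
  | _, n, prodLeft R, (x, y), xs =>
      ∃ us : Fin n → Univ x, (xs = fun k => (Sum.inl (us k) : Univ x ⊕ Univ y)) ∧ R.Holds x us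
  | _, n, prodRight R, (x, y), xs =>
      ∃ us : Fin n → Univ y, (xs = fun k => (Sum.inr (us k) : Univ x ⊕ Univ y)) ∧ R.Holds y us
  | _, _, prodFst, (x, y), xs => ∃ u : Univ x, xs 0 = (Sum.inl u : Univ x ⊕ Univ y)
  | _, _, listNullary R, l, xs => R.Holds (l.get (xs 0).1).1 Fin.elim0
  | list a, _, listItem (n := n) R, l, xs =>
      ∃ (i : Fin l.length) (us : Fin (n + 1) → a.carrier.Univ (l.get i).1),
        (xs = fun k => ⟨i, us k⟩) ∧ R.Holds (l.get i).1 us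
  | _, _, listLe, _, xs => (xs 0).1 ≤ (xs 1).1

/-- The vocabulary of a list type, as a relational first-order language. -/
def vocab (a : ListType) : FirstOrder.Language.{0, 0} := ⟨fun _ => Empty, Rel a⟩

instance (a : ListType) : a.vocab.IsRelational :=
  fun _ => (inferInstance : IsEmpty Empty)

/-- The structure that represents an element of a list type. -/
instance {a : ListType} (v : a.Elem) : a.vocab.Structure (Univ v) where
  funMap f _ := isEmptyElim f
  RelMap R xs := Rel.Holds R v xs

end ListType

/-- The formulas of a quantifier-free interpretation from structures over `L` to structures over
`L'`, with the identity as the polynomial functor: a universe formula with one free variable, and a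
formula with `n` free variables for every `n`-ary relation name of the output vocabulary. -/
structure QFInterpretation (L L' : FirstOrder.Language.{0, 0}) : Type where
  univ : L.Formula (Fin 1)
  univ_isQF : univ.IsQF
  rel : {n : ℕ} → L'.Relations n → L.Formula (Fin n)
  rel_isQF : ∀ {n : ℕ} (R : L'.Relations n), (rel R).IsQF

namespace QFInterpretation

/-- The universe of the output structure, a subset of the universe of the input structure. -/
def Out {L L' : FirstOrder.Language.{0, 0}} (I : QFInterpretation L L') (M : Type)
    [L.Structure M] : Type :=
  {x : M // I.univ.Realize (fun _ => x)}

/-- The output structure. -/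
instance {L L' : FirstOrder.Language.{0, 0}} [L'.IsRelational] (I : QFInterpretation L L') (M : Type)
    [L.Structure M] : L'.Structure (I.Out M) where
  funMap f _ := isEmptyElim f
  RelMap R xs := (I.rel R).Realize (fun k => (xs k).1)

end QFInterpretation

/-- A function between list types is a quantifier-free interpretation, if fixed quantifier-free
formulas define the structure of every output (up to isomorphism) in the structure of the input. -/
def IsQFInterpretation {a b : ListType} (f : a.Elem → b.Elem) : Prop :=
  ∃ I : QFInterpretation a.vocab b.vocab,
    ∀ v : a.Elem, Nonempty (b.vocab.Equiv (I.Out (ListType.Univ v)) (ListType.Univ (f v)))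

namespace ListType

variable {a b c d : ListType}

/-! The prime functions. List items have to be nonempty, so items that would have an empty universe
are left out. -/

def prodComm : (prod a b).Elem → (prod b a).Elem := fun (x, y) => (y, x)

def sumComm : (sum a b).Elem → (sum b a).Elem
  | Sum.inl x => Sum.inr x
  | Sum.inr y => Sum.inl y

def prodAssoc : (prod a (prod b c)).Elem → (prod (prod a b) c).Elem :=
  fun (x, (y, z)) => ((x, y), z)

def prodAssocInv : (prod (prod a b) c).Elem → (prod a (prod b c)).Elem :=
  fun ((x, y), z) => (x, (y, z))

def sumAssoc : (sum a (sum b c)).Elem → (sum (sum a b) c).Elem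
  | Sum.inl x => Sum.inl (Sum.inl x)
  | Sum.inr (Sum.inl y) => Sum.inl (Sum.inr y)
  | Sum.inr (Sum.inr z) => Sum.inr z

def sumAssocInv : (sum (sum a b) c).Elem → (sum a (sum b c)).Elem
  | Sum.inl (Sum.inl x) => Sum.inl x
  | Sum.inl (Sum.inr y) => Sum.inr (Sum.inl y)
  | Sum.inr z => Sum.inr (Sum.inr z)

def distrib : (prod a (sum b c)).Elem → (sum (prod a b) (prod a c)).Elem
  | (x, Sum.inl y) => Sum.inl (x, y)
  | (x, Sum.inr z) => Sum.inr (x, z)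

def distribInv : (sum (prod a b) (prod a c)).Elem → (prod a (sum b c)).Elem
  | Sum.inl (x, y) => (x, Sum.inl y)
  | Sum.inr (x, z) => (x, Sum.inr z)

def fst : (prod a b).Elem → a.Elem := fun (x, _) => x

def snd : (prod a b).Elem → b.Elem := fun (_, y) => y

def inl : a.Elem → (sum a b).Elem := fun x => Sum.inl x

def inr : b.Elem → (sum a b).Elem := fun y => Sum.inr y

def codiag : (sum a a).Elem → a.Elem
  | Sum.inl x => x
  | Sum.inr x => x

/-- The items of a list. -/
def items (l : (list a).Elem) : List {x : a.Elem // Nonempty (Univ x)} := l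

/-- The list with the given nonempty items. -/
def ofItems (l : List {x : a.Elem // Nonempty (Univ x)}) : (list a).Elem := l

open Classical in
/-- The items of the one-item list `[x]`; there are none if `x` has an empty universe. -/
noncomputable def single (x : a.Elem) : List {x : a.Elem // Nonempty (Univ x)} :=
  if h : Nonempty (Univ x) then [⟨x, h⟩] else []

noncomputable def append : (prod (list a) a).Elem → (list a).Elem :=
  fun (l, x) => ofItems (items l ++ single x)

def reverse : (list a).Elem → (list a).Elem := fun l => ofItems (items l).reverse

def concat : (list (list a)).Elem → (list a).Elem :=
  fun l => ofItems ((items l).flatMap fun x => items x.1)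

def createEmpty : a.Elem → (prod a (list b)).Elem := fun x => (x, ofItems [])

noncomputable def listDistrib : (list (prod a b)).Elem → (prod (list a) (list b)).Elem :=
  fun l => (ofItems ((items l).flatMap fun x => single (fst x.1)),
    ofItems ((items l).flatMap fun x => single (snd x.1)))

/-! The functions on which the combinators are based. -/

def prodMap (f : a.Elem → b.Elem) (g : c.Elem → d.Elem) : (prod a c).Elem → (prod b d).Elem :=
  fun (x, y) => (f x, g y)

def sumMap (f : a.Elem → b.Elem) (g : c.Elem → d.Elem) : (sum a c).Elem → (sum b d).Elem
  | Sum.inl x => Sum.inl (f x)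
  | Sum.inr y => Sum.inr (g y)

noncomputable def listMap (f : a.Elem → b.Elem) : (list a).Elem → (list b).Elem :=
  fun l => ofItems ((items l).flatMap fun x => single (f x.1))

end ListType

open ListType in
/-- The functions that can be derived from the prime functions by applying the combinators. -/
inductive Derivable : {a b : ListType} → (a.Elem → b.Elem) → Prop
  | prodComm {a b : ListType} : Derivable (prodComm (a := a) (b := b))
  | sumComm {a b : ListType} : Derivable (sumComm (a := a) (b := b))
  | prodAssoc {a b c : ListType} : Derivable (prodAssoc (a := a) (b := b) (c := c))
  | prodAssocInv {a b c : ListType} : Derivable (prodAssocInv (a := a) (b := b) (c := c))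
  | sumAssoc {a b c : ListType} : Derivable (sumAssoc (a := a) (b := b) (c := c))
  | sumAssocInv {a b c : ListType} : Derivable (sumAssocInv (a := a) (b := b) (c := c))
  | distrib {a b c : ListType} : Derivable (distrib (a := a) (b := b) (c := c))
  | distribInv {a b c : ListType} : Derivable (distribInv (a := a) (b := b) (c := c))
  | fst {a b : ListType} : Derivable (fst (a := a) (b := b))
  | snd {a b : ListType} : Derivable (snd (a := a) (b := b))
  | inl {a b : ListType} : Derivable (inl (a := a) (b := b))
  | inr {a b : ListType} : Derivable (inr (a := a) (b := b))
  | codiag {a : ListType} : Derivable (codiag (a := a))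
  | append {a : ListType} : Derivable (append (a := a))
  | reverse {a : ListType} : Derivable (reverse (a := a))
  | concat {a : ListType} : Derivable (concat (a := a))
  | createEmpty {a b : ListType} : Derivable (createEmpty (a := a) (b := b))
  | listDistrib {a b : ListType} : Derivable (listDistrib (a := a) (b := b))
  | comp {a b c : ListType} {f : a.Elem → b.Elem} {g : b.Elem → c.Elem} :
      Derivable f → Derivable g → Derivable (fun x => g (f x))
  | prodMap {a b c d : ListType} {f : a.Elem → b.Elem} {g : c.Elem → d.Elem} :
      Derivable f → Derivable g → Derivable (prodMap f g)
  | sumMap {a b c d : ListType} {f : a.Elem → b.Elem} {g : c.Elem → d.Elem} :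
      Derivable f → Derivable g → Derivable (sumMap f g)
  | listMap {a b : ListType} {f : a.Elem → b.Elem} : Derivable f → Derivable (listMap f)

/-! A quantifier-free formula cannot separate tuples that correspond under a partial isomorphism.
Since vocabularies are finite, the converse holds too: invariant properties of tuples are definable.
So `f` is an interpretation exactly when output universes embed into input universes by maps `e`
whose images, and whose pulled-back relations, are invariant under partial isomorphisms. This is
`Lifts`, and `isQFInterpretation_iff_exists_lifts` removes logic from the problem. Partial
isomorphisms have a description by recursion on the type (`PIso`), from which the prime functions
and combinators are seen to lift; hence derivable functions are interpretations.

For the converse, distributivity makes every type a retract of a sum of products of `one` and list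
types, and a function on a sum is a copairing; so the input type may be taken to be such a product
(`Normal false`). It has no nullary relations, and the unary type of a point is its leaf, the
occurrence of `one` it comes from. Hence the image of `e` consists of the points from some set of
leaves. The obstacle is that inputs cannot be copied. It is overcome by `Normal.splits`: for a
nontrivial set of leaves, the substructures on it and on its complement are computed together, in
smaller types. By `Lifts.exists_factor`, a function that uses only points from the set factors
through the first of them.

The proof is then an induction on the output type. For a sum, the side is constant. For a product,
the components use disjoint sets of leaves, so the input is split. For a list, there is an inner
induction on the size of the input type. After restriction `e` is bijective, and the output list
preorders the points of the input. If some nontrivial set of leaves always comes first (a cut), the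
output is a concatenation of two lists computed from the two halves of a split. Without such cuts
the preorder is rigid: on a product it is constant (`PosInvariant.eq_of_prod`); on a list it is
constant, or follows the list order, or follows its reverse (`PosInvariant.trichotomy_of_list`). A
constant preorder means a one-item output, covered by the outer induction; in the other two cases
`f` is assembled from its values on one-item lists, covered by the inner one. -/

namespace ListType

/-! ### Leaves and the recursive description of partial isomorphisms -/

/-- The occurrences of `one` in a list type. -/
def Leaf : ListType → Type
  | one => Unit
  | prod a b => Leaf a ⊕ Leaf b
  | sum a b => Leaf a ⊕ Leaf b
  | list a => Leaf a

/-- The occurrence of `one` that an element of the universe comes from. -/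
def leaf : {a : ListType} → (v : a.Elem) → Univ v → a.Leaf
  | one, _, _ => ()
  | prod _ _, (x, _), Sum.inl u => Sum.inl (leaf x u)
  | prod _ _, (_, y), Sum.inr u => Sum.inr (leaf y u)
  | sum _ _, Sum.inl x, u => Sum.inl (leaf x u)
  | sum _ _, Sum.inr x, u => Sum.inr (leaf x u)
  | list a, l, u => leaf (a := a) (List.get l u.1).1 u.2

/-- Partial isomorphisms between the structures of two elements of a list type. -/
def PIso : (a : ListType) → (v w : a.Elem) → (Univ v → Univ w → Prop) → Prop
  | one, _, _, _ => True
  | sum a _, Sum.inl x, Sum.inl y, r => PIso a x y r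
  | sum _ b, Sum.inr x, Sum.inr y, r => PIso b x y r
  | sum _ _, Sum.inl _, Sum.inr _, _ => False
  | sum _ _, Sum.inr _, Sum.inl _, _ => False
  | prod a b, (x, y), (x', y'), r =>
      (∀ u v, ¬ r (Sum.inl u) (Sum.inr v)) ∧ (∀ u v, ¬ r (Sum.inr u) (Sum.inl v)) ∧
      PIso a x x' (fun u v => r (Sum.inl u) (Sum.inl v)) ∧
      PIso b y y' (fun u v => r (Sum.inr u) (Sum.inr v))
  | list a, l, l', r =>
      (∀ x y x' y', r x x' → r y y' → (x.1 ≤ y.1 ↔ x'.1 ≤ y'.1)) ∧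
      ∀ x x', r x x' → PIso a (List.get l x.1).1 (List.get l' x'.1).1
        (fun u v => r ⟨x.1, u⟩ ⟨x'.1, v⟩)

theorem PIso.mono {a : ListType} {v w : a.Elem} {r s : Univ v → Univ w → Prop}
    (h : PIso a v w s) (hrs : ∀ x y, r x y → s x y) : PIso a v w r := by
  induction a with
  | one => trivial
  | sum a b iha ihb =>
    rcases v with v | v <;> rcases w with w | w
    · exact iha (v := v) (w := w) h hrs
    · exact h
    · exact h
    · exact ihb (v := v) (w := w) h hrs
  | prod a b iha ihb =>
    rcases v with ⟨v, v'⟩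
    rcases w with ⟨w, w'⟩
    obtain ⟨h1, h2, h3, h4⟩ := h
    exact ⟨fun u v h => h1 u v (hrs _ _ h), fun u v h => h2 u v (hrs _ _ h),
      iha (v := v) (w := w) h3 fun _ _ => hrs _ _, ihb (v := v') (w := w') h4 fun _ _ => hrs _ _⟩
  | list a ih =>
    exact ⟨fun x y x' y' hx hy => h.1 x y x' y' (hrs _ _ hx) (hrs _ _ hy),
      fun x x' hx => ih (h.2 x x' (hrs _ _ hx)) fun _ _ => hrs _ _⟩

end ListType

namespace ListType

theorem univ_list_mk_inj {a : ListType} {l : (list a).Elem} {i : Fin (List.length l)}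
    {x y : Univ (List.get l i).1} :
    (⟨i, x⟩ : (list a).carrier.Univ l) = ⟨i, y⟩ ↔ x = y :=
  ⟨fun h => by cases h; rfl, fun h => by rw [h]⟩

/-- Equality needs no clause of its own in `PIso`: equality of list positions follows from the order
by antisymmetry, and the universe of `one` is a point. -/
theorem PIso.eq_iff {a : ListType} {v w : a.Elem} {r : Univ v → Univ w → Prop}
    (h : PIso a v w r) {x y : Univ v} {x' y' : Univ w} (hx : r x x') (hy : r y y') :
    x = y ↔ x' = y' := by
  induction a with
  | one => exact ⟨fun _ => rfl, fun _ => rfl⟩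
  | sum a b iha ihb =>
    rcases v with v | v <;> rcases w with w | w
    · exact iha (v := v) (w := w) h hx hy
    · exact h.elim
    · exact h.elim
    · exact ihb (v := v) (w := w) h hx hy
  | prod a b iha ihb =>
    rcases v with ⟨v, v'⟩
    rcases w with ⟨w, w'⟩
    obtain ⟨h1, h2, h3, h4⟩ := h
    rcases x with x | x <;> rcases x' with x' | x'
    · rcases y with y | y <;> rcases y' with y' | y'
      · have := iha h3 hx hy
        exact Sum.inl_injective.eq_iff.trans (this.trans Sum.inl_injective.eq_iff.symm)
      · exact (h1 _ _ hy).elim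
      · exact (h2 _ _ hy).elim
      · exact ⟨fun h => (Sum.inl_ne_inr h).elim, fun h => (Sum.inl_ne_inr h).elim⟩
    · exact (h1 _ _ hx).elim
    · exact (h2 _ _ hx).elim
    · rcases y with y | y <;> rcases y' with y' | y'
      · exact ⟨fun h => (Sum.inr_ne_inl h).elim, fun h => (Sum.inr_ne_inl h).elim⟩
      · exact (h1 _ _ hy).elim
      · exact (h2 _ _ hy).elim
      · have := ihb h4 hx hy
        exact Sum.inr_injective.eq_iff.trans (this.trans Sum.inr_injective.eq_iff.symm)
  | list a ih =>
    obtain ⟨h1, h2⟩ := h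
    have e1 := h1 _ _ _ _ hx hy
    have e2 := h1 _ _ _ _ hy hx
    obtain ⟨i, x⟩ := x
    obtain ⟨j, y⟩ := y
    obtain ⟨i', x'⟩ := x'
    obtain ⟨j', y'⟩ := y'
    simp only at e1 e2
    constructor
    · intro h
      cases h
      have : i' = j' := le_antisymm (e1.1 le_rfl) (e2.1 le_rfl)
      subst this
      rw [(ih (h2 _ _ hx) hx hy).1 rfl]
    · intro h
      cases h
      have : i = j := le_antisymm (e1.2 le_rfl) (e2.2 le_rfl)
      subst this
      rw [(ih (h2 _ _ hx) hx hy).2 rfl]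

theorem PIso.holds_iff {a : ListType} {v w : a.Elem} {r : Univ v → Univ w → Prop}
    (h : PIso a v w r) {n : ℕ} (R : Rel a n) {xs : Fin n → Univ v} {ys : Fin n → Univ w}
    (hr : ∀ k, r (xs k) (ys k)) : R.Holds v xs ↔ R.Holds w ys := by
  induction R with
  | sumLeft R ih =>
    rcases v with v | v <;> rcases w with w | w
    · exact ih (v := v) (w := w) h hr
    · exact h.elim
    · exact h.elim
    · exact Iff.rfl
  | sumRight R ih =>
    rcases v with v | v <;> rcases w with w | w
    · exact Iff.rfl
    · exact h.elim
    · exact h.elim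
    · exact ih (v := v) (w := w) h hr
  | sumTag =>
    rcases v with v | v <;> rcases w with w | w
    · exact Iff.rfl
    · exact h.elim
    · exact h.elim
    · exact Iff.rfl
  | prodLeft R ih =>
    rcases v with ⟨v, v'⟩
    rcases w with ⟨w, w'⟩
    obtain ⟨h1, h2, h3, h4⟩ := h
    constructor
    · rintro ⟨us, rfl, hR⟩
      have : ∀ k, ∃ u, ys k = Sum.inl u := fun k => by
        have := hr k
        rcases hk : ys k with y | y
        · exact ⟨y, rfl⟩
        · rw [hk] at this; exact (h1 _ _ this).elim
      choose us' hus' using this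
      obtain rfl : ys = fun k => Sum.inl (us' k) := funext hus'
      exact ⟨us', rfl, (ih h3 hr).1 hR⟩
    · rintro ⟨us, rfl, hR⟩
      have : ∀ k, ∃ u, xs k = Sum.inl u := fun k => by
        have := hr k
        rcases hk : xs k with y | y
        · exact ⟨y, rfl⟩
        · rw [hk] at this; exact (h2 _ _ this).elim
      choose us' hus' using this
      obtain rfl : xs = fun k => Sum.inl (us' k) := funext hus'
      exact ⟨us', rfl, (ih h3 hr).2 hR⟩
  | prodRight R ih =>
    rcases v with ⟨v, v'⟩
    rcases w with ⟨w, w'⟩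
    obtain ⟨h1, h2, h3, h4⟩ := h
    constructor
    · rintro ⟨us, rfl, hR⟩
      have : ∀ k, ∃ u, ys k = Sum.inr u := fun k => by
        have := hr k
        rcases hk : ys k with y | y
        · rw [hk] at this; exact (h2 _ _ this).elim
        · exact ⟨y, rfl⟩
      choose us' hus' using this
      obtain rfl : ys = fun k => Sum.inr (us' k) := funext hus'
      exact ⟨us', rfl, (ih h4 hr).1 hR⟩
    · rintro ⟨us, rfl, hR⟩
      have : ∀ k, ∃ u, xs k = Sum.inr u := fun k => by
        have := hr k
        rcases hk : xs k with y | y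
        · rw [hk] at this; exact (h1 _ _ this).elim
        · exact ⟨y, rfl⟩
      choose us' hus' using this
      obtain rfl : xs = fun k => Sum.inr (us' k) := funext hus'
      exact ⟨us', rfl, (ih h4 hr).2 hR⟩
  | prodFst =>
    rcases v with ⟨v, v'⟩
    rcases w with ⟨w, w'⟩
    obtain ⟨h1, h2, h3, h4⟩ := h
    have h0 := hr 0
    change (∃ u : Univ v, xs 0 = (Sum.inl u : Univ v ⊕ Univ v')) ↔
      ∃ u : Univ w, ys 0 = (Sum.inl u : Univ w ⊕ Univ w')
    constructor
    · rintro ⟨u, hu⟩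
      rw [hu] at h0
      rcases hk : ys 0 with y | y
      · exact ⟨y, rfl⟩
      · rw [hk] at h0; exact (h1 _ _ h0).elim
    · rintro ⟨u, hu⟩
      rw [hu] at h0
      rcases hk : xs 0 with y | y
      · exact ⟨y, rfl⟩
      · rw [hk] at h0; exact (h2 _ _ h0).elim
  | listNullary R ih => exact ih (h.2 _ _ (hr 0)) fun k => k.elim0
  | @listItem a n R ih =>
    obtain ⟨h1, h2⟩ := h
    constructor
    · rintro ⟨i, us, rfl, hR⟩
      have : ∀ k, ∃ u, ys k = ⟨(ys 0).1, u⟩ := fun k => by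
        have e1 := (h1 _ _ _ _ (hr k) (hr 0)).1 le_rfl
        have e2 := (h1 _ _ _ _ (hr 0) (hr k)).1 le_rfl
        generalize ys 0 = z at e1 e2 ⊢
        generalize ys k = y at e1 e2 ⊢
        obtain ⟨i, y⟩ := y
        obtain ⟨j, z⟩ := z
        obtain rfl : i = j := le_antisymm e1 e2
        exact ⟨y, rfl⟩
      choose us' hus' using this
      have h0 := hr 0
      generalize (ys 0).1 = i' at us' hus'
      obtain rfl : ys = fun k => ⟨i', us' k⟩ := funext hus'
      exact ⟨i', us', rfl, (ih (h2 _ _ (hr 0)) hr).1 hR⟩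
    · rintro ⟨i, us, rfl, hR⟩
      have : ∀ k, ∃ u, xs k = ⟨(xs 0).1, u⟩ := fun k => by
        have e1 := (h1 _ _ _ _ (hr k) (hr 0)).2 le_rfl
        have e2 := (h1 _ _ _ _ (hr 0) (hr k)).2 le_rfl
        generalize xs 0 = z at e1 e2 ⊢
        generalize xs k = y at e1 e2 ⊢
        obtain ⟨i, y⟩ := y
        obtain ⟨j, z⟩ := z
        obtain rfl : i = j := le_antisymm e1 e2
        exact ⟨y, rfl⟩
      choose us' hus' using this
      have h0 := hr 0
      generalize (xs 0).1 = i' at us' hus'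
      obtain rfl : xs = fun k => ⟨i', us' k⟩ := funext hus'
      exact ⟨i', us', rfl, (ih (h2 _ _ (hr 0)) hr).2 hR⟩
  | listLe => exact h.1 _ _ _ _ (hr 0) (hr 1)

/-- Each clause of the recursion is witnessed by one symbol: `sumTag`, `prodFst` or `listLe`. With
`PIso.eq_iff` and `PIso.holds_iff` this shows that `PIso` means preserving and reflecting equality
and all relations, nullary ones included. -/
theorem PIso.of_holds {a : ListType} {v w : a.Elem} {r : Univ v → Univ w → Prop}
    (heq : ∀ x y x' y', r x x' → r y y' → (x = y ↔ x' = y'))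
    (h : ∀ (n : ℕ) (R : Rel a n) (xs : Fin n → Univ v) (ys : Fin n → Univ w),
      (∀ k, r (xs k) (ys k)) → (R.Holds v xs ↔ R.Holds w ys)) : PIso a v w r := by
  induction a with
  | one => trivial
  | sum a b iha ihb =>
    rcases v with v | v <;> rcases w with w | w
    · exact iha (v := v) (w := w) heq fun n R => h n (.sumLeft R)
    · exact (h 0 .sumTag Fin.elim0 Fin.elim0 (fun k => k.elim0)).1 trivial
    · exact (h 0 .sumTag Fin.elim0 Fin.elim0 (fun k => k.elim0)).2 trivial
    · exact ihb (v := v) (w := w) heq fun n R => h n (.sumRight R)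
  | prod a b iha ihb =>
    rcases v with ⟨v, v'⟩
    rcases w with ⟨w, w'⟩
    refine ⟨fun x y hxy => ?_, fun x y hxy => ?_, iha (fun x y x' y' hx hy => ?_) ?_,
      ihb (fun x y x' y' hx hy => ?_) ?_⟩
    · obtain ⟨u, hu⟩ := (h 1 .prodFst (fun _ => Sum.inl x) (fun _ => Sum.inr y)
        (fun _ => hxy)).1 ⟨x, rfl⟩
      cases hu
    · obtain ⟨u, hu⟩ := (h 1 .prodFst (fun _ => Sum.inr x) (fun _ => Sum.inl y)
        (fun _ => hxy)).2 ⟨y, rfl⟩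
      cases hu
    · exact Sum.inl_injective.eq_iff.symm.trans
        ((heq _ _ _ _ hx hy).trans Sum.inl_injective.eq_iff)
    · intro n R xs ys hr
      have := h n (.prodLeft R) (fun k => Sum.inl (xs k)) (fun k => Sum.inl (ys k)) hr
      constructor
      · intro hR
        obtain ⟨us, hus, hR⟩ := this.1 ⟨xs, rfl, hR⟩
        obtain rfl : ys = us := funext fun k => Sum.inl_injective (congrFun hus k)
        exact hR
      · intro hR
        obtain ⟨us, hus, hR⟩ := this.2 ⟨ys, rfl, hR⟩
        obtain rfl : xs = us := funext fun k => Sum.inl_injective (congrFun hus k)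
        exact hR
    · exact Sum.inr_injective.eq_iff.symm.trans
        ((heq _ _ _ _ hx hy).trans Sum.inr_injective.eq_iff)
    · intro n R xs ys hr
      have := h n (.prodRight R) (fun k => Sum.inr (xs k)) (fun k => Sum.inr (ys k)) hr
      constructor
      · intro hR
        obtain ⟨us, hus, hR⟩ := this.1 ⟨xs, rfl, hR⟩
        obtain rfl : ys = us := funext fun k => Sum.inr_injective (congrFun hus k)
        exact hR
      · intro hR
        obtain ⟨us, hus, hR⟩ := this.2 ⟨ys, rfl, hR⟩
        obtain rfl : xs = us := funext fun k => Sum.inr_injective (congrFun hus k)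
        exact hR
  | list a ih =>
    refine ⟨fun x y x' y' hx hy => ?_, fun z z' hz => ih (fun x y x' y' hx hy => ?_) ?_⟩
    · exact h 2 .listLe ![x, y] ![x', y'] (fun k => by fin_cases k <;> assumption)
    · have := heq _ _ _ _ hx hy
      exact univ_list_mk_inj.symm.trans (this.trans univ_list_mk_inj)
    · intro n R xs ys hr
      cases n with
      | zero =>
        have := h 1 (.listNullary R) (fun _ => z) (fun _ => z') (fun _ => hz)
        rw [Subsingleton.elim xs Fin.elim0, Subsingleton.elim ys Fin.elim0]
        exact this
      | succ n =>
        have := h (n + 1) (.listItem R) (fun k => ⟨z.1, xs k⟩) (fun k => ⟨z'.1, ys k⟩) hr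
        constructor
        · intro hR
          obtain ⟨i, us, hus, hR⟩ := this.1 ⟨z.1, xs, rfl, hR⟩
          obtain rfl : z'.1 = i := congrArg Sigma.fst (congrFun hus 0)
          obtain rfl : ys = us := funext fun k => univ_list_mk_inj.1 (congrFun hus k)
          exact hR
        · intro hR
          obtain ⟨i, us, hus, hR⟩ := this.2 ⟨z'.1, ys, rfl, hR⟩
          obtain rfl : z.1 = i := congrArg Sigma.fst (congrFun hus 0)
          obtain rfl : xs = us := funext fun k => univ_list_mk_inj.1 (congrFun hus k)
          exact hR

end ListType

/-! ### Quantifier-free formulas and invariance -/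

open FirstOrder

namespace FirstOrder.Language.BoundedFormula

theorem IsQF.foldr_sup {L : Language.{0, 0}} {α : Type} {n : ℕ} (l : List (L.BoundedFormula α n))
    (h : ∀ φ ∈ l, φ.IsQF) : (l.foldr (· ⊔ ·) ⊥).IsQF := by
  induction l with
  | nil => exact isQF_bot
  | cons φ l ih =>
    exact (h φ (by simp)).sup (ih fun ψ hψ => h ψ (by simp [hψ]))

theorem IsQF.foldr_inf {L : Language.{0, 0}} {α : Type} {n : ℕ} (l : List (L.BoundedFormula α n))
    (h : ∀ φ ∈ l, φ.IsQF) : (l.foldr (· ⊓ ·) ⊤).IsQF := by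
  induction l with
  | nil => exact IsQF.top
  | cons φ l ih =>
    exact (h φ (by simp)).inf (ih fun ψ hψ => h ψ (by simp [hψ]))

/-- Every property of the truth values of finitely many quantifier-free formulas is defined by a
quantifier-free formula. -/
theorem exists_isQF_of_finite {L : Language.{0, 0}} {α ι : Type} [Finite ι] (φ : ι → L.Formula α)
    (hφ : ∀ i, (φ i).IsQF) (Q : (ι → Prop) → Prop) :
    ∃ ψ : L.Formula α, ψ.IsQF ∧ ∀ (M : Type) [L.Structure M] (v : α → M),
      ψ.Realize v ↔ Q fun i => (φ i).Realize v := by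
  classical
  -- Disjunctive normal form: one disjunct for each truth assignment that satisfies `Q`.
  refine ⟨BoundedFormula.iSup fun t : {t : ι → Prop // Q t} =>
    BoundedFormula.iInf fun i => if t.1 i then φ i else (φ i).not, ?_, ?_⟩
  · refine IsQF.foldr_sup _ fun χ hχ => ?_
    obtain ⟨t, -, rfl⟩ := List.mem_map.1 hχ
    refine IsQF.foldr_inf _ fun χ hχ => ?_
    obtain ⟨i, -, rfl⟩ := List.mem_map.1 hχ
    split_ifs
    · exact hφ i
    · exact (hφ i).not
  · intro M _ v
    rw [Formula.Realize, BoundedFormula.realize_iSup]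
    constructor
    · rintro ⟨⟨t, ht⟩, h⟩
      rw [BoundedFormula.realize_iInf] at h
      convert ht using 1
      funext i
      have := h i
      dsimp only at this
      split_ifs at this with hi
      · exact propext ⟨fun _ => hi, fun _ => this⟩
      · exact propext ⟨fun h => (this h).elim, fun h => (hi h).elim⟩
    · intro h
      refine ⟨⟨_, h⟩, ?_⟩
      rw [BoundedFormula.realize_iInf]
      intro i
      dsimp only
      split_ifs with hi
      · exact hi
      · exact hi

/-- Terms of a relational language are variables, so the hypotheses on `r` settle the atomic
formulas directly. -/
theorem IsQF.realize_iff {L : Language.{0, 0}} [L.IsRelational] {α : Type} {n : ℕ}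
    {φ : L.BoundedFormula α n} (hφ : φ.IsQF) {M N : Type} [L.Structure M] [L.Structure N]
    {r : M → N → Prop} (heq : ∀ x y x' y', r x x' → r y y' → (x = y ↔ x' = y'))
    (hrel : ∀ (n : ℕ) (R : L.Relations n) (xs : Fin n → M) (ys : Fin n → N),
      (∀ k, r (xs k) (ys k)) → (Structure.RelMap R xs ↔ Structure.RelMap R ys))
    {v : α → M} {w : α → N} (hvw : ∀ i, r (v i) (w i)) {xs : Fin n → M} {ys : Fin n → N}
    (hxy : ∀ i, r (xs i) (ys i)) : φ.Realize v xs ↔ φ.Realize w ys := by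
  have hterm : ∀ t : L.Term (α ⊕ Fin n),
      r (t.realize (Sum.elim v xs)) (t.realize (Sum.elim w ys)) := by
    intro t
    cases t with
    | var i => rcases i with i | i
               · exact hvw i
               · exact hxy i
    | func f _ => exact isEmptyElim f
  induction hφ with
  | falsum => exact Iff.rfl
  | of_isAtomic h =>
    cases h with
    | equal t₁ t₂ => exact heq _ _ _ _ (hterm t₁) (hterm t₂)
    | rel R ts => exact hrel _ R _ _ fun k => hterm (ts k)
  | imp _ _ h₁ h₂ => exact imp_congr h₁ h₂

end FirstOrder.Language.BoundedFormula

/-! ### Liftings and their equivalence with quantifier-free interpretations -/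

namespace ListType

/-- The universes of the values of `f` are mapped to the universes of the arguments in a way that
depends on isomorphism types only. -/
def Lifts {a b : ListType} (f : a.Elem → b.Elem) (e : ∀ v, Univ (f v) → Univ v) : Prop :=
  (∀ v w r, PIso a v w r → PIso b (f v) (f w) fun x y => r (e v x) (e w y)) ∧
    ∀ v w r x y, PIso a v w r → r x y → (x ∈ Set.range (e v) ↔ y ∈ Set.range (e w))

/-- Pulling back the identity along `e v` gives the kernel of `e v`; being a partial isomorphism, it
cannot relate a point both to itself and to another one. -/
theorem Lifts.injective {a b : ListType} {f : a.Elem → b.Elem} {e : ∀ v, Univ (f v) → Univ v}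
    (h : Lifts f e) (hid : ∀ v, PIso a v v Eq) (v : a.Elem) : Function.Injective (e v) :=
  fun _ _ hxy => ((h.1 v v Eq (hid v)).eq_iff rfl hxy).1 rfl

theorem PIso.refl {a : ListType} (v : a.Elem) : PIso a v v Eq :=
  .of_holds (by rintro x y _ _ rfl rfl; rfl) (by
    intro n R xs ys h
    rw [funext h])

instance finite_rel (a : ListType) : Finite (Σ n, Rel a n) := by
  induction a with
  | one => exact @Finite.of_subsingleton _ ⟨fun x => nomatch x⟩
  | sum a b iha ihb =>
    let F : (Σ n, Rel a n) ⊕ (Σ n, Rel b n) ⊕ Unit → Σ n, Rel (sum a b) n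
      | .inl R => ⟨R.1, .sumLeft R.2⟩
      | .inr (.inl R) => ⟨R.1, .sumRight R.2⟩
      | .inr (.inr _) => ⟨0, .sumTag⟩
    refine Finite.of_surjective F ?_
    rintro ⟨n, R⟩
    cases R with
    | sumLeft R => exact ⟨.inl ⟨n, R⟩, rfl⟩
    | sumRight R => exact ⟨.inr (.inl ⟨n, R⟩), rfl⟩
    | sumTag => exact ⟨.inr (.inr ()), rfl⟩
  | prod a b iha ihb =>
    let F : (Σ n, Rel a n) ⊕ (Σ n, Rel b n) ⊕ Unit → Σ n, Rel (prod a b) n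
      | .inl R => ⟨R.1, .prodLeft R.2⟩
      | .inr (.inl R) => ⟨R.1, .prodRight R.2⟩
      | .inr (.inr _) => ⟨1, .prodFst⟩
    refine Finite.of_surjective F ?_
    rintro ⟨n, R⟩
    cases R with
    | prodLeft R => exact ⟨.inl ⟨n, R⟩, rfl⟩
    | prodRight R => exact ⟨.inr (.inl ⟨n, R⟩), rfl⟩
    | prodFst => exact ⟨.inr (.inr ()), rfl⟩
  | list a ih =>
    let F : (Σ n, Rel a n) ⊕ Unit → Σ n, Rel (list a) n
      | .inl ⟨0, R⟩ => ⟨1, .listNullary R⟩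
      | .inl ⟨n + 1, R⟩ => ⟨n + 1, .listItem R⟩
      | .inr _ => ⟨2, .listLe⟩
    refine Finite.of_surjective F ?_
    rintro ⟨n, R⟩
    cases R with
    | listNullary R => exact ⟨.inl ⟨0, R⟩, rfl⟩
    | listItem R => exact ⟨.inl ⟨_, R⟩, rfl⟩
    | listLe => exact ⟨.inr (), rfl⟩

/-- Properties of tuples that are invariant under partial isomorphisms are quantifier-free
definable. -/
theorem exists_isQF_of_pIso_invariant {a : ListType} {n : ℕ}
    (Q : ∀ v : a.Elem, (Fin n → Univ v) → Prop)
    (hQ : ∀ v w r xs ys, PIso a v w r → (∀ k, r (xs k) (ys k)) → (Q v xs ↔ Q w ys)) :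
    ∃ φ : a.vocab.Formula (Fin n), φ.IsQF ∧
      ∀ (v : a.Elem) (xs : Fin n → Univ v), φ.Realize xs ↔ Q v xs := by
  -- The atoms in `n` variables: every symbol with every substitution of variables, repetitions
  -- allowed, and all equalities. There are finitely many.
  let A := (Σ R : Σ m, Rel a m, Fin R.1 → Fin n) ⊕ Fin n × Fin n
  let at' : A → a.vocab.Formula (Fin n) := fun t => match t with
    | .inl ⟨⟨m, R⟩, k⟩ => Language.Relations.formula (L := a.vocab) (n := m) R
        fun i => Language.Term.var (k i)
    | .inr (i, j) => Language.Term.equal (Language.Term.var i) (Language.Term.var j)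
  have hat : ∀ t, (at' t).IsQF := by
    rintro (⟨⟨m, R⟩, k⟩ | ⟨i, j⟩)
    · exact .of_isAtomic (.rel _ _)
    · exact .of_isAtomic (.equal _ _)
  have hrel : ∀ (v : a.Elem) (xs : Fin n → Univ v) m (R : Rel a m) k,
      (at' (.inl ⟨⟨m, R⟩, k⟩)).Realize xs ↔ R.Holds v fun i => xs (k i) := by
    intro v xs m R k
    exact Language.Formula.realize_rel
  have heq : ∀ (v : a.Elem) (xs : Fin n → Univ v) i j,
      (at' (.inr (i, j))).Realize xs ↔ xs i = xs j := by
    intro v xs i j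
    simp [at']
  obtain ⟨φ, hφ, h⟩ := Language.BoundedFormula.exists_isQF_of_finite at' hat fun t =>
    ∃ (v : a.Elem) (xs : Fin n → Univ v), (t = fun i => (at' i).Realize xs) ∧ Q v xs
  refine ⟨φ, hφ, fun v xs => (h _ _).trans ⟨?_, fun hv => ⟨v, xs, rfl, hv⟩⟩⟩
  rintro ⟨w, ys, hyx, hw⟩
  -- Tuples with the same atomic type are matched, entry by entry, by a partial isomorphism.
  refine (hQ w v (fun y x => ∃ k, ys k = y ∧ xs k = x) ys xs (.of_holds ?_ ?_)
    fun k => ⟨k, rfl, rfl⟩).1 hw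
  · rintro _ _ _ _ ⟨i, rfl, rfl⟩ ⟨j, rfl, rfl⟩
    rw [← heq, ← heq]
    exact (iff_of_eq (congrFun hyx (.inr (i, j)))).symm
  · intro m R ys' xs' hr
    choose k hk hk' using hr
    have := (iff_of_eq (congrFun hyx (.inl ⟨⟨m, R⟩, k⟩))).symm
    rw [hrel, hrel] at this
    simpa only [hk, hk'] using this

end ListType

open ListType

/-- From an interpretation, `e` is the inverse of the given isomorphism followed by inclusion into
the input. From a lifting, the image of `e` and the relations carried over to it are invariant,
hence definable. -/
theorem isQFInterpretation_iff_exists_lifts {a b : ListType} {f : a.Elem → b.Elem} :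
    IsQFInterpretation f ↔ ∃ e, Lifts f e := by
  constructor
  · rintro ⟨I, hI⟩
    have e := fun v => Classical.choice (hI v)
    have hrel : ∀ v n (R : Rel b n) (xs : Fin n → Univ (f v)), R.Holds (f v) xs ↔
        (I.rel (L' := b.vocab) R).Realize fun k => ((e v).toEquiv.symm (xs k)).1 := by
      intro v n R xs
      have := (e v).map_rel' (n := n) R (fun k => (e v).toEquiv.symm (xs k))
      refine Iff.trans (iff_of_eq ?_) this
      change _ = Rel.Holds R (f v) _
      congr 1
      funext k
      exact ((e v).toEquiv.apply_symm_apply (xs k)).symm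
    have hrange : ∀ v x, x ∈ Set.range (fun u => ((e v).toEquiv.symm u).1) ↔
        I.univ.Realize fun _ => x := by
      intro v x
      constructor
      · rintro ⟨u, rfl⟩
        exact ((e v).toEquiv.symm u).2
      · intro h
        exact ⟨(e v).toEquiv ⟨x, h⟩, congrArg Subtype.val ((e v).toEquiv.symm_apply_apply ⟨x, h⟩)⟩
    refine ⟨fun v u => ((e v).toEquiv.symm u).1, fun v w r h => ?_, fun v w r x y h hxy => ?_⟩
    · refine .of_holds (fun x y x' y' hx hy => ?_) fun n R xs ys hr => ?_
      · have := h.eq_iff hx hy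
        exact (((Subtype.val_injective.comp (e v).toEquiv.symm.injective).eq_iff).symm.trans
          this).trans (Subtype.val_injective.comp (e w).toEquiv.symm.injective).eq_iff
      · rw [hrel, hrel]
        exact (I.rel_isQF R).realize_iff (fun _ _ _ _ => h.eq_iff)
          (fun n R xs ys => h.holds_iff R) hr fun i => i.elim0
    · rw [hrange, hrange]
      exact I.univ_isQF.realize_iff (fun _ _ _ _ => h.eq_iff)
          (fun n R xs ys => h.holds_iff R) (fun _ => hxy) fun i => i.elim0
  · rintro ⟨e, he⟩
    have hinj := he.injective .refl
    obtain ⟨φ, hφ, hφ'⟩ := exists_isQF_of_pIso_invariant (a := a) (n := 1)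
      (fun v xs => xs 0 ∈ Set.range (e v)) fun v w r xs ys h hr => he.2 v w r _ _ h (hr 0)
    have hR : ∀ {n : ℕ} (R : Rel b n), ∃ φ : a.vocab.Formula (Fin n), φ.IsQF ∧
        ∀ (v : a.Elem) (xs : Fin n → Univ v), φ.Realize xs ↔
          ∃ us, (xs = fun k => e v (us k)) ∧ R.Holds (f v) us := by
      intro n R
      refine exists_isQF_of_pIso_invariant (fun v xs => ∃ us, (xs = fun k => e v (us k)) ∧ R.Holds (f v) us) ?_
      intro v w r xs ys h hr
      constructor
      · rintro ⟨us, rfl, hR⟩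
        choose us' hus' using fun k => (he.2 v w r _ _ h (hr k)).1 ⟨us k, rfl⟩
        obtain rfl := funext hus'
        exact ⟨us', rfl, ((he.1 v w r h).holds_iff R hr).1 hR⟩
      · rintro ⟨us, rfl, hR⟩
        choose us' hus' using fun k => (he.2 v w r _ _ h (hr k)).2 ⟨us k, rfl⟩
        obtain rfl := funext hus'
        exact ⟨us', rfl, ((he.1 v w r h).holds_iff R hr).2 hR⟩
    choose ψ hψ hψ' using @hR
    refine ⟨⟨φ, hφ, fun {n} R => ψ (n := n) R, fun {n} R => hψ (n := n) R⟩, fun v => ⟨?_⟩⟩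
    let E : Univ (f v) ≃ {x : Univ v // φ.Realize fun _ => x} :=
      Equiv.ofBijective (fun u => ⟨e v u, (hφ' v _).2 ⟨u, rfl⟩⟩)
        ⟨fun x y h => hinj v (congrArg Subtype.val h), fun x => by
          obtain ⟨u, hu⟩ := (hφ' v _).1 x.2
          exact ⟨u, Subtype.ext hu⟩⟩
    refine ⟨E.symm, fun {n} F => isEmptyElim F, fun {n} R xs => ?_⟩
    change Rel.Holds (n := n) R (f v) _ ↔ (ψ (n := n) R).Realize _
    refine Iff.trans ?_ (hψ' (n := n) R v _).symm
    have hE : ∀ x, e v (E.symm x) = x.1 := fun x =>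
      congrArg Subtype.val (E.apply_symm_apply x)
    constructor
    · intro h
      exact ⟨_, funext fun k => (hE _).symm, h⟩
    · rintro ⟨us, hus, h⟩
      obtain rfl : us = E.symm ∘ xs := funext fun k =>
        hinj v ((congrFun hus k).symm.trans (hE _).symm)
      exact h

/-! ### Liftings of the prime functions and combinators that do not rearrange list items -/

namespace ListType

section primes
variable {a b c d : ListType}

theorem Lifts.comp {f : a.Elem → b.Elem} {g : b.Elem → c.Elem} {e : ∀ v, Univ (f v) → Univ v}
    {e' : ∀ v, Univ (g v) → Univ v} (hf : Lifts f e) (hg : Lifts g e') :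
    Lifts (fun v => g (f v)) (fun v x => e v (e' (f v) x)) := by
  refine ⟨fun v w r h => hg.1 _ _ _ (hf.1 v w r h), fun v w r x y h hxy => ?_⟩
  have hinj := hf.injective .refl
  constructor
  · rintro ⟨u, rfl⟩
    obtain ⟨u', rfl⟩ := (hf.2 v w r _ _ h hxy).1 ⟨_, rfl⟩
    obtain ⟨u'', hu''⟩ := (hg.2 _ _ _ _ u' (hf.1 v w r h) hxy).1 ⟨_, rfl⟩
    exact ⟨u'', congrArg (e w) hu''⟩
  · rintro ⟨u, rfl⟩
    obtain ⟨u', rfl⟩ := (hf.2 v w r _ _ h hxy).2 ⟨_, rfl⟩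
    obtain ⟨u'', hu''⟩ := (hg.2 _ _ _ u' _ (hf.1 v w r h) hxy).2 ⟨_, rfl⟩
    exact ⟨u'', congrArg (e v) hu''⟩

theorem Lifts.of_surjective {f : a.Elem → b.Elem} {e : ∀ v, Univ (f v) → Univ v}
    (h : ∀ v w r, PIso a v w r → PIso b (f v) (f w) fun x y => r (e v x) (e w y))
    (hs : ∀ v, Function.Surjective (e v)) : Lifts f e :=
  ⟨h, fun v w _ x y _ _ => ⟨fun _ => hs w y, fun _ => hs v x⟩⟩

/-- The two images are disjoint and invariant, so no partial isomorphism relates a point of one to a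
point of the other. Disjointness is what rules out the diagonal. -/
theorem Lifts.pair {f : a.Elem → b.Elem} {g : a.Elem → c.Elem} {e : ∀ v, Univ (f v) → Univ v}
    {e' : ∀ v, Univ (g v) → Univ v} (hf : Lifts f e) (hg : Lifts g e')
    (hd : ∀ v x y, e v x ≠ e' v y) :
    Lifts (b := prod b c) (fun v => (f v, g v)) (fun v => Sum.elim (e v) (e' v)) := by
  refine ⟨fun v w r h => ⟨fun x y hxy => ?_, fun x y hxy => ?_, hf.1 v w r h, hg.1 v w r h⟩,
    fun v w r x y h hxy => ?_⟩
  · obtain ⟨z, hz⟩ := (hf.2 v w r _ _ h hxy).1 ⟨x, rfl⟩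
    exact hd _ _ _ hz
  · obtain ⟨z, hz⟩ := (hf.2 v w r _ _ h hxy).2 ⟨y, rfl⟩
    exact hd _ _ _ hz
  · have := (hf.2 v w r _ _ h hxy).or (hg.2 v w r _ _ h hxy)
    rw [← Set.mem_union, ← Set.mem_union, ← Set.Sum.elim_range, ← Set.Sum.elim_range] at this
    exact this

theorem exists_lifts_prodComm : ∃ e, Lifts (prodComm (a := a) (b := b)) e := by
  refine ⟨fun ⟨x, y⟩ u => Sum.elim (Sum.inr : Univ y → Univ x ⊕ Univ y) Sum.inl u, .of_surjective ?_ ?_⟩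
  · rintro ⟨x, y⟩ ⟨x', y'⟩ r ⟨h1, h2, h3, h4⟩
    exact ⟨fun u v => h2 u v, fun u v => h1 u v, h4, h3⟩
  · rintro ⟨x, y⟩ (u | u)
    · exact ⟨Sum.inr u, rfl⟩
    · exact ⟨Sum.inl u, rfl⟩

theorem exists_lifts_sumComm : ∃ e, Lifts (sumComm (a := a) (b := b)) e := by
  refine ⟨fun v => match v with
    | Sum.inl _ => fun u => u
    | Sum.inr _ => fun u => u, .of_surjective ?_ ?_⟩
  · rintro (v | v) (w | w) r h
    exacts [h, h, h, h]
  · rintro (v | v) u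
    exacts [⟨u, rfl⟩, ⟨u, rfl⟩]

theorem exists_lifts_prodAssoc : ∃ e, Lifts (prodAssoc (a := a) (b := b) (c := c)) e := by
  refine ⟨fun ⟨x, (y, z)⟩ u =>
    (Equiv.sumAssoc (Univ x) (Univ y) (Univ z) u : Univ x ⊕ (Univ y ⊕ Univ z)), .of_surjective ?_ ?_⟩
  · rintro ⟨x, y, z⟩ ⟨x', y', z'⟩ r ⟨h1, h2, h3, h4, h5, h6, h7⟩
    refine ⟨?_, ?_, ⟨?_, ?_, h3, h6⟩, h7⟩
    · rintro (u | u) v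
      exacts [h1 u (Sum.inr v), h4 u v]
    · rintro u (v | v)
      exacts [h2 (Sum.inr u) v, h5 u v]
    · exact fun u v => h1 u (Sum.inl v)
    · exact fun u v => h2 (Sum.inl u) v
  · rintro ⟨x, y, z⟩
    exact (Equiv.sumAssoc (Univ x) (Univ y) (Univ z)).surjective

theorem exists_lifts_prodAssocInv : ∃ e, Lifts (prodAssocInv (a := a) (b := b) (c := c)) e := by
  refine ⟨fun ⟨(x, y), z⟩ u =>
    ((Equiv.sumAssoc (Univ x) (Univ y) (Univ z)).symm u : (Univ x ⊕ Univ y) ⊕ Univ z),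
    .of_surjective ?_ ?_⟩
  · rintro ⟨⟨x, y⟩, z⟩ ⟨⟨x', y'⟩, z'⟩ r ⟨h1, h2, ⟨h3, h4, h5, h6⟩, h7⟩
    refine ⟨?_, ?_, h5, ?_, ?_, h6, h7⟩
    · rintro u (v | v)
      exacts [h3 u v, h1 (Sum.inl u) v]
    · rintro (u | u) v
      exacts [h4 u v, h2 u (Sum.inl v)]
    · exact fun u v => h1 (Sum.inr u) v
    · exact fun u v => h2 u (Sum.inr v)
  · rintro ⟨⟨x, y⟩, z⟩
    exact (Equiv.sumAssoc (Univ x) (Univ y) (Univ z)).symm.surjective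

theorem exists_lifts_sumAssoc : ∃ e, Lifts (sumAssoc (a := a) (b := b) (c := c)) e := by
  refine ⟨fun v => match v with
    | Sum.inl _ => fun u => u
    | Sum.inr (Sum.inl _) => fun u => u
    | Sum.inr (Sum.inr _) => fun u => u, .of_surjective ?_ ?_⟩
  · rintro (v | v | v) (w | w | w) r h
    exacts [h, h, h, h, h, h, h, h, h]
  · rintro (v | v | v) u
    exacts [⟨u, rfl⟩, ⟨u, rfl⟩, ⟨u, rfl⟩]

theorem exists_lifts_sumAssocInv : ∃ e, Lifts (sumAssocInv (a := a) (b := b) (c := c)) e := by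
  refine ⟨fun v => match v with
    | Sum.inl (Sum.inl _) => fun u => u
    | Sum.inl (Sum.inr _) => fun u => u
    | Sum.inr _ => fun u => u, .of_surjective ?_ ?_⟩
  · rintro ((v | v) | v) ((w | w) | w) r h
    exacts [h, h, h, h, h, h, h, h, h]
  · rintro ((v | v) | v) u
    exacts [⟨u, rfl⟩, ⟨u, rfl⟩, ⟨u, rfl⟩]

theorem exists_lifts_distrib : ∃ e, Lifts (distrib (a := a) (b := b) (c := c)) e := by
  refine ⟨fun v => match v with
    | (_, Sum.inl _) => fun u => u
    | (_, Sum.inr _) => fun u => u, .of_surjective ?_ ?_⟩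
  · rintro ⟨v', v | v⟩ ⟨w', w | w⟩ r h
    · exact h
    · exact h.2.2.2
    · exact h.2.2.2
    · exact h
  · rintro ⟨v', v | v⟩ u
    exacts [⟨u, rfl⟩, ⟨u, rfl⟩]

theorem exists_lifts_distribInv : ∃ e, Lifts (distribInv (a := a) (b := b) (c := c)) e := by
  refine ⟨fun v => match v with
    | Sum.inl (_, _) => fun u => u
    | Sum.inr (_, _) => fun u => u, .of_surjective ?_ ?_⟩
  · rintro (⟨v', v⟩ | ⟨v', v⟩) (⟨w', w⟩ | ⟨w', w⟩) r h
    · exact h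
    · exact h.elim
    · exact h.elim
    · exact h
  · rintro (⟨v', v⟩ | ⟨v', v⟩) u
    exacts [⟨u, rfl⟩, ⟨u, rfl⟩]

theorem lifts_fst : Lifts (fst (a := a) (b := b)) fun v (u : Univ v.1) =>
    (Sum.inl u : Univ v.1 ⊕ Univ v.2) := by
  refine ⟨fun v w r h => h.2.2.1, fun v w r x y h hxy => ?_⟩
  rcases x with x | x <;> rcases y with y | y
  · exact ⟨fun _ => ⟨y, rfl⟩, fun _ => ⟨x, rfl⟩⟩
  · exact (h.1 _ _ hxy).elim
  · exact (h.2.1 _ _ hxy).elim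
  · exact ⟨fun ⟨u, hu⟩ => (Sum.inl_ne_inr hu).elim, fun ⟨u, hu⟩ => (Sum.inl_ne_inr hu).elim⟩

theorem lifts_snd : Lifts (snd (a := a) (b := b)) fun v (u : Univ v.2) =>
    (Sum.inr u : Univ v.1 ⊕ Univ v.2) := by
  refine ⟨fun v w r h => h.2.2.2, fun v w r x y h hxy => ?_⟩
  rcases x with x | x <;> rcases y with y | y
  · exact ⟨fun ⟨u, hu⟩ => (Sum.inr_ne_inl hu).elim, fun ⟨u, hu⟩ => (Sum.inr_ne_inl hu).elim⟩
  · exact (h.1 _ _ hxy).elim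
  · exact (h.2.1 _ _ hxy).elim
  · exact ⟨fun _ => ⟨y, rfl⟩, fun _ => ⟨x, rfl⟩⟩

theorem lifts_inl : Lifts (inl (a := a) (b := b)) fun _ u => u :=
  .of_surjective (fun _ _ _ h => h) fun _ u => ⟨u, rfl⟩

theorem lifts_inr : Lifts (inr (a := a) (b := b)) fun _ u => u :=
  .of_surjective (fun _ _ _ h => h) fun _ u => ⟨u, rfl⟩

theorem exists_lifts_codiag : ∃ e, Lifts (codiag (a := a)) e := by
  refine ⟨fun v => match v with
    | Sum.inl _ => fun u => u
    | Sum.inr _ => fun u => u, .of_surjective ?_ ?_⟩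
  · rintro (v | v) (w | w) r h
    exacts [h, h.elim, h.elim, h]
  · rintro (v | v) u
    exacts [⟨u, rfl⟩, ⟨u, rfl⟩]

theorem exists_lifts_createEmpty : ∃ e, Lifts (createEmpty (a := a) (b := b)) e := by
  refine ⟨fun v u => Sum.elim (fun x => x) (fun x => x.1.elim0) u, .of_surjective ?_ ?_⟩
  · intro v w r h
    exact ⟨fun _ v => v.1.elim0, fun u => u.1.elim0, h, fun u => u.1.elim0, fun u => u.1.elim0⟩
  · exact fun v u => ⟨Sum.inl u, rfl⟩

theorem Lifts.prodMap {f : a.Elem → b.Elem} {g : c.Elem → d.Elem} {e : ∀ v, Univ (f v) → Univ v}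
    {e' : ∀ v, Univ (g v) → Univ v} (hf : Lifts f e) (hg : Lifts g e') :
    ∃ e, Lifts (prodMap f g) e :=
  ⟨_, (lifts_fst.comp hf).pair (lifts_snd.comp hg) fun _ _ _ => Sum.inl_ne_inr⟩

theorem Lifts.sumMap {f : a.Elem → b.Elem} {g : c.Elem → d.Elem} {e : ∀ v, Univ (f v) → Univ v}
    {e' : ∀ v, Univ (g v) → Univ v} (hf : Lifts f e) (hg : Lifts g e') :
    ∃ e, Lifts (sumMap f g) e := by
  refine ⟨fun v => match v with
    | Sum.inl v => fun u => e v u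
    | Sum.inr v => fun u => e' v u, ?_, ?_⟩
  · rintro (v | v) (w | w) r h
    exacts [hf.1 v w r h, h.elim, h.elim, hg.1 v w r h]
  · rintro (v | v) (w | w) r x y h hxy
    exacts [hf.2 v w r x y h hxy, h.elim, h.elim, hg.2 v w r x y h hxy]

end primes

end ListType

/-! ### Positions in lists and liftings of the list functions -/

/-- A position in the concatenation is sent to the position `i` of its block and the position `j`
inside the block; the order is lexicographic. Plain natural numbers keep dependent indices out of
the induction. -/
theorem List.exists_flatMap_index {X Y : Type} (h : X → List Y) (l : List X) :
    ∃ i j : ℕ → ℕ,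
      (∀ k y, (l.flatMap h)[k]? = some y → ∃ x, l[i k]? = some x ∧ (h x)[j k]? = some y) ∧
      (∀ k k', k < (l.flatMap h).length → k' < (l.flatMap h).length →
        (k ≤ k' ↔ i k < i k' ∨ i k = i k' ∧ j k ≤ j k')) ∧
      ∀ x m n, l[m]? = some x → n < (h x).length →
        ∃ k < (l.flatMap h).length, i k = m ∧ j k = n := by
  induction l with
  | nil => exact ⟨id, id, by simp, by simp, by simp⟩
  | cons x l ih =>
    obtain ⟨i, j, h1, h2, h3⟩ := ih
    refine ⟨fun k => if k < (h x).length then 0 else i (k - (h x).length) + 1,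
      fun k => if k < (h x).length then k else j (k - (h x).length), ?_, ?_, ?_⟩
    · intro k y hk
      rw [List.flatMap_cons, List.getElem?_append] at hk
      dsimp only
      split_ifs at hk ⊢
      · exact ⟨x, rfl, hk⟩
      · exact h1 _ _ hk
    · intro k k' hk hk'
      rw [List.flatMap_cons, List.length_append] at hk hk'
      dsimp only
      split_ifs with h4 h5 h5
      · omega
      · simp only [Nat.zero_lt_succ, true_or, iff_true]
        omega
      · simp only [Nat.not_lt_zero, false_and, or_false, iff_false]
        omega
      · have := h2 (k - (h x).length) (k' - (h x).length) (by omega) (by omega)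
        rw [Nat.add_lt_add_iff_right, Nat.add_right_cancel_iff, ← this]
        omega
    · intro y m n hm hn
      rw [List.flatMap_cons, List.length_append]
      cases m with
      | zero =>
        obtain rfl : x = y := by simpa using hm
        exact ⟨n, by omega, by simp [hn]⟩
      | succ m =>
        obtain ⟨k, hk, rfl, rfl⟩ := h3 y m n (by simpa using hm) hn
        exact ⟨(h x).length + k, by omega, by simp⟩

namespace ListType

variable {a b c : ListType}

/-- The elements of a list type that can be items of a list. -/
abbrev Item (a : ListType) : Type := {x : a.Elem // Nonempty (Univ x)}

/-- Transport between the universes of equal elements. -/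
def castUniv {v w : a.Elem} (h : v = w) (x : Univ v) : Univ w := h ▸ x

theorem castUniv_surjective {v w : a.Elem} (h : v = w) : Function.Surjective (castUniv h) := by
  subst h
  exact fun x => ⟨x, rfl⟩

theorem leaf_castUniv {v w : a.Elem} (h : v = w) (x : Univ v) :
    leaf w (castUniv h x) = leaf v x := by
  subst h
  rfl

theorem pIso_castUniv {v v' w w' : a.Elem} (hv : v = v') (hw : w = w')
    {r : Univ v' → Univ w' → Prop} :
    PIso a v w (fun x y => r (castUniv hv x) (castUniv hw y)) ↔ PIso a v' w' r := by
  subst hv hw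
  exact Iff.rfl

/-- The universe of a family of items. -/
abbrev FamUniv {J : Type} (p : J → Item a) : Type := Σ j, Univ (p j).1

/-- Partial isomorphisms between lists that are given as families over preordered sets. -/
def FamIso {J J' : Type} (le : J → J → Prop) (le' : J' → J' → Prop) (p : J → Item a)
    (p' : J' → Item a) (r : FamUniv p → FamUniv p' → Prop) : Prop :=
  (∀ x y x' y', r x x' → r y y' → (le x.1 y.1 ↔ le' x'.1 y'.1)) ∧
    ∀ x x', r x x' → PIso a (p x.1).1 (p' x'.1).1 fun u v => r ⟨x.1, u⟩ ⟨x'.1, v⟩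

/-- The map between universes that comes with a map between index sets. -/
def reindex {J K : Type} {p : J → Item a} {q : K → Item a} (f : K → J) (h : ∀ k, q k = p (f k))
    (x : FamUniv q) : FamUniv p :=
  ⟨f x.1, castUniv (congrArg Subtype.val (h x.1)) x.2⟩

theorem reindex_surjective {J K : Type} {p : J → Item a} {q : K → Item a} {f : K → J}
    (h : ∀ k, q k = p (f k)) (hf : Function.Surjective f) :
    Function.Surjective (reindex f h) := by
  rintro ⟨j, x⟩
  obtain ⟨k, rfl⟩ := hf j
  obtain ⟨y, rfl⟩ := castUniv_surjective (congrArg Subtype.val (h k)) x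
  exact ⟨⟨k, y⟩, rfl⟩

/-- Operations that only select or rearrange items transfer partial isomorphisms. The orders are
arbitrary relations, so that reversed and lexicographic orders are covered. -/
theorem FamIso.reindex {J J' K K' : Type} {le : J → J → Prop} {le' : J' → J' → Prop}
    {ke : K → K → Prop} {ke' : K' → K' → Prop} {p : J → Item a} {p' : J' → Item a}
    {q : K → Item a} {q' : K' → Item a} {r : FamUniv p → FamUniv p' → Prop}
    (hr : FamIso le le' p p' r) {f : K → J} (h : ∀ k, q k = p (f k)) {f' : K' → J'}
    (h' : ∀ k, q' k = p' (f' k)) (hf : ∀ i j, ke i j ↔ le (f i) (f j))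
    (hf' : ∀ i j, ke' i j ↔ le' (f' i) (f' j)) :
    FamIso ke ke' q q' fun x y => r (ListType.reindex f h x) (ListType.reindex f' h' y) := by
  refine ⟨fun x y x' y' hx hy => ?_, fun x x' hx => ?_⟩
  · rw [hf, hf']
    exact hr.1 _ _ _ _ hx hy
  · exact (pIso_castUniv (congrArg Subtype.val (h x.1)) (congrArg Subtype.val (h' x'.1))).2
      (hr.2 _ _ hx)

theorem FamIso.of_reindex {J J' K K' : Type} {le : J → J → Prop} {le' : J' → J' → Prop}
    {ke : K → K → Prop} {ke' : K' → K' → Prop} {p : J → Item a} {p' : J' → Item a}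
    {q : K → Item a} {q' : K' → Item a} {r : FamUniv p → FamUniv p' → Prop}
    {f : K → J} (h : ∀ k, q k = p (f k)) {f' : K' → J'}
    (h' : ∀ k, q' k = p' (f' k)) (hf : ∀ i j, ke i j ↔ le (f i) (f j))
    (hf' : ∀ i j, ke' i j ↔ le' (f' i) (f' j)) (hs : Function.Surjective f)
    (hs' : Function.Surjective f')
    (hr : FamIso ke ke' q q' fun x y => r (ListType.reindex f h x) (ListType.reindex f' h' y)) :
    FamIso le le' p p' r := by
  have hs := reindex_surjective h hs
  have hs' := reindex_surjective h' hs'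
  refine ⟨fun x y x' y' hx hy => ?_, fun x x' hx => ?_⟩
  · obtain ⟨x, rfl⟩ := hs x
    obtain ⟨y, rfl⟩ := hs y
    obtain ⟨x', rfl⟩ := hs' x'
    obtain ⟨y', rfl⟩ := hs' y'
    have := hr.1 _ _ _ _ hx hy
    rwa [hf, hf'] at this
  · obtain ⟨x, rfl⟩ := hs x
    obtain ⟨x', rfl⟩ := hs' x'
    exact (pIso_castUniv (congrArg Subtype.val (h x.1)) (congrArg Subtype.val (h' x'.1))).1
      (hr.2 _ _ hx)

/-! Concatenation of two lists -/

/-- The position in the two summands of a position in the concatenation. -/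
def appendIdx {X : Type} (l m : List X) (k : Fin (l ++ m).length) : Fin l.length ⊕ Fin m.length :=
  if h : k.1 < l.length then Sum.inl ⟨k.1, h⟩
  else Sum.inr ⟨k.1 - l.length, by have := k.2.trans_eq List.length_append; omega⟩

theorem get_append_eq {X : Type} (l m : List X) (k : Fin (l ++ m).length) :
    (l ++ m).get k = Sum.elim l.get m.get (appendIdx l m k) := by
  unfold appendIdx
  split_ifs with h
  · simp [List.getElem_append_left h]
  · simp [List.getElem_append_right (not_lt.1 h)]

/-- The order of the concatenation. -/
def AppendLe {m n : ℕ} : Fin m ⊕ Fin n → Fin m ⊕ Fin n → Prop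
  | Sum.inl i, Sum.inl j => i ≤ j
  | Sum.inl _, Sum.inr _ => True
  | Sum.inr _, Sum.inl _ => False
  | Sum.inr i, Sum.inr j => i ≤ j

theorem le_iff_appendIdx {X : Type} (l m : List X) (i j : Fin (l ++ m).length) :
    i ≤ j ↔ AppendLe (appendIdx l m i) (appendIdx l m j) := by
  unfold appendIdx
  rw [Fin.le_def]
  split_ifs with h1 h2 h2 <;> simp only [AppendLe, Fin.le_def, iff_true, iff_false] <;> omega

theorem appendIdx_surjective {X : Type} (l m : List X) : Function.Surjective (appendIdx l m) := by
  rintro (⟨k, hk⟩ | ⟨k, hk⟩)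
  · exact ⟨⟨k, by rw [List.length_append]; omega⟩, by simp [appendIdx, hk]⟩
  · exact ⟨⟨l.length + k, by rw [List.length_append]; omega⟩, by simp [appendIdx]⟩

/-- The concatenation of two lists. -/
def appendLists : (prod (list a) (list a)).Elem → (list a).Elem :=
  fun (l, m) => ofItems (items l ++ items m)

theorem exists_lifts_appendLists : ∃ e, Lifts (appendLists (a := a)) e := by
  let F : ∀ l m : List (Item a), FamUniv (Sum.elim l.get m.get) → FamUniv l.get ⊕ FamUniv m.get :=
    fun l m x => match x with
      | ⟨Sum.inl i, u⟩ => Sum.inl ⟨i, u⟩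
      | ⟨Sum.inr i, u⟩ => Sum.inr ⟨i, u⟩
  refine ⟨fun ⟨l, m⟩ x => F l m (reindex (appendIdx l m) (get_append_eq l m) x),
    .of_surjective ?_ ?_⟩
  · rintro ⟨l, m⟩ ⟨l', m'⟩ r ⟨h1, h2, h3, h4⟩
    refine FamIso.reindex (r := fun x y => r (F l m x) (F l' m' y)) ⟨?_, ?_⟩ (get_append_eq l m)
      (get_append_eq l' m') (le_iff_appendIdx l m) (le_iff_appendIdx l' m')
    · rintro ⟨i | i, x⟩ ⟨j | j, y⟩ ⟨i' | i', x'⟩ ⟨j' | j', y'⟩ hx hy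
      all_goals first
        | exact (h1 _ _ hx).elim | exact (h2 _ _ hx).elim | exact (h1 _ _ hy).elim
        | exact (h2 _ _ hy).elim | skip
      · exact h3.1 _ _ _ _ hx hy
      · exact Iff.rfl
      · exact Iff.rfl
      · exact h4.1 _ _ _ _ hx hy
    · rintro ⟨i | i, x⟩ ⟨i' | i', x'⟩ hx
      · exact h3.2 _ _ hx
      · exact (h1 _ _ hx).elim
      · exact (h2 _ _ hx).elim
      · exact h4.2 _ _ hx
  · rintro ⟨l, m⟩
    refine Function.Surjective.comp (g := F l m) ?_ (reindex_surjective _ (appendIdx_surjective l m))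
    rintro (⟨i, u⟩ | ⟨i, u⟩)
    · exact ⟨⟨Sum.inl i, u⟩, rfl⟩
    · exact ⟨⟨Sum.inr i, u⟩, rfl⟩

/-! Reversal -/

theorem exists_lifts_reverse : ∃ e, Lifts (reverse (a := a)) e ∧
    ∀ l x y, (e l x).1 ≤ (e l y).1 ↔ y.1 ≤ x.1 := by
  let f : ∀ l : List (Item a), Fin l.reverse.length → Fin l.length := fun l k =>
    (Fin.cast (List.length_reverse) k).rev
  have hf : ∀ (l : List (Item a)) k, l.reverse.get k = l.get (f l k) := by
    intro l k
    simp only [List.get_eq_getElem, List.getElem_reverse, f, Fin.val_rev, Fin.val_cast]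
    congr 1
    omega
  have hle : ∀ (l : List (Item a)) (i j : Fin l.reverse.length), i ≤ j ↔ f l j ≤ f l i := fun l i j => by
    simp only [f, Fin.rev_le_rev, Fin.cast_le_cast]
  refine ⟨fun l x => reindex (f l) (hf l) x, .of_surjective ?_ ?_, ?_⟩
  · rintro l l' r ⟨h1, h2⟩
    exact FamIso.reindex (le := fun x y => y ≤ x) (le' := fun x y => y ≤ x)
      ⟨fun x y x' y' hx hy => h1 _ _ _ _ hy hx, h2⟩ (hf l) (hf l') (hle l) (hle l')
  · exact fun l => reindex_surjective _ fun k =>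
      ⟨Fin.cast (List.length_reverse).symm k.rev, Fin.rev_rev k⟩
  · exact fun l x y => (hle l _ _).symm

/-! One-item lists -/

theorem get_single (x : a.Elem) (k : Fin (single x).length) : ((single x).get k).1 = x := by
  have : ∀ y ∈ single x, y.1 = x := by
    intro y hy
    unfold single at hy
    split_ifs at hy with h
    · rw [List.mem_singleton.1 hy]
    · simp at hy
  exact this _ (List.get_mem _ _)

theorem length_single_le (x : a.Elem) : (single x).length ≤ 1 := by
  unfold single
  split_ifs <;> simp

/-- The map between universes for the function that creates one-item lists. -/
noncomputable def singleLift (x : a.Elem) (u : Univ (a := list a) (ofItems (single x))) : Univ x :=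
  castUniv (get_single x u.1) u.2

theorem lifts_single : Lifts (fun x : a.Elem => ofItems (single x)) singleLift := by
  refine .of_surjective (fun v w r h => ⟨fun x y x' y' hx hy => ?_, fun x x' hx => ?_⟩) ?_
  · have : ∀ {v : a.Elem} (i j : Fin (single v).length), i ≤ j := fun {v} i j => by
      have := length_single_le v
      rw [Fin.le_def]
      omega
    exact iff_of_true (this _ _) (this _ _)
  · exact (pIso_castUniv (get_single v x.1) (get_single w x'.1)).2 h
  · intro v x
    have hk : 0 < (single v).length := by
      unfold single
      rw [dif_pos ⟨x⟩]
      simp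
    obtain ⟨y, hy⟩ := castUniv_surjective (get_single v ⟨0, hk⟩) x
    exact ⟨⟨⟨0, hk⟩, y⟩, hy⟩

/-! Maps to lists, applied to the items of a list -/

/-- Apply `h` to every item and concatenate the results. -/
def bind (h : Item a → (list b).Elem) (l : (list a).Elem) : (list b).Elem :=
  ofItems ((items l).flatMap fun x => items (h x))

/-- The positions in the results of applying `h` to the items of a list. -/
abbrev BindIdx (h : Item a → (list b).Elem) (l : (list a).Elem) : Type :=
  Σ i : Fin (items l).length, Fin (items (h ((items l).get i))).length

/-- The lexicographic order on positions. -/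
def BindIdx.Le {h : Item a → (list b).Elem} {l : (list a).Elem} (i j : BindIdx h l) : Prop :=
  i.1 < j.1 ∨ i.1 = j.1 ∧ i.2.1 ≤ j.2.1

/-- The item at a position. -/
abbrev BindIdx.item {h : Item a → (list b).Elem} {l : (list a).Elem} (i : BindIdx h l) : Item b :=
  (items (h ((items l).get i.1))).get i.2

theorem exists_bindIdx (h : Item a → (list b).Elem) (l : (list a).Elem) :
    ∃ f : Fin (items (bind h l)).length → BindIdx h l,
      (∀ k, (items (bind h l)).get k = (f k).item) ∧ (∀ i j, i ≤ j ↔ (f i).Le (f j)) ∧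
      Function.Surjective f := by
  obtain ⟨i, j, h1, h2, h3⟩ := List.exists_flatMap_index (fun x => items (h x)) (items l)
  have : ∀ k : Fin (items (bind h l)).length, ∃ p : BindIdx h l,
      (items (bind h l)).get k = p.item ∧ p.1.1 = i k.1 ∧ p.2.1 = j k.1 := by
    intro k
    obtain ⟨x, hx, hy⟩ := h1 k.1 _ (List.getElem?_eq_getElem k.2)
    obtain ⟨hi, rfl⟩ := List.getElem?_eq_some_iff.1 hx
    obtain ⟨hj, hj'⟩ := List.getElem?_eq_some_iff.1 hy
    exact ⟨⟨⟨i k.1, hi⟩, ⟨j k.1, hj⟩⟩, hj'.symm, rfl, rfl⟩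
  choose f hf hf1 hf2 using this
  refine ⟨f, hf, fun k k' => ?_, ?_⟩
  · rw [Fin.le_def, h2 _ _ k.2 k'.2, BindIdx.Le, Fin.lt_def, Fin.ext_iff, hf1, hf1, hf2, hf2]
  · rintro ⟨m, n⟩
    obtain ⟨k, hk, hkm, hkn⟩ := h3 _ m.1 n.1 (List.getElem?_eq_getElem m.2) n.2
    refine ⟨⟨k, hk⟩, ?_⟩
    have h1 := hf1 ⟨k, hk⟩
    have h2 := hf2 ⟨k, hk⟩
    generalize f ⟨k, hk⟩ = p at h1 h2
    obtain ⟨p, q⟩ := p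
    obtain rfl : p = m := Fin.ext (h1.trans hkm)
    obtain rfl : q = n := Fin.ext (h2.trans hkn)
    rfl

/-- The version of `Lifts` for functions that are defined on items only. -/
def ItemLifts (h : Item a → (list b).Elem) (e : ∀ v, Univ (h v) → Univ v.1) : Prop :=
  (∀ v w r, PIso a v.1 w.1 r → PIso (list b) (h v) (h w) fun x y => r (e v x) (e w y)) ∧
    ∀ v w r x y, PIso a v.1 w.1 r → r x y → (x ∈ Set.range (e v) ↔ y ∈ Set.range (e w))

/-- The map from the universe of the results of applying `h` to the universe of a list. -/
def bindLift {h : Item a → (list b).Elem} (e : ∀ v, Univ (h v) → Univ v.1) (l : (list a).Elem)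
    (x : FamUniv (BindIdx.item (h := h) (l := l))) : Univ l :=
  ⟨x.1.1, e _ ⟨x.1.2, x.2⟩⟩

theorem range_bindLift {h : Item a → (list b).Elem} (e : ∀ v, Univ (h v) → Univ v.1)
    (l : (list a).Elem) (x : Univ l) :
    x ∈ Set.range (bindLift e l) ↔ x.2 ∈ Set.range (e (List.get l x.1)) := by
  obtain ⟨i, x⟩ := x
  constructor
  · rintro ⟨⟨⟨i', j⟩, u⟩, hu⟩
    unfold bindLift at hu
    obtain ⟨rfl, hu⟩ := Sigma.mk.inj_iff.1 hu
    exact ⟨⟨j, u⟩, eq_of_heq hu⟩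
  · rintro ⟨⟨j, u⟩, hu⟩
    exact ⟨⟨⟨i, j⟩, u⟩, Sigma.mk.inj_iff.2 ⟨rfl, heq_of_eq hu⟩⟩

/-- The description of the range is recorded for `exists_lifts_listDistrib`, where the images of the
two projections have to be disjoint. -/
theorem exists_lifts_bind {h : Item a → (list b).Elem} {e : ∀ v, Univ (h v) → Univ v.1}
    (he : ItemLifts h e) : ∃ e', Lifts (bind h) e' ∧
      ∀ l x, x ∈ Set.range (e' l) ↔ x.2 ∈ Set.range (e (List.get l x.1)) := by
  choose f hf1 hf2 hf3 using exists_bindIdx h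
  have hrange : ∀ l x, x ∈ Set.range (fun y => bindLift e l (reindex (f l) (hf1 l) y)) ↔
      x.2 ∈ Set.range (e (List.get l x.1)) := fun l x => by
    rw [← range_bindLift]
    exact Set.ext_iff.1 ((reindex_surjective (hf1 l) (hf3 l)).range_comp (bindLift e l)) x
  refine ⟨fun l x => bindLift e l (reindex (f l) (hf1 l) x), ⟨fun l l' r hr => ?_,
    fun l l' r x y hr hxy => ?_⟩, hrange⟩
  · refine FamIso.reindex (r := fun x y => r (bindLift e l x) (bindLift e l' y)) ⟨?_, ?_⟩
      (hf1 l) (hf1 l') (hf2 l) (hf2 l')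
    · rintro ⟨⟨i, j⟩, x⟩ ⟨⟨i₂, j₂⟩, y⟩ ⟨⟨i', j'⟩, x'⟩ ⟨⟨i₂', j₂'⟩, y'⟩ hx hy
      have h1 : i ≤ i₂ ↔ i' ≤ i₂' := hr.1 _ _ _ _ hx hy
      -- With both comparisons, equality of input items is preserved as well, which the
      -- lexicographic order requires.
      have h2 : i₂ ≤ i ↔ i₂' ≤ i' := hr.1 _ _ _ _ hy hx
      unfold BindIdx.Le
      dsimp only
      refine or_congr (by rw [← not_le, ← not_le, h2])
        ⟨fun ⟨e1, e2⟩ => ?_, fun ⟨e1, e2⟩ => ?_⟩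
      · subst e1
        obtain rfl : i' = i₂' := le_antisymm (h1.1 le_rfl) (h2.1 le_rfl)
        exact ⟨rfl, ((he.1 _ _ _ (hr.2 _ _ hx)).1 ⟨j, x⟩ ⟨j₂, y⟩ ⟨j', x'⟩ ⟨j₂', y'⟩ hx hy).1 e2⟩
      · subst e1
        obtain rfl : i = i₂ := le_antisymm (h1.2 le_rfl) (h2.2 le_rfl)
        exact ⟨rfl, ((he.1 _ _ _ (hr.2 _ _ hx)).1 ⟨j, x⟩ ⟨j₂, y⟩ ⟨j', x'⟩ ⟨j₂', y'⟩ hx hy).2 e2⟩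
    · rintro ⟨⟨i, j⟩, x⟩ ⟨⟨i', j'⟩, x'⟩ hx
      exact (he.1 _ _ _ (hr.2 _ _ hx)).2 ⟨j, x⟩ ⟨j', x'⟩ hx
  · exact (hrange l x).trans ((he.2 _ _ _ _ _ (hr.2 _ _ hxy) hxy).trans (hrange l' y).symm)

theorem Lifts.itemLifts {f : a.Elem → (list b).Elem} {e : ∀ v, Univ (f v) → Univ v}
    (h : Lifts f e) : ItemLifts (fun x => f x.1) (fun x => e x.1) :=
  ⟨fun v w => h.1 v.1 w.1, fun v w => h.2 v.1 w.1⟩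

theorem exists_lifts_append : ∃ e, Lifts (append (a := a)) e := by
  obtain ⟨e, he⟩ := exists_lifts_appendLists (a := a)
  obtain ⟨e', he'⟩ := Lifts.prodMap (a := list a)
    (.of_surjective (f := fun l => l) (e := fun _ x => x) (fun _ _ _ h => h) fun _ u => ⟨u, rfl⟩)
    (lifts_single (a := a))
  exact ⟨_, he'.comp he⟩

theorem exists_lifts_concat : ∃ e, Lifts (concat (a := a)) e := by
  obtain ⟨e, he, -⟩ := exists_lifts_bind (h := fun x : Item (list a) => x.1) (e := fun _ u => u)
    ⟨fun _ _ _ h => h, fun _ _ _ _ _ _ _ => iff_of_true ⟨_, rfl⟩ ⟨_, rfl⟩⟩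
  exact ⟨e, he⟩

theorem Lifts.listMap {f : a.Elem → b.Elem} {e : ∀ v, Univ (f v) → Univ v} (h : Lifts f e) :
    ∃ e, Lifts (listMap f) e := by
  obtain ⟨e, he, -⟩ := exists_lifts_bind (h.comp lifts_single).itemLifts
  exact ⟨e, he⟩

theorem exists_lifts_listDistrib : ∃ e, Lifts (listDistrib (a := a) (b := b)) e := by
  obtain ⟨e, he, hr⟩ := exists_lifts_bind ((lifts_fst (a := a) (b := b)).comp lifts_single).itemLifts
  obtain ⟨e', he', hr'⟩ :=
    exists_lifts_bind ((lifts_snd (a := a) (b := b)).comp lifts_single).itemLifts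
  refine ⟨_, he.pair he' fun l x y hxy => ?_⟩
  obtain ⟨u, hu⟩ := (hr l _).1 ⟨x, rfl⟩
  obtain ⟨u', hu'⟩ := (hr' l (e l x)).1 ⟨y, hxy.symm⟩
  exact Sum.inl_ne_inr (hu.trans hu'.symm)

end ListType

open ListType in
theorem Derivable.exists_lifts {a b : ListType} {f : a.Elem → b.Elem} (h : Derivable f) :
    ∃ e, Lifts f e := by
  induction h with
  | prodComm => exact exists_lifts_prodComm
  | sumComm => exact exists_lifts_sumComm
  | prodAssoc => exact exists_lifts_prodAssoc
  | prodAssocInv => exact exists_lifts_prodAssocInv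
  | sumAssoc => exact exists_lifts_sumAssoc
  | sumAssocInv => exact exists_lifts_sumAssocInv
  | distrib => exact exists_lifts_distrib
  | distribInv => exact exists_lifts_distribInv
  | fst => exact ⟨_, lifts_fst⟩
  | snd => exact ⟨_, lifts_snd⟩
  | inl => exact ⟨_, lifts_inl⟩
  | inr => exact ⟨_, lifts_inr⟩
  | codiag => exact exists_lifts_codiag
  | append => exact exists_lifts_append
  | reverse => exact exists_lifts_reverse.imp fun _ h => h.1
  | concat => exact exists_lifts_concat
  | createEmpty => exact exists_lifts_createEmpty
  | listDistrib => exact exists_lifts_listDistrib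
  | comp _ _ hf hg =>
    obtain ⟨_, hf⟩ := hf
    obtain ⟨_, hg⟩ := hg
    exact ⟨_, hf.comp hg⟩
  | prodMap _ _ hf hg =>
    obtain ⟨_, hf⟩ := hf
    obtain ⟨_, hg⟩ := hg
    exact hf.prodMap hg
  | sumMap _ _ hf hg =>
    obtain ⟨_, hf⟩ := hf
    obtain ⟨_, hg⟩ := hg
    exact hf.sumMap hg
  | listMap _ hf =>
    obtain ⟨_, hf⟩ := hf
    exact hf.listMap

/-! ### Rigidity of structures, nullary equivalence and leaves -/

namespace ListType

variable {a b c d : ListType}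

/-- Elements with isomorphic structures are equal. -/
theorem PIso.eq_of_total {v w : a.Elem} {r : Univ v → Univ w → Prop} (h : PIso a v w r)
    (hl : ∀ x, ∃ y, r x y) (hr : ∀ y, ∃ x, r x y) : v = w := by
  induction a with
  | one => rfl
  | sum a b iha ihb =>
    rcases v with v | v <;> rcases w with w | w
    · exact congrArg Sum.inl (iha (v := v) (w := w) h hl hr)
    · exact h.elim
    · exact h.elim
    · exact congrArg Sum.inr (ihb (v := v) (w := w) h hl hr)
  | prod a b iha ihb =>
    rcases v with ⟨v, v'⟩
    rcases w with ⟨w, w'⟩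
    obtain ⟨h1, h2, h3, h4⟩ := h
    refine Prod.ext (iha h3 (fun x => ?_) fun y => ?_) (ihb h4 (fun x => ?_) fun y => ?_)
    · obtain ⟨y | y, hy⟩ := hl (Sum.inl x)
      exacts [⟨y, hy⟩, (h1 _ _ hy).elim]
    · obtain ⟨x | x, hx⟩ := hr (Sum.inl y)
      exacts [⟨x, hx⟩, (h2 _ _ hx).elim]
    · obtain ⟨y | y, hy⟩ := hl (Sum.inr x)
      exacts [(h2 _ _ hy).elim, ⟨y, hy⟩]
    · obtain ⟨x | x, hx⟩ := hr (Sum.inr y)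
      exacts [(h1 _ _ hx).elim, ⟨x, hx⟩]
  | list a ih =>
    obtain ⟨h1, h2⟩ := h
    -- Items are nonempty, so totality of `r` on points yields a total map on positions.
    have key : ∀ i : Fin (List.length v), ∃ j : Fin (List.length w), ∃ x y, r ⟨i, x⟩ ⟨j, y⟩ := by
      intro i
      obtain ⟨x⟩ := (List.get v i).2
      obtain ⟨⟨j, y⟩, hy⟩ := hl ⟨i, x⟩
      exact ⟨j, x, y, hy⟩
    choose g x y hg using key
    have hmono : ∀ i j, g i ≤ g j ↔ i ≤ j := fun i j => (h1 _ _ _ _ (hg i) (hg j)).symm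
    have hget : ∀ z z', r z z' → g z.1 = z'.1 := fun z z' hz =>
      le_antisymm ((h1 _ _ _ _ (hg z.1) hz).1 le_rfl) ((h1 _ _ _ _ hz (hg z.1)).1 le_rfl)
    have hsurj : Function.Surjective g := by
      intro j
      obtain ⟨y⟩ := (List.get w j).2
      obtain ⟨z, hz⟩ := hr ⟨j, y⟩
      exact ⟨z.1, hget _ _ hz⟩
    have hinj : Function.Injective g := fun i j hij =>
      le_antisymm ((hmono i j).1 hij.le) ((hmono j i).1 hij.ge)
    -- An order isomorphism between finite initial segments of `ℕ` preserves values, so items are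
    -- matched at equal positions.
    let G : Fin (List.length v) ≃o Fin (List.length w) :=
      { Equiv.ofBijective g ⟨hinj, hsurj⟩ with map_rel_iff' := fun {i j} => hmono i j }
    have hG : ∀ i, g i = G i := fun _ => rfl
    refine List.ext_get (by simpa using Fintype.card_congr G.toEquiv) fun n hn hn' => ?_
    have hgn : g ⟨n, hn⟩ = ⟨n, hn'⟩ := Fin.ext (by rw [hG, Fin.coe_orderIso_apply])
    refine Subtype.ext (ih (r := fun u u' => r ⟨⟨n, hn⟩, u⟩ ⟨⟨n, hn'⟩, u'⟩) ?_ ?_ ?_)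
    · have := h2 _ _ (hg ⟨n, hn⟩)
      dsimp only at this
      rwa [hgn] at this
    · intro u
      obtain ⟨⟨j, u'⟩, hu⟩ := hl ⟨⟨n, hn⟩, u⟩
      obtain rfl : ⟨n, hn'⟩ = j := hgn.symm.trans (hget _ _ hu)
      exact ⟨u', hu⟩
    · intro u'
      obtain ⟨⟨j, u⟩, hu⟩ := hr ⟨⟨n, hn'⟩, u'⟩
      obtain rfl : ⟨n, hn⟩ = j := hinj (hgn.trans (hget _ _ hu).symm)
      exact ⟨u, hu⟩

theorem PIso.leaf_eq {v w : a.Elem} {r : Univ v → Univ w → Prop} (h : PIso a v w r)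
    {x : Univ v} {y : Univ w} (hxy : r x y) : leaf v x = leaf w y := by
  induction a with
  | one => rfl
  | sum a b iha ihb =>
    rcases v with v | v <;> rcases w with w | w
    · exact congrArg Sum.inl (iha (v := v) (w := w) h hxy)
    · exact h.elim
    · exact h.elim
    · exact congrArg Sum.inr (ihb (v := v) (w := w) h hxy)
  | prod a b iha ihb =>
    rcases v with ⟨v, v'⟩
    rcases w with ⟨w, w'⟩
    obtain ⟨h1, h2, h3, h4⟩ := h
    rcases x with x | x <;> rcases y with y | y
    · exact congrArg Sum.inl (iha h3 hxy)
    · exact (h1 _ _ hxy).elim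
    · exact (h2 _ _ hxy).elim
    · exact congrArg Sum.inr (ihb h4 hxy)
  | list a ih => exact ih (h.2 _ _ hxy) hxy

/-- The empty relation is a partial isomorphism exactly when the same nullary relations hold on both
sides, which is an equivalence. -/
theorem PIso.bot_trans {u v w : a.Elem} (h : PIso a u v fun _ _ => False)
    (h' : PIso a v w fun _ _ => False) : PIso a u w fun _ _ => False := by
  induction a with
  | one => trivial
  | sum a b iha ihb =>
    rcases u with u | u <;> rcases v with v | v <;> rcases w with w | w
    · exact iha (u := u) (v := v) (w := w) h h'
    all_goals first | exact h.elim | exact h'.elim | skip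
    exact ihb (u := u) (v := v) (w := w) h h'
  | prod a b iha ihb =>
    exact ⟨fun _ _ => id, fun _ _ => id, iha h.2.2.1 h'.2.2.1, ihb h.2.2.2 h'.2.2.2⟩
  | list a ih => exact ⟨fun _ _ _ _ h => h.elim, fun _ _ h => h.elim⟩

theorem PIso.bot_symm {u v : a.Elem} (h : PIso a u v fun _ _ => False) :
    PIso a v u fun _ _ => False := by
  induction a with
  | one => trivial
  | sum a b iha ihb =>
    rcases u with u | u <;> rcases v with v | v
    · exact iha (u := u) (v := v) h
    all_goals first | exact h.elim | skip
    exact ihb (u := u) (v := v) h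
  | prod a b iha ihb => exact ⟨fun _ _ => id, fun _ _ => id, iha h.2.2.1, ihb h.2.2.2⟩
  | list a ih => exact ⟨fun _ _ _ _ h => h.elim, fun _ _ h => h.elim⟩

theorem exists_leaf_eq (i : a.Leaf) : ∃ (v : a.Elem) (x : Univ v), leaf v x = i := by
  have hne : ∀ a : ListType, Nonempty a.Elem := by
    intro a
    induction a with
    | one => exact ⟨()⟩
    | sum a b iha ihb => exact iha.map Sum.inl
    | prod a b iha ihb => exact iha.elim fun x => ihb.elim fun y => ⟨(x, y)⟩
    | list a ih => exact ⟨([] : List (Item a))⟩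
  induction a with
  | one => exact ⟨(), (), rfl⟩
  | sum a b iha ihb =>
    rcases i with i | i
    · obtain ⟨v, x, h⟩ := iha i
      exact ⟨Sum.inl v, x, congrArg Sum.inl h⟩
    · obtain ⟨v, x, h⟩ := ihb i
      exact ⟨Sum.inr v, x, congrArg Sum.inr h⟩
  | prod a b iha ihb =>
    rcases i with i | i
    · obtain ⟨v, x, h⟩ := iha i
      obtain ⟨w⟩ := hne b
      exact ⟨(v, w), Sum.inl x, congrArg Sum.inl h⟩
    · obtain ⟨v, x, h⟩ := ihb i
      obtain ⟨w⟩ := hne a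
      exact ⟨(w, v), Sum.inr x, congrArg Sum.inr h⟩
  | list a ih =>
    obtain ⟨v, x, h⟩ := ih i
    exact ⟨([⟨v, ⟨x⟩⟩] : List (Item a)), ⟨⟨0, Nat.one_pos⟩, x⟩, h⟩

instance nonempty_leaf (a : ListType) : Nonempty a.Leaf := by
  induction a with
  | one => exact ⟨()⟩
  | sum a b iha ihb => exact iha.map Sum.inl
  | prod a b iha ihb => exact iha.map Sum.inl
  | list a ih => exact ih

instance finite_leaf (a : ListType) : Finite a.Leaf := by
  induction a with
  | one => exact inferInstanceAs (Finite Unit)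
  | sum a b iha ihb => exact inferInstanceAs (Finite (a.Leaf ⊕ b.Leaf))
  | prod a b iha ihb => exact inferInstanceAs (Finite (a.Leaf ⊕ b.Leaf))
  | list a ih => exact ih

end ListType

/-! ### Some derivable functions -/

namespace Derivable

open ListType

variable {a b c d : ListType}

theorem congr {f g : a.Elem → b.Elem} (hf : Derivable f) (h : ∀ x, f x = g x) : Derivable g :=
  funext h ▸ hf

theorem id : Derivable (fun x : a.Elem => x) :=
  Derivable.comp (g := ListType.codiag) (.inl (b := a)) .codiag

theorem single : Derivable (fun x : a.Elem => ofItems (ListType.single x)) :=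
  (Derivable.createEmpty.comp .prodComm).comp .append

theorem copair {f : a.Elem → c.Elem} {g : b.Elem → c.Elem} (hf : Derivable f) (hg : Derivable g) :
    Derivable (a := ListType.sum a b) fun v => Sum.elim f g v :=
  ((hf.sumMap hg).comp .codiag).congr fun v => by rcases v with v | v <;> rfl

theorem flatMap_single_items (l : (list a).Elem) :
    ((ListType.single l).flatMap fun x => items x.1) = items l := by
  unfold ListType.single
  split_ifs with h
  · simp
  · rcases l with _ | ⟨x, l⟩
    · rfl
    · exact (h ⟨⟨⟨0, Nat.succ_pos _⟩, x.2.some⟩⟩).elim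

/-- `listMap` drops the items on which `f` gives the empty list, but these contribute nothing to the
concatenation anyway. -/
theorem bind {f : a.Elem → (list b).Elem} (hf : Derivable f) :
    Derivable (ListType.bind fun x => f x.1) := by
  refine (hf.listMap.comp .concat).congr fun l => ?_
  change List.flatMap _ (List.flatMap _ _) = List.flatMap _ _
  rw [List.flatMap_assoc]
  congr 1
  funext x
  exact flatMap_single_items (f x.1)

theorem appendLists : Derivable (appendLists (a := a)) := by
  refine (((single (a := list a)).prodMap id).comp (.comp .append .concat)).congr fun v => ?_
  rcases v with ⟨l, m⟩
  change List.flatMap _ (List.append _ _) = List.append _ _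
  refine List.flatMap_append.trans ?_
  exact congrArg₂ List.append (flatMap_single_items l) (flatMap_single_items m)

/-- New points cannot be created, so only constants with empty universe are available, all of them
built from empty lists. Keeping the input in the pair lets a product constant be adjoined one
component at a time. -/
theorem pairConst {e : b.Elem} (he : IsEmpty (Univ e)) :
    Derivable (b := prod a b) fun x : a.Elem => (x, e) := by
  induction b generalizing a with
  | one => exact (he.false ()).elim
  | sum b c ihb ihc =>
    rcases e with e | e
    · exact ((ihb (e := e) he).comp (id.prodMap .inl)).congr fun _ => rfl
    · exact ((ihc (e := e) he).comp (id.prodMap .inr)).congr fun _ => rfl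
  | prod b c ihb ihc =>
    rcases e with ⟨e, e'⟩
    exact (((ihb (e := e) ⟨fun u => he.false (Sum.inl u)⟩).comp
      (ihc (e := e') ⟨fun u => he.false (Sum.inr u)⟩)).comp .prodAssocInv).congr fun _ => rfl
  | list b ih =>
    rcases e with _ | ⟨x, l⟩
    · exact .createEmpty
    · exact (he.false ⟨⟨0, Nat.succ_pos _⟩, x.2.some⟩).elim

theorem const {e : b.Elem} (he : IsEmpty (Univ e)) : Derivable fun _ : a.Elem => e :=
  (pairConst he).comp .snd

end Derivable

/-! ### Retracts and normal forms of input types -/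

namespace ListType

variable {a b c d : ListType}

/-- `a` embeds into `b` by derivable functions. -/
def Retract (a b : ListType) : Prop :=
  ∃ (s : a.Elem → b.Elem) (r : b.Elem → a.Elem), Derivable s ∧ Derivable r ∧ ∀ x, r (s x) = x

theorem Retract.refl (a : ListType) : Retract a a := ⟨_, _, .id, .id, fun _ => rfl⟩

theorem Retract.trans (h : Retract a b) (h' : Retract b c) : Retract a c := by
  obtain ⟨s, r, hs, hr, h⟩ := h
  obtain ⟨s', r', hs', hr', h'⟩ := h'
  exact ⟨_, _, hs.comp hs', hr'.comp hr, fun x => by rw [h', h]⟩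

theorem Retract.prod (h : Retract a b) (h' : Retract c d) : Retract (prod a c) (prod b d) := by
  obtain ⟨s, r, hs, hr, h⟩ := h
  obtain ⟨s', r', hs', hr', h'⟩ := h'
  exact ⟨_, _, hs.prodMap hs', hr.prodMap hr', fun ⟨x, y⟩ => Prod.ext (h x) (h' y)⟩

theorem Retract.sum (h : Retract a b) (h' : Retract c d) : Retract (sum a c) (sum b d) := by
  obtain ⟨s, r, hs, hr, h⟩ := h
  obtain ⟨s', r', hs', hr', h'⟩ := h'
  refine ⟨_, _, hs.sumMap hs', hr.sumMap hr', ?_⟩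
  rintro (x | x)
  exacts [congrArg Sum.inl (h x), congrArg Sum.inr (h' x)]

theorem Retract.list (h : Retract a b) : Retract (list a) (list b) := by
  obtain ⟨s, r, hs, hr, h⟩ := h
  refine ⟨_, _, hs.listMap, hr.listMap, fun l => ?_⟩
  obtain ⟨e, he⟩ := hr.exists_lifts
  refine List.flatMap_assoc.trans ?_
  refine Eq.trans (congrArg (fun f => List.flatMap f l) (funext fun x => ?_)) (List.flatMap_singleton' l)
  -- The lifting of `r` maps points of `r (s x) = x` to points of `s x`, so `s` sends items to items
  -- and none is dropped.
  have hx : Nonempty (Univ (s x.1)) := ⟨e _ (castUniv (h x.1).symm x.2.some)⟩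
  have hx' : Nonempty (Univ (r (s x.1))) := by rw [h]; exact x.2
  rw [single, dif_pos hx, List.flatMap_singleton, single, dif_pos hx']
  exact congrArg (fun y => [y]) (Subtype.ext (h x.1))

theorem retract_prod_sum : Retract (prod a (sum b c)) (sum (prod a b) (prod a c)) :=
  ⟨_, _, .distrib, .distribInv, by rintro ⟨x, y | y⟩ <;> rfl⟩

theorem retract_prodComm : Retract (prod a b) (prod b a) :=
  ⟨_, _, .prodComm, .prodComm, fun _ => rfl⟩

/-- Types built from `one` and lists by products, where the item types of lists are in turn sums
of such types (`Normal true`). -/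
inductive Normal : Bool → ListType → Prop
  | one : Normal false one
  | list {a : ListType} : Normal true a → Normal false (list a)
  | prod {a b : ListType} : Normal false a → Normal false b → Normal false (prod a b)
  | base {a : ListType} : Normal false a → Normal true a
  | sum {a b : ListType} : Normal true a → Normal true b → Normal true (sum a b)

/-- Induction over the top-level sums only, with `Normal false` types as atoms. -/
theorem Normal.induction_true {p : ∀ a, Normal true a → Prop}
    (base : ∀ a (h : Normal false a), p a (.base h))
    (sum : ∀ a b (ha : Normal true a) (hb : Normal true b), p a ha → p b hb →
      p (ListType.sum a b) (.sum ha hb)) {a : ListType} (h : Normal true a) : p a h := by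
  have key : ∀ k a, Normal k a → ∀ h : Normal true a, k = true → p a h := by
    intro k a h'
    induction h' with
    | one => intro _ hk; cases hk
    | list => intro _ hk; cases hk
    | prod => intro _ hk; cases hk
    | base h => intro _ _; exact base _ h
    | sum h h' ih ih' => intro _ _; exact sum _ _ h h' (ih h rfl) (ih' h' rfl)
  exact key true a h h rfl

theorem Normal.exists_retract_prod (ha : Normal true a) (hb : Normal true b) :
    ∃ c, Normal true c ∧ Retract (ListType.prod a b) c := by
  induction ha using Normal.induction_true with
  | base a ha =>
    induction hb using Normal.induction_true with
    | base b hb => exact ⟨_, .base (.prod ha hb), .refl _⟩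
    | sum b b' _ _ ih ih' =>
      obtain ⟨c, hc, h⟩ := ih
      obtain ⟨c', hc', h'⟩ := ih'
      exact ⟨_, .sum hc hc', retract_prod_sum.trans (h.sum h')⟩
  | sum a a' _ _ ih ih' =>
    obtain ⟨c, hc, h⟩ := ih
    obtain ⟨c', hc', h'⟩ := ih'
    exact ⟨_, .sum hc hc', retract_prodComm.trans (retract_prod_sum.trans
      ((retract_prodComm.trans h).sum (retract_prodComm.trans h')))⟩

theorem exists_retract_normal (a : ListType) : ∃ c, Normal true c ∧ Retract a c := by
  induction a with
  | one => exact ⟨_, .base .one, .refl _⟩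
  | prod a b iha ihb =>
    obtain ⟨c, hc, h⟩ := iha
    obtain ⟨d, hd, h'⟩ := ihb
    obtain ⟨e, he, h''⟩ := hc.exists_retract_prod hd
    exact ⟨e, he, (h.prod h').trans h''⟩
  | sum a b iha ihb =>
    obtain ⟨c, hc, h⟩ := iha
    obtain ⟨d, hd, h'⟩ := ihb
    exact ⟨_, hc.sum hd, h.sum h'⟩
  | list a ih =>
    obtain ⟨c, hc, h⟩ := ih
    exact ⟨_, .base (.list hc), h.list⟩

/-- Nullary relations come from sums, and lists turn them into unary ones; a type without sums
outside lists has none. -/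
theorem Normal.pIso_bot (ha : Normal false a) (v w : a.Elem) : PIso a v w fun _ _ => False := by
  generalize hk : false = k at ha
  induction ha with
  | one => trivial
  | list => exact ⟨fun _ _ _ _ h => h.elim, fun _ _ h => h.elim⟩
  | prod _ _ ih ih' => exact ⟨fun _ _ => False.elim, fun _ _ => False.elim, ih _ _ hk, ih' _ _ hk⟩
  | base => cases hk
  | sum => cases hk

/-- The leaf is the whole unary type of a point. In a sum, equal leaves force the same side; in a
product, the factor without the point is handled by `Normal.pIso_bot`. -/
theorem Normal.pIso_singleton {k : Bool} (ha : Normal k a) {v w : a.Elem} {x : Univ v}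
    {y : Univ w} (h : leaf v x = leaf w y) : PIso a v w fun x' y' => x' = x ∧ y' = y := by
  induction ha with
  | one => trivial
  | @list a _ ih =>
    refine ⟨?_, ?_⟩
    · rintro _ _ _ _ ⟨rfl, rfl⟩ ⟨rfl, rfl⟩
      exact iff_of_true le_rfl le_rfl
    · rintro _ _ ⟨rfl, rfl⟩
      refine (ih h).mono ?_
      rintro u u' ⟨hu, hu'⟩
      exact ⟨univ_list_mk_inj.1 hu, univ_list_mk_inj.1 hu'⟩
  | prod ha hb ih ih' =>
    rcases v with ⟨v, v'⟩
    rcases w with ⟨w, w'⟩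
    rcases x with x | x <;> rcases y with y | y
    · exact ⟨fun u u' h => Sum.inr_ne_inl h.2, fun u u' h => Sum.inr_ne_inl h.1,
        (ih (Sum.inl_injective h)).mono fun u u' h =>
          ⟨Sum.inl_injective h.1, Sum.inl_injective h.2⟩,
        (hb.pIso_bot _ _).mono fun u u' h => Sum.inr_ne_inl h.1⟩
    · cases h
    · cases h
    · exact ⟨fun u u' h => Sum.inl_ne_inr h.1, fun u u' h => Sum.inl_ne_inr h.2,
        (ha.pIso_bot _ _).mono fun u u' h => Sum.inl_ne_inr h.1,
        (ih' (Sum.inr_injective h)).mono fun u u' h =>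
          ⟨Sum.inr_injective h.1, Sum.inr_injective h.2⟩⟩
  | base _ ih => exact ih h
  | @sum a b _ _ ih ih' =>
    rcases v with v | v <;> rcases w with w | w
    · exact ih (v := v) (w := w) (Sum.inl_injective h)
    · cases h
    · cases h
    · exact ih' (v := v) (w := w) (Sum.inr_injective h)

/-- A list can hold one item for each leaf, even if the leaves lie on different sides of a sum. Such
elements serve as universal references in comparisons. -/
theorem Normal.exists_forall_leaf (ha : Normal false a) :
    ∃ v : a.Elem, ∀ i, ∃ x, leaf v x = i := by
  generalize hk : false = k at ha
  induction ha with
  | one => exact ⟨(), fun _ => ⟨(), rfl⟩⟩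
  | @list a _ ih =>
    choose f g hfg using exists_leaf_eq (a := a)
    have := Fintype.ofFinite a.Leaf
    let l : List (Item a) := Finset.univ.toList.map fun i : a.Leaf => ⟨f i, ⟨g i⟩⟩
    refine ⟨l, fun i => ?_⟩
    have hi : (⟨f i, ⟨g i⟩⟩ : Item a) ∈ l := List.mem_map.2 ⟨i, Finset.mem_toList.2 (Finset.mem_univ _), rfl⟩
    obtain ⟨k, hk⟩ := List.get_of_mem hi
    have hk' := congrArg Subtype.val hk
    exact ⟨⟨k, castUniv hk'.symm (g i)⟩, (leaf_castUniv hk'.symm (g i)).trans (hfg i)⟩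
  | prod _ _ ih ih' =>
    obtain ⟨v, hv⟩ := ih hk
    obtain ⟨w, hw⟩ := ih' hk
    refine ⟨(v, w), ?_⟩
    rintro (i | i)
    · obtain ⟨x, hx⟩ := hv i
      exact ⟨Sum.inl x, congrArg Sum.inl hx⟩
    · obtain ⟨x, hx⟩ := hw i
      exact ⟨Sum.inr x, congrArg Sum.inr hx⟩
  | base => cases hk
  | sum => cases hk

/-- The number of constructors of a list type. -/
def size : ListType → ℕ
  | one => 1
  | prod a b => size a + size b + 1
  | sum a b => size a + size b + 1
  | list a => size a + 1

/-! ### Restriction to the points from a set of leaves -/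

/-- `p` computes the substructure whose elements come from leaves in `S`. -/
def Restr (S : Set a.Leaf) (p : a.Elem → b.Elem) : Prop :=
  Function.Surjective p ∧ ∃ e : ∀ v, Univ (p v) → Univ v, (∀ v, Function.Injective (e v)) ∧
    (∀ v x, x ∈ Set.range (e v) ↔ leaf v x ∈ S) ∧
    ∀ v w r, PIso b (p v) (p w) r → PIso a v w (Relation.Map r (e v) (e w))

theorem restr_id {S : Set a.Leaf} (h : ∀ i, i ∈ S) : Restr S fun v : a.Elem => v :=
  ⟨fun v => ⟨v, rfl⟩, fun _ u => u, fun _ _ _ h => h, fun _ x => iff_of_true ⟨x, rfl⟩ (h _),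
    fun _ _ _ h => h.mono fun _ _ ⟨_, _, hr, hx, hy⟩ => hx ▸ hy ▸ hr⟩

theorem nonempty_elem (a : ListType) : Nonempty a.Elem :=
  (nonempty_leaf a).elim fun i => (exists_leaf_eq i).elim fun v _ => ⟨v⟩

/-- Forgetting `b` is harmless: partial isomorphisms on the other factor extend by the empty
relation, because `b` has no nullary relations. -/
theorem Restr.fst {S : Set (prod a b).Leaf} {p : a.Elem → c.Elem} (h : Restr (Sum.inl ⁻¹' S) p)
    (hb : Normal false b) (hS : ∀ i : b.Leaf, Sum.inr i ∉ S) :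
    Restr (a := prod a b) S fun v => p v.1 := by
  obtain ⟨hp, e, he, hr, hi⟩ := h
  obtain ⟨y₀⟩ := nonempty_elem b
  refine ⟨fun z => (hp z).elim fun x hx => ⟨(x, y₀), hx⟩, fun v u => Sum.inl (e v.1 u),
    fun v => Sum.inl_injective.comp (he v.1), ?_, ?_⟩
  · rintro ⟨v, v'⟩ (x | x)
    · refine Iff.trans ⟨?_, ?_⟩ (hr v x)
      · rintro ⟨u, hu⟩
        exact ⟨u, Sum.inl_injective hu⟩
      · rintro ⟨u, hu⟩
        exact ⟨u, congrArg Sum.inl hu⟩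
    · exact iff_of_false (fun ⟨u, hu⟩ => Sum.inl_ne_inr hu) (hS _)
  · rintro ⟨v, v'⟩ ⟨w, w'⟩ r h
    refine ⟨?_, ?_, (hi _ _ _ h).mono ?_, (hb.pIso_bot _ _).mono ?_⟩
    · rintro x y ⟨u, u', _, _, h⟩
      exact Sum.inl_ne_inr h
    · rintro x y ⟨u, u', _, h, _⟩
      exact Sum.inl_ne_inr h
    · rintro x y ⟨u, u', h, hx, hy⟩
      exact ⟨u, u', h, Sum.inl_injective hx, Sum.inl_injective hy⟩
    · rintro x y ⟨u, u', _, h, _⟩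
      exact Sum.inl_ne_inr h

theorem Restr.snd {S : Set (prod a b).Leaf} {p : b.Elem → c.Elem} (h : Restr (Sum.inr ⁻¹' S) p)
    (ha : Normal false a) (hS : ∀ i : a.Leaf, Sum.inl i ∉ S) :
    Restr (a := prod a b) S fun v => p v.2 := by
  obtain ⟨hp, e, he, hr, hi⟩ := h
  obtain ⟨x₀⟩ := nonempty_elem a
  refine ⟨fun z => (hp z).elim fun y hy => ⟨(x₀, y), hy⟩, fun v u => Sum.inr (e v.2 u),
    fun v => Sum.inr_injective.comp (he v.2), ?_, ?_⟩
  · rintro ⟨v, v'⟩ (x | x)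
    · exact iff_of_false (fun ⟨u, hu⟩ => Sum.inr_ne_inl hu) (hS _)
    · refine Iff.trans ⟨?_, ?_⟩ (hr v' x)
      · rintro ⟨u, hu⟩
        exact ⟨u, Sum.inr_injective hu⟩
      · rintro ⟨u, hu⟩
        exact ⟨u, congrArg Sum.inr hu⟩
  · rintro ⟨v, v'⟩ ⟨w, w'⟩ r h
    refine ⟨?_, ?_, (ha.pIso_bot _ _).mono ?_, (hi _ _ _ h).mono ?_⟩
    · rintro x y ⟨u, u', _, h, _⟩
      exact Sum.inr_ne_inl h
    · rintro x y ⟨u, u', _, _, h⟩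
      exact Sum.inr_ne_inl h
    · rintro x y ⟨u, u', _, h, _⟩
      exact Sum.inr_ne_inl h
    · rintro x y ⟨u, u', h, hx, hy⟩
      exact ⟨u, u', h, Sum.inr_injective hx, Sum.inr_injective hy⟩

theorem Restr.prod {S : Set (prod a b).Leaf} {p : a.Elem → c.Elem} {q : b.Elem → d.Elem}
    (h : Restr (Sum.inl ⁻¹' S) p) (h' : Restr (Sum.inr ⁻¹' S) q) :
    Restr (a := ListType.prod a b) (b := ListType.prod c d) S fun v => (p v.1, q v.2) := by
  obtain ⟨hp, e, he, hr, hi⟩ := h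
  obtain ⟨hp', e', he', hr', hi'⟩ := h'
  refine ⟨fun ⟨z, z'⟩ => ?_, fun v u => Sum.map (e v.1) (e' v.2) u,
    fun v => (he v.1).sumMap (he' v.2), ?_, ?_⟩
  · obtain ⟨x, rfl⟩ := hp z
    obtain ⟨y, rfl⟩ := hp' z'
    exact ⟨(x, y), rfl⟩
  · rintro ⟨v, v'⟩ (x | x)
    · refine Iff.trans ⟨?_, ?_⟩ (hr v x)
      · rintro ⟨u | u, hu⟩
        · exact ⟨u, Sum.inl_injective hu⟩
        · exact (Sum.inr_ne_inl hu).elim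
      · rintro ⟨u, hu⟩
        exact ⟨Sum.inl u, congrArg Sum.inl hu⟩
    · refine Iff.trans ⟨?_, ?_⟩ (hr' v' x)
      · rintro ⟨u | u, hu⟩
        · exact (Sum.inl_ne_inr hu).elim
        · exact ⟨u, Sum.inr_injective hu⟩
      · rintro ⟨u, hu⟩
        exact ⟨Sum.inr u, congrArg Sum.inr hu⟩
  · rintro ⟨v, v'⟩ ⟨w, w'⟩ r ⟨h1, h2, h3, h4⟩
    refine ⟨?_, ?_, (hi _ _ _ h3).mono ?_, (hi' _ _ _ h4).mono ?_⟩
    · rintro x y ⟨u | u, u' | u', h, hx, hy⟩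
      exacts [Sum.inl_ne_inr hy, h1 _ _ h, Sum.inr_ne_inl hx, Sum.inr_ne_inl hx]
    · rintro x y ⟨u | u, u' | u', h, hx, hy⟩
      exacts [Sum.inl_ne_inr hx, Sum.inl_ne_inr hx, h2 _ _ h, Sum.inr_ne_inl hy]
    · rintro x y ⟨u | u, u' | u', h, hx, hy⟩
      exacts [⟨u, u', h, Sum.inl_injective hx, Sum.inl_injective hy⟩, (Sum.inr_ne_inl hy).elim,
        (Sum.inr_ne_inl hx).elim, (Sum.inr_ne_inl hx).elim]
    · rintro x y ⟨u | u, u' | u', h, hx, hy⟩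
      exacts [(Sum.inl_ne_inr hx).elim, (Sum.inl_ne_inr hx).elim, (Sum.inl_ne_inr hy).elim,
        ⟨u, u', h, Sum.inr_injective hx, Sum.inr_injective hy⟩]

/-- The version of `Restr` for partial functions, with `none` for an empty substructure. -/
def PartRestr (S : Set a.Leaf) (p : a.Elem → Option b.Elem) : Prop :=
  (∀ y, ∃ v, p v = some y) ∧ ∃ e : ∀ v y, p v = some y → Univ y → Univ v,
    (∀ v y h, Function.Injective (e v y h)) ∧
    (∀ v x, leaf v x ∈ S ↔ ∃ y h u, e v y h u = x) ∧
    ∀ v w y z hy hz r, PIso b y z r → PIso a v w (Relation.Map r (e v y hy) (e w z hz))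

theorem Restr.partRestr {S : Set a.Leaf} {p : a.Elem → b.Elem} (h : Restr S p) :
    PartRestr S fun v => some (p v) := by
  obtain ⟨hp, e, he, hr, hi⟩ := h
  refine ⟨fun y => (hp y).imp fun v hv => congrArg some hv,
    fun v y h u => e v (castUniv (Option.some_injective _ h).symm u), ?_, fun v x => ?_, ?_⟩
  · intro v y h
    obtain rfl := Option.some_injective _ h
    exact he v
  · rw [← hr]
    constructor
    · rintro ⟨u, rfl⟩
      exact ⟨_, rfl, u, rfl⟩
    · rintro ⟨y, h, u, rfl⟩
      exact ⟨_, rfl⟩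
  · intro v w y z hy hz r h
    obtain rfl := Option.some_injective _ hy
    obtain rfl := Option.some_injective _ hz
    exact hi v w r h

/-- The copairing of two partial functions. -/
def copairO (p : a.Elem → Option c.Elem) (q : b.Elem → Option c.Elem) :
    (sum a b).Elem → Option c.Elem :=
  fun v => Sum.elim p q v

/-- The partial function that is undefined everywhere. -/
def noneO (a b : ListType) : a.Elem → Option b.Elem := fun _ => none

/-- Post-composition of a partial function with the left injection. -/
def inlO (p : a.Elem → Option c.Elem) : a.Elem → Option (sum c d).Elem :=
  fun v => (p v).map inl

/-- Post-composition of a partial function with the right injection. -/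
def inrO (p : a.Elem → Option d.Elem) : a.Elem → Option (sum c d).Elem :=
  fun v => (p v).map inr

/-- Partiality is needed here. A right element contains nothing from `S`, yet `c` may have no
element with empty universe, and a total function would lose the side of the sum. -/
theorem PartRestr.left {S : Set (sum a b).Leaf} {p : a.Elem → Option c.Elem}
    (h : PartRestr (Sum.inl ⁻¹' S) p) (hS : ∀ i : b.Leaf, Sum.inr i ∉ S) :
    PartRestr S (copairO p (noneO b c)) := by
  obtain ⟨hp, e, he, hr, hi⟩ := h
  refine ⟨fun y => (hp y).elim fun v hv => ⟨Sum.inl v, hv⟩,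
    show ∀ v y, copairO p (noneO b c) v = some y → Univ y → Univ v from fun v y => match v with
      | Sum.inl v => e v y
      | Sum.inr v => fun h => (nomatch h), ?_, ?_, ?_⟩
  · rintro (v | v) y h
    · exact he v y h
    · cases h
  · rintro (v | v) x
    · exact hr v x
    · refine iff_of_false (hS _) ?_
      rintro ⟨_, h, _⟩
      cases h
  · rintro (v | v) (w | w) y z hy hz r h
    · exact hi v w y z hy hz r h
    · cases hz
    · cases hy
    · cases hy

theorem PartRestr.right {S : Set (sum a b).Leaf} {p : b.Elem → Option c.Elem}
    (h : PartRestr (Sum.inr ⁻¹' S) p) (hS : ∀ i : a.Leaf, Sum.inl i ∉ S) :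
    PartRestr S (copairO (noneO a c) p) := by
  obtain ⟨hp, e, he, hr, hi⟩ := h
  refine ⟨fun y => (hp y).elim fun v hv => ⟨Sum.inr v, hv⟩,
    show ∀ v y, copairO (noneO a c) p v = some y → Univ y → Univ v from fun v y => match v with
      | Sum.inl v => fun h => (nomatch h)
      | Sum.inr v => e v y, ?_, ?_, ?_⟩
  · rintro (v | v) y h
    · cases h
    · exact he v y h
  · rintro (v | v) x
    · refine iff_of_false (hS _) ?_
      rintro ⟨_, h, _⟩
      cases h
    · exact hr v x
  · rintro (v | v) (w | w) y z hy hz r h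
    · cases hy
    · cases hy
    · cases hz
    · exact hi v w y z hy hz r h

theorem PartRestr.both {S : Set (sum a b).Leaf} {p : a.Elem → Option c.Elem}
    {q : b.Elem → Option d.Elem} (h : PartRestr (Sum.inl ⁻¹' S) p)
    (h' : PartRestr (Sum.inr ⁻¹' S) q) : PartRestr S (copairO (inlO (d := d) p) (inrO q)) := by
  obtain ⟨hp, e, he, hr, hi⟩ := h
  obtain ⟨hp', e', he', hr', hi'⟩ := h'
  have hl : ∀ {v : a.Elem} {y : c.Elem},
      copairO (inlO (d := d) p) (inrO q) (Sum.inl v) = some (Sum.inl y) → p v = some y :=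
    fun {v y} h => by
      obtain ⟨z, hz, hzy⟩ := Option.map_eq_some_iff.1 h
      rw [hz, Sum.inl_injective hzy]
  have hr₂ : ∀ {v : b.Elem} {y : d.Elem},
      copairO (inlO (d := d) p) (inrO q) (Sum.inr v) = some (Sum.inr y) → q v = some y :=
    fun {v y} h => by
      obtain ⟨z, hz, hzy⟩ := Option.map_eq_some_iff.1 h
      rw [hz, Sum.inr_injective hzy]
  have hlr : ∀ {v : a.Elem} {y : d.Elem},
      copairO (inlO (d := d) p) (inrO q) (Sum.inl v) ≠ some (Sum.inr y) := fun {v y} h => by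
    obtain ⟨z, hz, hzy⟩ := Option.map_eq_some_iff.1 h
    cases hzy
  have hrl : ∀ {v : b.Elem} {y : c.Elem},
      copairO (inlO (d := d) p) (inrO q) (Sum.inr v) ≠ some (Sum.inl y) := fun {v y} h => by
    obtain ⟨z, hz, hzy⟩ := Option.map_eq_some_iff.1 h
    cases hzy
  refine ⟨?_, fun v y => match v, y with
    | Sum.inl v, Sum.inl y => fun h => e v y (hl h)
    | Sum.inl v, Sum.inr y => fun h => (hlr h).elim
    | Sum.inr v, Sum.inl y => fun h => (hrl h).elim
    | Sum.inr v, Sum.inr y => fun h => e' v y (hr₂ h), ?_, ?_, ?_⟩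
  · rintro (y | y)
    · obtain ⟨v, hv⟩ := hp y
      exact ⟨Sum.inl v, congrArg (Option.map inl) hv⟩
    · obtain ⟨v, hv⟩ := hp' y
      exact ⟨Sum.inr v, congrArg (Option.map inr) hv⟩
  · rintro (v | v) (y | y) h
    exacts [he v y (hl h), (hlr h).elim, (hrl h).elim, he' v y (hr₂ h)]
  · rintro (v | v) x
    · refine (hr v x).trans ⟨?_, ?_⟩
      · rintro ⟨y, h, u, hu⟩
        exact ⟨Sum.inl y, congrArg (Option.map inl) h, u, hu⟩
      · rintro ⟨y | y, h, u, hu⟩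
        exacts [⟨y, hl h, u, hu⟩, (hlr h).elim]
    · refine (hr' v x).trans ⟨?_, ?_⟩
      · rintro ⟨y, h, u, hu⟩
        exact ⟨Sum.inr y, congrArg (Option.map inr) h, u, hu⟩
      · rintro ⟨y | y, h, u, hu⟩
        exacts [(hrl h).elim, ⟨y, hr₂ h, u, hu⟩]
  · rintro (v | v) (w | w) (y | y) (z | z) hy hz r h
    all_goals first
      | exact (hlr hy).elim | exact (hrl hy).elim | exact (hlr hz).elim | exact (hrl hz).elim
      | exact h.elim | skip
    · exact hi v w y z (hl hy) (hl hz) r h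
    · exact hi' v w y z (hr₂ hy) (hr₂ hz) r h

/-- The list with the value of a partial function as only item, if it is defined and nonempty. -/
noncomputable def toList (p : a.Elem → Option b.Elem) (v : a.Elem) : (list b).Elem :=
  ofItems ((p v).elim [] single)

theorem toList_inlO (p : a.Elem → Option b.Elem) (v : a.Elem) :
    toList (inlO (d := d) p) v = listMap inl (toList p v) := by
  unfold toList inlO
  rcases p v with _ | y
  · rfl
  · change single _ = List.flatMap _ (single y)
    by_cases h : Nonempty (Univ y)
    · rw [single, single, dif_pos h, List.flatMap_singleton, single]
    · have h' : ¬ Nonempty (Univ (a := sum b d) (inl y)) := h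
      rw [single, single, dif_neg h, dif_neg h']
      rfl

theorem toList_inrO (p : a.Elem → Option b.Elem) (v : a.Elem) :
    toList (inrO (c := d) p) v = listMap inr (toList p v) := by
  unfold toList inrO
  rcases p v with _ | y
  · rfl
  · change single _ = List.flatMap _ (single y)
    by_cases h : Nonempty (Univ y)
    · rw [single, single, dif_pos h, List.flatMap_singleton, single]
    · have h' : ¬ Nonempty (Univ (a := sum d b) (inr y)) := h
      rw [single, single, dif_neg h, dif_neg h']
      rfl

/-- Two partial functions can be computed together, without copying the argument. -/
def PairO (p : a.Elem → Option b.Elem) (q : a.Elem → Option c.Elem) : Prop :=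
  Derivable (b := prod (list b) (list c)) fun v => (toList p v, toList q v)

theorem PairO.copairO {p : a.Elem → Option c.Elem} {q : a.Elem → Option d.Elem}
    {p' : b.Elem → Option c.Elem} {q' : b.Elem → Option d.Elem} (h : PairO p q)
    (h' : PairO p' q') : PairO (copairO p p') (copairO q q') :=
  (Derivable.copair h h').congr fun v => by rcases v with v | v <;> rfl

theorem PairO.mapLeft {b' : ListType} {p : a.Elem → Option b.Elem} {q : a.Elem → Option c.Elem}
    {p' : a.Elem → Option b'.Elem} (h : PairO p q) {f : b.Elem → b'.Elem} (hf : Derivable f)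
    (hp : ∀ v, toList p' v = listMap f (toList p v)) : PairO p' q :=
  (h.comp (hf.listMap.prodMap .id)).congr fun v => Prod.ext (hp v).symm rfl

theorem PairO.mapRight {c' : ListType} {p : a.Elem → Option b.Elem} {q : a.Elem → Option c.Elem}
    {q' : a.Elem → Option c'.Elem} (h : PairO p q) {f : c.Elem → c'.Elem} (hf : Derivable f)
    (hq : ∀ v, toList q' v = listMap f (toList q v)) : PairO p q' :=
  (h.comp (Derivable.id.prodMap hf.listMap)).congr fun v => Prod.ext rfl (hq v).symm

theorem PairO.inl_left {p : a.Elem → Option b.Elem} {q : a.Elem → Option c.Elem}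
    (h : PairO p q) : PairO (inlO (d := d) p) q := h.mapLeft .inl (toList_inlO p)

theorem PairO.inr_left {p : a.Elem → Option b.Elem} {q : a.Elem → Option c.Elem}
    (h : PairO p q) : PairO (inrO (c := d) p) q := h.mapLeft .inr (toList_inrO p)

theorem PairO.inl_right {p : a.Elem → Option b.Elem} {q : a.Elem → Option c.Elem}
    (h : PairO p q) : PairO p (inlO (d := d) q) := h.mapRight .inl (toList_inlO q)

theorem PairO.inr_right {p : a.Elem → Option b.Elem} {q : a.Elem → Option c.Elem}
    (h : PairO p q) : PairO p (inrO (c := d) q) := h.mapRight .inr (toList_inrO q)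

theorem pairO_some_none : PairO (fun v : a.Elem => some v) (noneO a b) :=
  (Derivable.single.comp .createEmpty).congr fun _ => rfl

theorem pairO_none_some : PairO (noneO a b) (fun v : a.Elem => some v) :=
  (pairO_some_none.comp .prodComm).congr fun _ => rfl

theorem castUniv_injective {v w : a.Elem} (h : v = w) : Function.Injective (castUniv h) := by
  subst h
  exact fun _ _ h => h

theorem reindex_injective {J K : Type} {p : J → Item a} {q : K → Item a} {f : K → J}
    (h : ∀ k, q k = p (f k)) (hf : Function.Injective f) : Function.Injective (reindex f h) := by
  rintro ⟨k, x⟩ ⟨k', y⟩ hxy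
  obtain ⟨hk, hxy⟩ := Sigma.mk.inj_iff.1 hxy
  obtain rfl := hf hk
  exact congrArg _ (castUniv_injective _ (eq_of_heq hxy))

theorem singleLift_surjective (x : a.Elem) : Function.Surjective (singleLift x) := by
  intro u
  obtain ⟨y, hy⟩ := (lifts_single.2 x x Eq u u (.refl x) rfl).1 <| by
    have hk : 0 < (single x).length := by
      unfold single
      rw [dif_pos ⟨u⟩]
      simp
    obtain ⟨y, hy⟩ := castUniv_surjective (get_single x ⟨0, hk⟩) u
    exact ⟨⟨⟨0, hk⟩, y⟩, hy⟩
  exact ⟨y, hy⟩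

theorem singleLift_injective (x : a.Elem) : Function.Injective (singleLift x) :=
  lifts_single.injective .refl x

theorem pIso_of_single {y z : b.Elem}
    {r : Univ (a := list b) (ofItems (single y)) → Univ (a := list b) (ofItems (single z)) → Prop}
    (h : PIso (list b) (ofItems (single y)) (ofItems (single z)) r) {u v} (huv : r u v) :
    PIso b y z (Relation.Map r (singleLift y) (singleLift z)) := by
  refine (pIso_castUniv (get_single y u.1) (get_single z v.1)).1 ((h.2 u v huv).mono ?_)
  rintro s t ⟨s', t', hst, hs, ht⟩
  obtain rfl : s' = ⟨u.1, s⟩ := singleLift_injective y hs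
  obtain rfl : t' = ⟨v.1, t⟩ := singleLift_injective z ht
  exact hst

/-- The version of `Restr` for functions to lists with at most one item. -/
def ItemRestr (S : Set a.Leaf) (p : a.Elem → (list b).Elem) : Prop :=
  (∀ v, List.length (p v) ≤ 1) ∧ (∀ y : Item b, ∃ v : a.Elem, p v = ([y] : List (Item b))) ∧
    ∃ e : ∀ v, Univ (p v) → Univ v, (∀ v, Function.Injective (e v)) ∧
      (∀ v x, x ∈ Set.range (e v) ↔ leaf v x ∈ S) ∧
      ∀ v w r x y, PIso (list b) (p v) (p w) r → r x y → PIso a v w (Relation.Map r (e v) (e w))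

/-- `toList` confuses an undefined value with one of empty universe. Partial isomorphisms are
therefore reflected only if they relate at least one pair of points, which is all that the item
clause of `PIso` for lists asks for. -/
theorem PartRestr.itemRestr {S : Set a.Leaf} {p : a.Elem → Option b.Elem} (h : PartRestr S p) :
    ItemRestr S (toList p) := by
  obtain ⟨hp, e, he, hr, hi⟩ := h
  have key : ∀ v, ∃ F : Univ (toList p v) → Univ v,
      (p v = none ∧ IsEmpty (Univ (toList p v))) ∨ ∃ y, ∃ h : p v = some y,
        ∃ h' : toList p v = ofItems (single y),
          F = fun u => e v y h (singleLift y (castUniv h' u)) := by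
    intro v
    obtain h | ⟨y, h⟩ := Option.eq_none_or_eq_some (p v)
    · have h' : IsEmpty (Univ (toList p v)) := by
        have : toList p v = ofItems [] := by unfold toList; rw [h]; rfl
        rw [this]
        exact ⟨fun u => u.1.elim0⟩
      exact ⟨fun u => h'.elim u, .inl ⟨h, h'⟩⟩
    · have h' : toList p v = ofItems (single y) := by unfold toList; rw [h]; rfl
      exact ⟨_, .inr ⟨y, h, h', rfl⟩⟩
  choose F hF using key
  refine ⟨fun v => ?_, fun y => ?_, F, fun v => ?_, fun v x => ?_, fun v w r x y h hxy => ?_⟩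
  · unfold toList
    rcases p v with _ | y
    · exact Nat.zero_le _
    · exact length_single_le y
  · obtain ⟨v, hv⟩ := hp y.1
    refine ⟨v, ?_⟩
    unfold toList
    rw [hv]
    change single y.1 = [y]
    rw [single, dif_pos y.2]
  · rcases hF v with ⟨_, h⟩ | ⟨y, h, h', hFv⟩
    · exact fun x => h.elim x
    · rw [hFv]
      exact (he v y h).comp ((singleLift_injective y).comp (castUniv_injective h'))
  · rw [hr]
    rcases hF v with ⟨h, h'⟩ | ⟨y, h, h', hFv⟩
    · refine iff_of_false (fun ⟨u, _⟩ => h'.elim u) ?_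
      rintro ⟨y, hy, _⟩
      rw [h] at hy
      cases hy
    · rw [hFv]
      constructor
      · rintro ⟨u, hu⟩
        exact ⟨y, h, _, hu⟩
      · rintro ⟨z, hz, u, hu⟩
        obtain rfl : y = z := Option.some_injective _ (h.symm.trans hz)
        obtain ⟨t, rfl⟩ := singleLift_surjective y u
        obtain ⟨t, rfl⟩ := castUniv_surjective h' t
        exact ⟨t, hu⟩
  · rcases hF v with ⟨_, hv⟩ | ⟨y', h1, h1', hFv⟩
    · exact hv.elim x
    rcases hF w with ⟨_, hw⟩ | ⟨z', h2, h2', hFw⟩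
    · exact hw.elim y
    have h3 : PIso (list b) (ofItems (single y')) (ofItems (single z'))
        (Relation.Map r (castUniv h1') (castUniv h2')) :=
      (pIso_castUniv h1' h2').1 (h.mono fun s t ⟨s', t', hst, hs, ht⟩ =>
        castUniv_injective h1' hs ▸ castUniv_injective h2' ht ▸ hst)
    have h4 := pIso_of_single (u := castUniv h1' x) (v := castUniv h2' y) h3 ⟨x, y, hxy, rfl, rfl⟩
    refine (hi v w y' z' h1 h2 _ h4).mono ?_
    rintro _ _ ⟨s, t, hst, rfl, rfl⟩
    exact ⟨_, _, ⟨_, _, ⟨s, t, hst, rfl, rfl⟩, rfl, rfl⟩, by rw [hFv], by rw [hFw]⟩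

theorem bindLift_injective {h : Item a → (list b).Elem} {e : ∀ v, Univ (h v) → Univ v.1}
    (he : ∀ v, Function.Injective (e v)) (l : (list a).Elem) :
    Function.Injective (bindLift e l) := by
  rintro ⟨⟨i, j⟩, u⟩ ⟨⟨i', j'⟩, u'⟩ hu
  obtain ⟨hi, hu⟩ := Sigma.mk.inj_iff.1 hu
  change i = i' at hi
  subst hi
  obtain ⟨hj, hu⟩ := Sigma.mk.inj_iff.1 (he _ (eq_of_heq hu))
  change j = j' at hj
  subst hj
  exact congrArg _ (eq_of_heq hu)

/-- Each item yields at most one item, so the inner position is always `0` and `f l` embeds output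
positions into input positions as an order. Dropped items have no points from `S`. -/
theorem ItemRestr.restr {S : Set a.Leaf} {p : a.Elem → (list b).Elem} (h : ItemRestr S p) :
    Restr (a := list a) S (bind fun v => p v.1) := by
  obtain ⟨hlen, hp, e, he, hr, hi⟩ := h
  choose f hf1 hf2 hf3 using exists_bindIdx fun v : Item a => p v.1
  have hinj : ∀ l, Function.Injective (f l) := fun l i j hij => le_antisymm
    ((hf2 l i j).2 (hij ▸ Or.inr ⟨rfl, le_rfl⟩)) ((hf2 l j i).2 (hij ▸ Or.inr ⟨rfl, le_rfl⟩))
  have hle : ∀ l i j, i ≤ j ↔ (f l i).1 ≤ (f l j).1 := by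
    intro l i j
    have h1 := hlen ((items l).get (f l i).1).1
    have h2 := (f l i).2.2
    have h3 : (f l i).2.1 = 0 := Nat.lt_one_iff.1 (h2.trans_le h1)
    rw [hf2, BindIdx.Le, h3]
    simp only [zero_le, and_true]
    exact le_iff_lt_or_eq.symm
  have hgi : ∀ l, Function.Injective (reindex (f l) (hf1 l)) := fun l =>
    reindex_injective (hf1 l) (hinj l)
  refine ⟨fun m => ?_, fun l x => bindLift (fun v => e v.1) l (reindex (f l) (hf1 l) x),
    fun l => (bindLift_injective (fun v => he v.1) l).comp (hgi l), fun l x => ?_,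
    fun l l' r h => ⟨?_, ?_⟩⟩
  · choose g hg using hp
    have hg' : ∀ y, Nonempty (Univ (g y)) := fun y => by
      have hk : 0 < List.length (p (g y)) := by rw [hg]; exact Nat.one_pos
      exact ⟨e _ ⟨⟨0, hk⟩, (List.get (p (g y)) ⟨0, hk⟩).2.some⟩⟩
    refine ⟨List.map (fun y => (⟨g y, hg' y⟩ : Item a)) m, ?_⟩
    refine (List.flatMap_map _ _ m).trans ?_
    refine Eq.trans (congrArg (fun f => List.flatMap f m) (funext fun y => ?_))
      (List.flatMap_singleton' m)
    exact hg y
  · refine Iff.trans ?_ ((range_bindLift (fun v => e v.1) l x).trans (hr _ _))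
    exact Set.ext_iff.1 ((reindex_surjective (hf1 l) (hf3 l)).range_comp
      (bindLift (fun v => e v.1) l)) x
  · rintro _ _ _ _ ⟨u, u', hu, rfl, rfl⟩ ⟨w, w', hw, rfl, rfl⟩
    exact (hle l u.1 w.1).symm.trans ((h.1 _ _ _ _ hu hw).trans (hle l' u'.1 w'.1))
  · rintro _ _ ⟨u, u', hu, rfl, rfl⟩
    have h1 : FamIso BindIdx.Le BindIdx.Le BindIdx.item BindIdx.item
        (Relation.Map r (reindex (f l) (hf1 l)) (reindex (f l') (hf1 l'))) := by
      refine FamIso.of_reindex (hf1 l) (hf1 l') (hf2 l) (hf2 l') (hf3 l) (hf3 l')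
        (PIso.mono (a := list b) h ?_)
      rintro x y ⟨x', y', hxy, hx, hy⟩
      exact hgi l hx ▸ hgi l' hy ▸ hxy
    have key : ∀ x x', Relation.Map r (reindex (f l) (hf1 l)) (reindex (f l') (hf1 l')) x x' →
        PIso a (List.get l x.1.1).1 (List.get l' x'.1.1).1 fun z z' =>
          Relation.Map r (fun x => bindLift (fun v => e v.1) l (reindex (f l) (hf1 l) x))
            (fun x => bindLift (fun v => e v.1) l' (reindex (f l') (hf1 l') x))
            ⟨x.1.1, z⟩ ⟨x'.1.1, z'⟩ := by
      rintro ⟨⟨i, j⟩, t⟩ ⟨⟨i', j'⟩, t'⟩ ht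
      have h2 : PIso (list b) (p (List.get l i).1) (p (List.get l' i').1) fun s s' =>
          Relation.Map r (reindex (f l) (hf1 l)) (reindex (f l') (hf1 l'))
            ⟨⟨i, s.1⟩, s.2⟩ ⟨⟨i', s'.1⟩, s'.2⟩ := by
        refine ⟨fun x y x' y' _ _ => ?_, fun s s' hs => h1.2 _ _ hs⟩
        have hall : ∀ (v : a.Elem) (i j : Fin (List.length (p v))), i ≤ j := fun v i j => by
          have := hlen v
          rw [Fin.le_def]
          omega
        exact iff_of_true (hall _ _ _) (hall _ _ _)
      refine (hi _ _ _ ⟨j, t⟩ ⟨j', t'⟩ h2 ht).mono ?_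
      rintro z z' ⟨s, s', hs, hz, hz'⟩
      obtain ⟨⟨⟨i₂, j₂⟩, q⟩, hy⟩ : ∃ y, reindex (f l) (hf1 l) s = y := ⟨_, rfl⟩
      obtain ⟨⟨⟨i₂', j₂'⟩, q'⟩, hy'⟩ : ∃ y, reindex (f l') (hf1 l') s' = y := ⟨_, rfl⟩
      replace hz := (congrArg (bindLift (fun v => e v.1) l) hy).symm.trans hz
      replace hz' := (congrArg (bindLift (fun v => e v.1) l') hy').symm.trans hz'
      obtain ⟨hi, hq⟩ := Sigma.mk.inj_iff.1 hz
      obtain ⟨hi', hq'⟩ := Sigma.mk.inj_iff.1 hz'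
      change i₂ = i at hi
      change i₂' = i' at hi'
      subst hi hi'
      exact ⟨⟨j₂, q⟩, ⟨j₂', q'⟩, ⟨s, s', hs, hy, hy'⟩, eq_of_heq hq, eq_of_heq hq'⟩
    exact key _ _ ⟨u, u', hu, rfl, rfl⟩

theorem flatMap_single_eq {X : Type} {y : b.Elem} (h : Item b → List X)
    {l : List X} (hl : ∀ hy, h ⟨y, hy⟩ = l) (he : ¬ Nonempty (Univ y) → l = []) :
    (single y).flatMap h = l := by
  unfold single
  split_ifs with hy
  · rw [List.flatMap_singleton, hl]
  · exact (he hy).symm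

theorem eq_nil_of_isEmpty {l : (list a).Elem} (h : ¬ Nonempty (Univ l)) : items l = [] := by
  rcases l with _ | ⟨x, l⟩
  · rfl
  · exact (h ⟨⟨⟨0, Nat.succ_pos _⟩, x.2.some⟩⟩).elim

/-- List distribute separates the pairs of lists, then both sides are concatenated. Only empty pairs
and empty lists are omitted on the way, and concatenation ignores them. -/
theorem PairO.bind {p : a.Elem → Option b.Elem} {q : a.Elem → Option c.Elem} (h : PairO p q) :
    Derivable (a := list a) (b := prod (list b) (list c)) fun l =>
      (bind (fun v => toList p v.1) l, bind (fun v => toList q v.1) l) := by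
  refine (h.listMap.comp (.comp .listDistrib (.prodMap .concat .concat))).congr fun l => ?_
  refine Prod.ext ?_ ?_
  · refine (List.flatMap_assoc.trans List.flatMap_assoc).trans
      (congrArg (fun f => List.flatMap f (items l)) (funext fun x => ?_))
    refine flatMap_single_eq _ (fun hy => ?_) fun hy => ?_
    · exact flatMap_single_eq (y := toList p x.1) _ (fun _ => rfl) eq_nil_of_isEmpty
    · exact eq_nil_of_isEmpty fun ⟨u⟩ => hy ⟨Sum.inl u⟩
  · refine (List.flatMap_assoc.trans List.flatMap_assoc).trans
      (congrArg (fun f => List.flatMap f (items l)) (funext fun x => ?_))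
    refine flatMap_single_eq _ (fun hy => ?_) fun hy => ?_
    · exact flatMap_single_eq (y := toList q x.1) _ (fun _ => rfl) eq_nil_of_isEmpty
    · exact eq_nil_of_isEmpty fun ⟨u⟩ => hy ⟨Sum.inr u⟩

/-! ### Splitting the input along a set of leaves without copying -/

/-- The substructures given by `S` and its complement can be computed together, by functions to
smaller types. -/
def Splits (S : Set a.Leaf) : Prop :=
  ∃ (b c : ListType) (p : a.Elem → b.Elem) (q : a.Elem → c.Elem), Normal false b ∧
    Normal false c ∧ size b < size a ∧ size c < size a ∧ Restr S p ∧ Restr Sᶜ q ∧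
    Derivable (b := prod b c) fun v => (p v, q v)

/-- The version of `Splits` for partial functions. -/
def PartSplits (S : Set a.Leaf) : Prop :=
  ∃ (b c : ListType) (p : a.Elem → Option b.Elem) (q : a.Elem → Option c.Elem), Normal true b ∧
    Normal true c ∧ size b < size a ∧ size c < size a ∧ PartRestr S p ∧ PartRestr Sᶜ q ∧ PairO p q

theorem Splits.partSplits {S : Set a.Leaf} (h : Splits S) : PartSplits S := by
  obtain ⟨b, c, p, q, hb, hc, hb', hc', hp, hq, hpq⟩ := h
  exact ⟨b, c, _, _, .base hb, .base hc, hb', hc', hp.partRestr, hq.partRestr,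
    hpq.comp (.prodMap .single .single)⟩

theorem Splits.symm {S : Set a.Leaf} (h : Splits S) : Splits Sᶜ := by
  obtain ⟨b, c, p, q, hb, hc, hb', hc', hp, hq, hpq⟩ := h
  exact ⟨c, b, q, p, hc, hb, hc', hb', hq, by rwa [compl_compl], hpq.comp .prodComm⟩

theorem PartSplits.symm {S : Set a.Leaf} (h : PartSplits S) : PartSplits Sᶜ := by
  obtain ⟨b, c, p, q, hb, hc, hb', hc', hp, hq, hpq⟩ := h
  exact ⟨c, b, q, p, hc, hb, hc', hb', hq, by rwa [compl_compl], hpq.comp .prodComm⟩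

theorem splits_prod_of_left {S : Set (prod a b).Leaf} (hb : Normal false b)
    (h : Splits (a := a) (Sum.inl ⁻¹' S)) (h' : ∀ i : b.Leaf, Sum.inr i ∉ S) : Splits S := by
  obtain ⟨c, d, p, q, hc, hd, hc', hd', hp, hq, hpq⟩ := h
  refine ⟨c, prod d b, _, _, hc, hd.prod hb, ?_, ?_, hp.fst hb h',
    Restr.prod hq (restr_id fun i => h' i), ?_⟩
  · simp only [size]; omega
  · simp only [size]; omega
  · exact ((hpq.prodMap .id).comp .prodAssocInv).congr fun _ => rfl

theorem splits_prod_of_right {S : Set (prod a b).Leaf} (ha : Normal false a)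
    (h : Splits (a := b) (Sum.inr ⁻¹' S)) (h' : ∀ i : a.Leaf, Sum.inl i ∉ S) : Splits S := by
  obtain ⟨c, d, p, q, hc, hd, hc', hd', hp, hq, hpq⟩ := h
  refine ⟨c, prod a d, _, _, hc, ha.prod hd, ?_, ?_, hp.snd ha h',
    Restr.prod (restr_id fun i => h' i) hq, ?_⟩
  · simp only [size]; omega
  · simp only [size]; omega
  · exact (((Derivable.id.prodMap (hpq.comp .prodComm)).comp .prodAssoc).comp .prodComm).congr
      fun _ => rfl

/-- If one factor is split and the other lies wholly in `S` or outside it, the latter is attached to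
the matching half; complements reduce the first possibility to the second. If both are split, the
four parts are regrouped. -/
theorem splits_prod {S : Set (prod a b).Leaf} (ha : Normal false a) (hb : Normal false b)
    (h : (∀ i : a.Leaf, Sum.inl i ∉ S) ∨ (∀ i : a.Leaf, Sum.inl i ∈ S) ∨
      Splits (a := a) (Sum.inl ⁻¹' S))
    (h' : (∀ i : b.Leaf, Sum.inr i ∉ S) ∨ (∀ i : b.Leaf, Sum.inr i ∈ S) ∨
      Splits (a := b) (Sum.inr ⁻¹' S)) : (∀ i, i ∉ S) ∨ (∀ i, i ∈ S) ∨ Splits S := by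
  rcases h with h | h | h <;> rcases h' with h' | h' | h'
  · exact .inl (Sum.rec h h')
  · refine .inr (.inr ⟨b, a, _, _, hb, ha, ?_, ?_, (restr_id h').snd ha h,
      Restr.fst (p := fun v => v) (restr_id h) hb fun i hi => hi (h' i), .prodComm⟩)
    · simp only [size]; omega
    · simp only [size]; omega
  · exact .inr (.inr (splits_prod_of_right ha h' h))
  · refine .inr (.inr ⟨a, b, _, _, ha, hb, ?_, ?_, (restr_id h).fst hb h',
      Restr.snd (p := fun v => v) (restr_id h') ha fun i hi => hi (h i), .id⟩)
    · simp only [size]; omega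
    · simp only [size]; omega
  · exact .inr (.inl (Sum.rec h h'))
  · refine .inr (.inr ?_)
    rw [← compl_compl S]
    exact (splits_prod_of_right ha (S := Sᶜ) h'.symm fun i hi => hi (h i)).symm
  · exact .inr (.inr (splits_prod_of_left hb h h'))
  · refine .inr (.inr ?_)
    rw [← compl_compl S]
    exact (splits_prod_of_left hb (S := Sᶜ) h.symm fun i hi => hi (h' i)).symm
  · obtain ⟨c, d, p, q, hc, hd, hc', hd', hp, hq, hpq⟩ := h
    obtain ⟨c₂, d₂, p₂, q₂, hc₂, hd₂, hc₂', hd₂', hp₂, hq₂, hpq₂⟩ := h'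
    refine .inr (.inr ⟨prod c c₂, prod d d₂, _, _, hc.prod hc₂, hd.prod hd₂, ?_, ?_, hp.prod hp₂,
      Restr.prod hq hq₂, ?_⟩)
    · simp only [size]; omega
    · simp only [size]; omega
    · have h1 : Derivable (a := prod (prod c d) (prod c₂ d₂)) (b := prod (prod c c₂) (prod d d₂))
          fun v => ((v.1.1, v.2.1), (v.1.2, v.2.2)) := by
        have h2 : Derivable (a := prod d (prod c₂ d₂)) (b := prod c₂ (prod d d₂))
            fun v => (v.2.1, (v.1, v.2.2)) :=
          ((Derivable.prodAssoc.comp (.prodMap .prodComm .id)).comp .prodAssocInv).congr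
            fun _ => rfl
        exact ((Derivable.prodAssocInv.comp (.prodMap .id h2)).comp .prodAssoc).congr fun _ => rfl
      exact ((hpq.prodMap hpq₂).comp h1).congr fun _ => rfl

theorem partRestr_id {S : Set a.Leaf} (h : ∀ i, i ∈ S) : PartRestr S fun v : a.Elem => some v :=
  (restr_id h).partRestr

theorem partSplits_sum_of_left {S : Set (sum a b).Leaf} (hb : Normal true b)
    (h : PartSplits (a := a) (Sum.inl ⁻¹' S)) (h' : ∀ i : b.Leaf, Sum.inr i ∉ S) :
    PartSplits S := by
  obtain ⟨c, d, p, q, hc, hd, hc', hd', hp, hq, hpq⟩ := h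
  refine ⟨c, sum d b, _, _, hc, hd.sum hb, ?_, ?_, hp.left h',
    PartRestr.both hq (partRestr_id fun i => h' i),
    hpq.inl_right.copairO pairO_none_some.inr_right⟩
  · simp only [size]; omega
  · simp only [size]; omega

theorem partSplits_sum_of_right {S : Set (sum a b).Leaf} (ha : Normal true a)
    (h : PartSplits (a := b) (Sum.inr ⁻¹' S)) (h' : ∀ i : a.Leaf, Sum.inl i ∉ S) :
    PartSplits S := by
  obtain ⟨c, d, p, q, hc, hd, hc', hd', hp, hq, hpq⟩ := h
  refine ⟨c, sum a d, _, _, hc, ha.sum hd, ?_, ?_, hp.right h',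
    PartRestr.both (partRestr_id fun i => h' i) hq,
    pairO_none_some.inl_right.copairO hpq.inr_right⟩
  · simp only [size]; omega
  · simp only [size]; omega

theorem partSplits_sum {S : Set (sum a b).Leaf} (ha : Normal true a) (hb : Normal true b)
    (h : (∀ i : a.Leaf, Sum.inl i ∉ S) ∨ (∀ i : a.Leaf, Sum.inl i ∈ S) ∨
      PartSplits (a := a) (Sum.inl ⁻¹' S))
    (h' : (∀ i : b.Leaf, Sum.inr i ∉ S) ∨ (∀ i : b.Leaf, Sum.inr i ∈ S) ∨
      PartSplits (a := b) (Sum.inr ⁻¹' S)) : (∀ i, i ∉ S) ∨ (∀ i, i ∈ S) ∨ PartSplits S := by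
  rcases h with h | h | h <;> rcases h' with h' | h' | h'
  · exact .inl (Sum.rec h h')
  · refine .inr (.inr ⟨b, a, _, _, hb, ha, ?_, ?_, (partRestr_id h').right h,
      PartRestr.left (partRestr_id h) fun i hi => hi (h' i),
      pairO_none_some.copairO pairO_some_none⟩)
    · simp only [size]; omega
    · simp only [size]; omega
  · exact .inr (.inr (partSplits_sum_of_right ha h' h))
  · refine .inr (.inr ⟨a, b, _, _, ha, hb, ?_, ?_, (partRestr_id h).left h',
      PartRestr.right (partRestr_id h') fun i hi => hi (h i),
      pairO_some_none.copairO pairO_none_some⟩)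
    · simp only [size]; omega
    · simp only [size]; omega
  · exact .inr (.inl (Sum.rec h h'))
  · refine .inr (.inr ?_)
    rw [← compl_compl S]
    exact (partSplits_sum_of_right ha (S := Sᶜ) h'.symm fun i hi => hi (h i)).symm
  · exact .inr (.inr (partSplits_sum_of_left hb h h'))
  · refine .inr (.inr ?_)
    rw [← compl_compl S]
    exact (partSplits_sum_of_left hb (S := Sᶜ) h.symm fun i hi => hi (h' i)).symm
  · obtain ⟨c, d, p, q, hc, hd, hc', hd', hp, hq, hpq⟩ := h
    obtain ⟨c₂, d₂, p₂, q₂, hc₂, hd₂, hc₂', hd₂', hp₂, hq₂, hpq₂⟩ := h'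
    refine .inr (.inr ⟨sum c c₂, sum d d₂, _, _, hc.sum hc₂, hd.sum hd₂, ?_, ?_, hp.both hp₂,
      PartRestr.both hq hq₂, hpq.inl_left.inl_right.copairO hpq₂.inr_left.inr_right⟩)
    · simp only [size]; omega
    · simp only [size]; omega

theorem PartSplits.list {S : Set a.Leaf} (h : PartSplits S) : Splits (a := list a) S := by
  obtain ⟨b, c, p, q, hb, hc, hb', hc', hp, hq, hpq⟩ := h
  exact ⟨ListType.list b, ListType.list c, _, _, .list hb, .list hc, Nat.succ_lt_succ hb',
    Nat.succ_lt_succ hc', hp.itemRestr.restr, hq.itemRestr.restr, hpq.bind⟩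

/-- Products use total restrictions and sums partial ones; under a list, a partial restriction
becomes total because undefined items can be left out. -/
theorem Normal.splits {k : Bool} (ha : Normal k a) (S : Set a.Leaf) :
    (∀ i, i ∉ S) ∨ (∀ i, i ∈ S) ∨ match k with
      | false => Splits S
      | true => PartSplits S := by
  induction ha with
  | one =>
    by_cases h : () ∈ S
    · exact .inr (.inl fun _ => h)
    · exact .inl fun _ => h
  | list _ ih => exact (ih S).imp_right fun h => h.imp_right PartSplits.list
  | prod ha hb ih ih' => exact splits_prod ha hb (ih _) (ih' _)
  | base _ ih => exact (ih S).imp_right fun h => h.imp_right Splits.partSplits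
  | sum ha hb ih ih' => exact partSplits_sum ha hb (ih _) (ih' _)

theorem pIso_castUniv_graph {v w : a.Elem} (h : w = v) :
    PIso a v w fun x y => castUniv h y = x := by
  subst h
  exact (PIso.refl w).mono fun _ _ h => h.symm

/-- A function that only uses elements from leaves in `S` factors through the substructure. -/
theorem Lifts.exists_factor {S : Set a.Leaf} {p : a.Elem → b.Elem} (hp : Restr S p)
    {f : a.Elem → c.Elem} {e : ∀ v, Univ (f v) → Univ v} (hf : Lifts f e)
    (hS : ∀ v x, leaf v (e v x) ∈ S) :
    ∃ g : b.Elem → c.Elem, (∃ e', Lifts g e') ∧ ∀ v, f v = g (p v) := by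
  obtain ⟨hs, E, hE, hr, hi⟩ := hp
  choose s hs using hs
  have hr' : ∀ v x, ∃ u, E v u = e v x := fun v x => (hr v _).2 (hS v x)
  choose F hF using hr'
  refine ⟨fun y => f (s y), ⟨fun y x => castUniv (hs y) (F (s y) x), fun y z r h => ?_,
    fun y z r x x' h hx => ?_⟩, fun v => ?_⟩
  · have h1 := hi _ _ _ ((pIso_castUniv (hs y) (hs z)).2 h)
    refine (hf.1 _ _ _ h1).mono fun x x' hx => ⟨_, _, hx, hF _ _, hF _ _⟩
  · have h1 := hi _ _ _ ((pIso_castUniv (hs y) (hs z)).2 h)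
    obtain ⟨x, rfl⟩ := castUniv_surjective (hs y) x
    obtain ⟨x', rfl⟩ := castUniv_surjective (hs z) x'
    have h2 := hf.2 _ _ _ _ _ h1 ⟨x, x', hx, rfl, rfl⟩
    have h3 : ∀ y x, castUniv (hs y) x ∈ Set.range (fun x => castUniv (hs y) (F (s y) x)) ↔
        E (s y) x ∈ Set.range (e (s y)) := by
      intro y x
      constructor
      · rintro ⟨u, hu⟩
        exact ⟨u, by rw [← hF, castUniv_injective (hs y) hu]⟩
      · rintro ⟨u, hu⟩
        exact ⟨u, congrArg (castUniv (hs y)) (hE _ ((hF _ _).trans hu))⟩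
    exact (h3 y x).trans (h2.trans (h3 z x').symm)
  -- `v` and its representative `s (p v)` have the same restriction, so a partial isomorphism
  -- matches all their points from `S`. The outputs use no others, hence they are isomorphic and
  -- therefore equal.
  · have h1 := hi v (s (p v)) (fun x y => castUniv (hs (p v)) y = x)
      (pIso_castUniv_graph (hs (p v)))
    refine (hf.1 _ _ _ h1).eq_of_total (fun x => ?_) fun y => ?_
    · obtain ⟨u, hu⟩ := castUniv_surjective (hs (p v)) (F v x)
      have h2 : Relation.Map (fun x y => castUniv (hs (p v)) y = x) (E v) (E (s (p v))) (e v x)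
        (E _ u) := ⟨_, _, hu, hF _ _, rfl⟩
      obtain ⟨y, hy⟩ := (hf.2 _ _ _ _ _ h1 h2).1 ⟨x, rfl⟩
      exact ⟨y, hy ▸ h2⟩
    · have h2 : Relation.Map (fun x y => castUniv (hs (p v)) y = x) (E v) (E (s (p v)))
        (E v (castUniv (hs (p v)) (F _ y))) (e _ y) := ⟨_, _, rfl, rfl, hF _ _⟩
      obtain ⟨x, hx⟩ := (hf.2 _ _ _ _ _ h1 h2).2 ⟨y, rfl⟩
      exact ⟨x, hx ▸ h2⟩

/-! Rankings of the elements of the universes -/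

/-- The order given by `pos` depends on isomorphism types only. -/
def PosInvariant (pos : ∀ v : a.Elem, Univ v → ℕ) : Prop :=
  ∀ v w r, PIso a v w r → ∀ x y x' y', r x x' → r y y' → (pos v x ≤ pos v y ↔ pos w x' ≤ pos w y')

/-- The elements from leaves in `L` come before the other elements. -/
def IsCut (pos : ∀ v : a.Elem, Univ v → ℕ) (L : Set a.Leaf) : Prop :=
  ∀ v x y, leaf v x ∈ L → leaf v y ∉ L → pos v x < pos v y

/-- There are no nontrivial cuts. -/
def Indecomposable (pos : ∀ v : a.Elem, Univ v → ℕ) : Prop :=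
  ∀ L, IsCut pos L → (∀ i, i ∉ L) ∨ ∀ i, i ∈ L

theorem PosInvariant.lt_iff {pos : ∀ v : a.Elem, Univ v → ℕ} (h : PosInvariant pos)
    {v w : a.Elem} {r : Univ v → Univ w → Prop} (hr : PIso a v w r) {x y x' y'} (hx : r x x')
    (hy : r y y') : pos v x < pos v y ↔ pos w x' < pos w y' := by
  rw [← not_le, ← not_le, h v w r hr y x y' x' hy hx]

section prod

variable {pos : ∀ v : (prod a b).Elem, Univ v → ℕ}

theorem pIso_prod_pair {k k' : Bool} (ha : Normal k a) (hb : Normal k' b) {A A' : a.Elem}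
    {B B' : b.Elem} {x : Univ A} {x' : Univ A'} {y : Univ B} {y' : Univ B'}
    (hx : leaf A x = leaf A' x') (hy : leaf B y = leaf B' y') :
    PIso (prod a b) (A, B) (A', B') fun p q =>
      p = Sum.inl x ∧ q = Sum.inl x' ∨ p = Sum.inr y ∧ q = Sum.inr y' := by
  refine ⟨?_, ?_, (ha.pIso_singleton hx).mono ?_, (hb.pIso_singleton hy).mono ?_⟩
  · rintro u v (⟨h, h'⟩ | ⟨h, h'⟩)
    exacts [Sum.inr_ne_inl h', Sum.inl_ne_inr h]
  · rintro u v (⟨h, h'⟩ | ⟨h, h'⟩)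
    exacts [Sum.inr_ne_inl h, Sum.inl_ne_inr h']
  · rintro u v (⟨h, h'⟩ | ⟨h, h'⟩)
    exacts [⟨Sum.inl_injective h, Sum.inl_injective h'⟩, (Sum.inl_ne_inr h).elim]
  · rintro u v (⟨h, h'⟩ | ⟨h, h'⟩)
    exacts [(Sum.inr_ne_inl h).elim, ⟨Sum.inr_injective h, Sum.inr_injective h'⟩]

theorem pIso_prod_left (hb : Normal false b) (A : a.Elem) (B B' : b.Elem) :
    PIso (prod a b) (A, B) (A, B') fun p q => ∃ x : Univ A, p = Sum.inl x ∧ q = Sum.inl x := by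
  refine ⟨?_, ?_, (PIso.refl A).mono ?_, (hb.pIso_bot _ _).mono ?_⟩
  · rintro u v ⟨x, _, h⟩
    exact Sum.inr_ne_inl h
  · rintro u v ⟨x, h, _⟩
    exact Sum.inr_ne_inl h
  · rintro u v ⟨x, h, h'⟩
    exact (Sum.inl_injective h).trans (Sum.inl_injective h').symm
  · rintro u v ⟨x, h, _⟩
    exact Sum.inr_ne_inl h

theorem pIso_prod_right (ha : Normal false a) (A A' : a.Elem) (B : b.Elem) :
    PIso (prod a b) (A, B) (A', B) fun p q => ∃ x : Univ B, p = Sum.inr x ∧ q = Sum.inr x := by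
  refine ⟨?_, ?_, (ha.pIso_bot _ _).mono ?_, (PIso.refl B).mono ?_⟩
  · rintro u v ⟨x, h, _⟩
    exact Sum.inl_ne_inr h
  · rintro u v ⟨x, _, h⟩
    exact Sum.inl_ne_inr h
  · rintro u v ⟨x, h, _⟩
    exact Sum.inl_ne_inr h
  · rintro u v ⟨x, h, h'⟩
    exact (Sum.inr_injective h).trans (Sum.inr_injective h').symm

/-- The position of an element of the first component. -/
def posL (pos : ∀ v : (prod a b).Elem, Univ v → ℕ) (A : a.Elem) (B : b.Elem) (x : Univ A) : ℕ :=
  pos (A, B) (Sum.inl x)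

/-- The position of an element of the second component. -/
def posR (pos : ∀ v : (prod a b).Elem, Univ v → ℕ) (A : a.Elem) (B : b.Elem) (y : Univ B) : ℕ :=
  pos (A, B) (Sum.inr y)

/-- Whether a left point precedes a right one depends only on their leaves. If `x` strictly preceded
`y`, the leaves before that of `y` would generate a cut that contains the leaf of `x` but not the
leaf of `y`. -/
theorem PosInvariant.not_lt_of_prod (hpos : PosInvariant pos) (hind : Indecomposable pos)
    (ha : Normal false a) (hb : Normal false b) (A : a.Elem) (B : b.Elem) (x : Univ A)
    (y : Univ B) : posR pos A B y ≤ posL pos A B x := by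
  have hlt : ∀ {A A' : a.Elem} {B B' : b.Elem} {x : Univ A} {x' : Univ A'} {y : Univ B}
      {y' : Univ B'}, leaf A x = leaf A' x' → leaf B y = leaf B' y' →
      (posL pos A B x < posR pos A B y ↔ posL pos A' B' x' < posR pos A' B' y') :=
    fun hx hy => hpos.lt_iff (pIso_prod_pair ha hb hx hy) (.inl ⟨rfl, rfl⟩) (.inr ⟨rfl, rfl⟩)
  have hlt' : ∀ {A A' : a.Elem} {B B' : b.Elem} {x : Univ A} {x' : Univ A'} {y : Univ B}
      {y' : Univ B'}, leaf A x = leaf A' x' → leaf B y = leaf B' y' →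
      (posR pos A B y < posL pos A B x ↔ posR pos A' B' y' < posL pos A' B' x') :=
    fun hx hy => hpos.lt_iff (pIso_prod_pair ha hb hx hy) (.inr ⟨rfl, rfl⟩) (.inl ⟨rfl, rfl⟩)
  have hL : ∀ {A : a.Elem} {B B' : b.Elem} {x x' : Univ A},
      posL pos A B x < posL pos A B x' ↔ posL pos A B' x < posL pos A B' x' :=
    hpos.lt_iff (pIso_prod_left hb _ _ _) ⟨_, rfl, rfl⟩ ⟨_, rfl, rfl⟩
  have hR : ∀ {A A' : a.Elem} {B : b.Elem} {y y' : Univ B},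
      posR pos A B y < posR pos A B y' ↔ posR pos A' B y < posR pos A' B y' :=
    hpos.lt_iff (pIso_prod_right ha _ _ _) ⟨_, rfl, rfl⟩ ⟨_, rfl, rfl⟩
  obtain ⟨A₀, hA₀⟩ := ha.exists_forall_leaf
  obtain ⟨B₀, hB₀⟩ := hb.exists_forall_leaf
  obtain ⟨y₀, hy₀⟩ := hB₀ (leaf B y)
  -- On the left, the leaves with a point of `A₀` before `y₀`; on the right, those with a point of
  -- `B₀` not after such a left point. Since `A₀` and `B₀` realize all leaves, `L` decides
  -- comparisons in every `(A, B)`.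
  let L : Set (a.Leaf ⊕ b.Leaf) := {i | Sum.elim
    (fun i => ∃ x, leaf A₀ x = i ∧ posL pos A₀ B₀ x < posR pos A₀ B₀ y₀)
    (fun i => ∃ x y, leaf B₀ y = i ∧ posR pos A₀ B₀ y ≤ posL pos A₀ B₀ x ∧
      posL pos A₀ B₀ x < posR pos A₀ B₀ y₀) i}
  have hcut : IsCut (a := prod a b) pos L := by
    rintro ⟨A, B⟩ (x | y) (x' | y') h h'
    · obtain ⟨x₁, hx₁, h₁⟩ := h
      have h₂ : posL pos A B₀ x < posR pos A B₀ y₀ := (hlt hx₁ rfl).1 h₁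
      obtain ⟨x₂, hx₂⟩ := hA₀ (leaf A x')
      have h₃ : ¬ posL pos A B₀ x' < posR pos A B₀ y₀ := fun h =>
        h' ⟨x₂, hx₂, (hlt hx₂.symm rfl).1 h⟩
      exact hL.1 (h₂.trans_le (not_lt.1 h₃))
    · obtain ⟨x₁, hx₁, h₁⟩ := h
      obtain ⟨y₁, hy₁⟩ := hB₀ (leaf B y')
      have h₂ : ¬ posR pos A₀ B₀ y₁ ≤ posL pos A₀ B₀ x₁ := fun h => h' ⟨x₁, y₁, hy₁, h, h₁⟩
      exact (hlt hx₁ hy₁).1 (not_le.1 h₂)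
    · obtain ⟨x₁, y₁, hy₁, h₁, h₂⟩ := h
      obtain ⟨x₂, hx₂⟩ := hA₀ (leaf A x')
      have h₃ : ¬ posL pos A₀ B₀ x₂ < posR pos A₀ B₀ y₀ := fun h => h' ⟨x₂, hx₂, h⟩
      exact (hlt' hx₂ hy₁).1 ((h₁.trans_lt h₂).trans_le (not_lt.1 h₃))
    · obtain ⟨x₁, y₁, hy₁, h₁, h₂⟩ := h
      obtain ⟨y₂, hy₂⟩ := hB₀ (leaf B y')
      have h₃ : ¬ posR pos A₀ B₀ y₂ ≤ posL pos A₀ B₀ x₁ := fun h => h' ⟨x₁, y₂, hy₂, h, h₂⟩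
      have h₄ : posL pos A₀ B x₁ < posR pos A₀ B y' := (hlt rfl hy₂).1 (not_le.1 h₃)
      have h₅ : ¬ posL pos A₀ B x₁ < posR pos A₀ B y := fun h =>
        h₁.not_gt ((hlt rfl hy₁.symm).1 h)
      exact hR.1 ((not_lt.1 h₅).trans_lt h₄)
  refine not_lt.1 fun hxy => ?_
  rcases hind L hcut with h | h
  · obtain ⟨x₁, hx₁⟩ := hA₀ (leaf A x)
    exact h (Sum.inl (leaf A x)) ⟨x₁, hx₁, (hlt hx₁ hy₀).2 hxy⟩
  · obtain ⟨x₁, y₁, hy₁, h₁, h₂⟩ := h (Sum.inr (leaf B y))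
    exact h₁.not_gt ((hlt rfl (hy₁.trans hy₀.symm)).2 h₂)

theorem PosInvariant.eq_of_prod (hpos : PosInvariant pos) (hind : Indecomposable pos)
    (ha : Normal false a) (hb : Normal false b) (v : (prod a b).Elem) (x y : Univ v) :
    pos v x = pos v y := by
  -- Exchanging the factors gives the opposite inequality. Points of the same factor are then
  -- compared through a point of the other one, after that factor has been replaced by `A₀` or `B₀`,
  -- as it might be empty.
  let pos' : ∀ v : (prod b a).Elem, Univ v → ℕ := fun v u =>
    pos (v.2, v.1) (Sum.elim (Sum.inr : Univ v.1 → Univ v.2 ⊕ Univ v.1) Sum.inl u)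
  have hpos' : PosInvariant pos' := by
    rintro ⟨A, B⟩ ⟨A', B'⟩ r ⟨h1, h2, h3, h4⟩ x y x' y' hx hy
    refine hpos (B, A) (B', A')
      (fun p q => r (Sum.elim (Sum.inr : Univ B → Univ A ⊕ Univ B) Sum.inl p)
        (Sum.elim (Sum.inr : Univ B' → Univ A' ⊕ Univ B') Sum.inl q))
      ⟨fun u v => h2 u v, fun u v => h1 u v, h4, h3⟩ _ _ _ _ ?_ ?_
    · rcases x with x | x <;> rcases x' with x' | x' <;> exact hx
    · rcases y with y | y <;> rcases y' with y' | y' <;> exact hy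
  have hind' : Indecomposable pos' := by
    intro L hL
    let L' : Set (a.Leaf ⊕ b.Leaf) := {i | Sum.elim (fun i => Sum.inr i ∈ L) (fun i => Sum.inl i ∈ L) i}
    refine (hind L' ?_).imp (fun h => Sum.rec (fun i => h (Sum.inr i)) fun i => h (Sum.inl i))
      fun h => Sum.rec (fun i => h (Sum.inr i)) fun i => h (Sum.inl i)
    rintro ⟨A, B⟩ (x | x) (y | y) h h'
    · exact hL (B, A) (Sum.inr x) (Sum.inr y) h h'
    · exact hL (B, A) (Sum.inr x) (Sum.inl y) h h'
    · exact hL (B, A) (Sum.inl x) (Sum.inr y) h h'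
    · exact hL (B, A) (Sum.inl x) (Sum.inl y) h h'
  have heq : ∀ (A : a.Elem) (B : b.Elem) (x : Univ A) (y : Univ B),
      posL pos A B x = posR pos A B y := fun A B x y =>
    le_antisymm (hpos'.not_lt_of_prod hind' hb ha B A y x) (hpos.not_lt_of_prod hind ha hb A B x y)
  obtain ⟨A₀, hA₀⟩ := ha.exists_forall_leaf
  obtain ⟨B₀, hB₀⟩ := hb.exists_forall_leaf
  obtain ⟨x₀, -⟩ := hA₀ (Classical.arbitrary _)
  obtain ⟨y₀, -⟩ := hB₀ (Classical.arbitrary _)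
  rcases v with ⟨A, B⟩
  have hle : ∀ x x' : Univ A, posL pos A B x ≤ posL pos A B x' := fun x x' =>
    (hpos (A, B) (A, B₀) _ (pIso_prod_left hb A B B₀) (Sum.inl x) (Sum.inl x') (Sum.inl x)
      (Sum.inl x') ⟨_, rfl, rfl⟩ ⟨_, rfl, rfl⟩).2 ((heq A B₀ x y₀).trans (heq A B₀ x' y₀).symm).le
  have hle' : ∀ y y' : Univ B, posR pos A B y ≤ posR pos A B y' := fun y y' =>
    (hpos (A, B) (A₀, B) _ (pIso_prod_right ha A A₀ B) (Sum.inr y) (Sum.inr y') (Sum.inr y)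
      (Sum.inr y') ⟨_, rfl, rfl⟩ ⟨_, rfl, rfl⟩).2 ((heq A₀ B x₀ y).symm.trans (heq A₀ B x₀ y')).le
  rcases x with x | x <;> rcases y with y | y
  · exact le_antisymm (hle x y) (hle y x)
  · exact heq A B x y
  · exact (heq A B y x).symm
  · exact le_antisymm (hle' x y) (hle' y x)

end prod

section list

variable {pos : ∀ v : (list a).Elem, Univ v → ℕ}

theorem pIso_reindex {l m : (list a).Elem} {f : Fin (List.length l) → Fin (List.length m)}
    (h : ∀ k, List.get l k = List.get m (f k)) (hf : ∀ i j, i ≤ j ↔ f i ≤ f j) :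
    PIso (list a) l m fun x y => reindex f h x = y :=
  FamIso.reindex (r := Eq) (PIso.refl m) h (f' := id) (fun _ => rfl) hf fun _ _ => Iff.rfl

/-- The map from the universe of a list to the universe of the list with a new first item. -/
def consLift (w : Item a) (l : (list a).Elem) (x : Univ l) :
    Univ (a := list a) (ofItems (w :: items l)) :=
  reindex (q := List.get l) (p := List.get (w :: items l)) Fin.succ (fun _ => rfl) x

theorem pIso_consLift (w : Item a) (l : (list a).Elem) :
    PIso (list a) l (ofItems (w :: items l)) fun x y => consLift w l x = y :=
  pIso_reindex _ fun _ _ => Fin.succ_le_succ_iff.symm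

theorem pIso_list_pair {k : Bool} (ha : Normal k a) {l m : (list a).Elem} {x y : Univ l}
    {x' y' : Univ m} (hx : leaf l x = leaf m x') (hy : leaf l y = leaf m y') (h : x.1 < y.1)
    (h' : x'.1 < y'.1) :
    PIso (list a) l m fun p q => p = x ∧ q = x' ∨ p = y ∧ q = y' := by
  refine ⟨?_, ?_⟩
  · rintro _ _ _ _ (⟨rfl, rfl⟩ | ⟨rfl, rfl⟩) (⟨rfl, rfl⟩ | ⟨rfl, rfl⟩)
    · exact iff_of_true le_rfl le_rfl
    · exact iff_of_true h.le h'.le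
    · exact iff_of_false h.not_ge h'.not_ge
    · exact iff_of_true le_rfl le_rfl
  · rintro _ _ (⟨rfl, rfl⟩ | ⟨rfl, rfl⟩)
    · refine (ha.pIso_singleton hx).mono ?_
      rintro u u' (⟨hu, hu'⟩ | ⟨hu, hu'⟩)
      · exact ⟨univ_list_mk_inj.1 hu, univ_list_mk_inj.1 hu'⟩
      · have hxy := congrArg (fun z : FamUniv (List.get l) => z.1) hu
        exact (h.ne hxy).elim
    · refine (ha.pIso_singleton hy).mono ?_
      rintro u u' (⟨hu, hu'⟩ | ⟨hu, hu'⟩)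
      · have hxy := congrArg (fun z : FamUniv (List.get l) => z.1) hu
        exact (h.ne' hxy).elim
      · exact ⟨univ_list_mk_inj.1 hu, univ_list_mk_inj.1 hu'⟩

/-- Points below a threshold precede the others. In the applications `m` is `l` with an additional
item, and `t` is set by a point of that item, the pivot. -/
theorem isCut_of_pivot (hpos : PosInvariant pos) {L : Set (list a).Leaf}
    (h : ∀ l, ∃ (m : (list a).Elem) (f : Univ l → Univ m) (t : ℕ),
      PIso (list a) l m (fun x y => f x = y) ∧ ∀ x, leaf l x ∈ L ↔ pos m (f x) < t) :
    IsCut pos L := by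
  intro l x y hx hy
  obtain ⟨m, f, t, hf, ht⟩ := h l
  rw [ht] at hx hy
  exact (hpos.lt_iff hf rfl rfl).2 (hx.trans_le (not_lt.1 hy))

/-- For points in different items, the comparison depends only on the two leaves and on which item
is earlier. Comparing with a pivot put in front or at the end turns each such dependence into a cut,
so without cuts it does not depend on the leaves. -/
theorem PosInvariant.trichotomy_of_list (hpos : PosInvariant pos) (hind : Indecomposable pos)
    (ha : Normal true a) :
    (∀ l x y, pos l x = pos l y) ∨ (∀ (l : (list a).Elem) (x y : Univ l), x.1 < y.1 → pos l x < pos l y) ∨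
      ∀ (l : (list a).Elem) (x y : Univ l), x.1 < y.1 → pos l y < pos l x := by
  have hlt : ∀ {l m : (list a).Elem} {x y : Univ l} {x' y' : Univ m}, leaf l x = leaf m x' →
      leaf l y = leaf m y' → x.1 < y.1 → x'.1 < y'.1 → (pos l x < pos l y ↔ pos m x' < pos m y') :=
    fun hx hy h h' => hpos.lt_iff (pIso_list_pair ha hx hy h h') (.inl ⟨rfl, rfl⟩) (.inr ⟨rfl, rfl⟩)
  have hgt : ∀ {l m : (list a).Elem} {x y : Univ l} {x' y' : Univ m}, leaf l x = leaf m x' →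
      leaf l y = leaf m y' → x.1 < y.1 → x'.1 < y'.1 → (pos l y < pos l x ↔ pos m y' < pos m x') :=
    fun hx hy h h' => hpos.lt_iff (pIso_list_pair ha hx hy h h') (.inr ⟨rfl, rfl⟩) (.inl ⟨rfl, rfl⟩)
  let F : (list a).Leaf → (list a).Leaf → Prop := fun i j => ∃ (l : (list a).Elem) (x y : Univ l),
    leaf l x = i ∧ leaf l y = j ∧ x.1 < y.1 ∧ pos l x < pos l y
  let B : (list a).Leaf → (list a).Leaf → Prop := fun i j => ∃ (l : (list a).Elem) (x y : Univ l),
    leaf l x = i ∧ leaf l y = j ∧ x.1 < y.1 ∧ pos l y < pos l x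
  have hF : ∀ (l : (list a).Elem) (x y : Univ l), x.1 < y.1 →
      (F (leaf l x) (leaf l y) ↔ pos l x < pos l y) := fun l x y h =>
    ⟨fun ⟨m, x', y', hx, hy, h', hp⟩ => (hlt hx hy h' h).1 hp, fun hp => ⟨l, x, y, rfl, rfl, h, hp⟩⟩
  have hB : ∀ (l : (list a).Elem) (x y : Univ l), x.1 < y.1 →
      (B (leaf l x) (leaf l y) ↔ pos l y < pos l x) := fun l x y h =>
    ⟨fun ⟨m, x', y', hx, hy, h', hp⟩ => (hgt hx hy h' h).1 hp, fun hp => ⟨l, x, y, rfl, rfl, h, hp⟩⟩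
  have hleft : ∀ (i : (list a).Leaf) (l : (list a).Elem), ∃ (m : (list a).Elem)
      (f : Univ l → Univ m) (z : Univ m), PIso (list a) l m (fun x y => f x = y) ∧
        leaf m z = i ∧ ∀ x, z.1 < (f x).1 := by
    intro i l
    obtain ⟨w, u, hu⟩ := exists_leaf_eq (a := a) i
    exact ⟨ofItems (⟨w, ⟨u⟩⟩ :: items l), consLift ⟨w, ⟨u⟩⟩ l,
      ⟨⟨0, Nat.succ_pos (List.length l)⟩, u⟩, pIso_consLift ⟨w, ⟨u⟩⟩ l, hu, fun x => Fin.succ_pos _⟩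
  have hright : ∀ (i : (list a).Leaf) (l : (list a).Elem), ∃ (m : (list a).Elem)
      (f : Univ l → Univ m) (z : Univ m), PIso (list a) l m (fun x y => f x = y) ∧
        leaf m z = i ∧ ∀ x, (f x).1 < z.1 := by
    intro i l
    obtain ⟨w, u, hu⟩ := exists_leaf_eq (a := a) i
    let m : List (Item a) := items l ++ [⟨w, ⟨u⟩⟩]
    have hm : List.length m = List.length l + 1 := List.length_append
    have hk : List.length l < List.length m := by omega
    have hget : w = (List.get m ⟨List.length l, hk⟩).1 :=
      (congrArg Subtype.val (List.getElem_concat_length (l := items l) rfl hk)).symm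
    refine ⟨m, reindex (q := List.get l) (p := List.get m) (fun k => ⟨k.1, k.2.trans hk⟩) ?_,
      ⟨⟨List.length l, hk⟩, castUniv hget u⟩, pIso_reindex _ fun _ _ => Iff.rfl,
      (leaf_castUniv hget u).trans hu, fun x => x.1.2⟩
    intro k
    exact (List.getElem_append_left k.2).symm
  have hcut1 : ∀ i, IsCut pos {j | B i j} := fun i => isCut_of_pivot hpos fun l => by
    obtain ⟨m, f, z, hf, rfl, hz⟩ := hleft i l
    exact ⟨m, f, pos m z, hf, fun x => by
      rw [Set.mem_ofPred_eq, hf.leaf_eq (x := x) rfl, hB _ _ _ (hz x)]⟩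
  have hcut2 : ∀ i, IsCut pos {j | ¬ F i j} := fun i => isCut_of_pivot hpos fun l => by
    obtain ⟨m, f, z, hf, rfl, hz⟩ := hleft i l
    -- The threshold is one higher here: the points wanted are those not after the pivot.
    exact ⟨m, f, pos m z + 1, hf, fun x => by
      rw [Set.mem_ofPred_eq, hf.leaf_eq (x := x) rfl, hF _ _ _ (hz x), Nat.lt_succ_iff, not_lt]⟩
  have hcut3 : ∀ j, IsCut pos {i | F i j} := fun i => isCut_of_pivot hpos fun l => by
    obtain ⟨m, f, z, hf, rfl, hz⟩ := hright i l
    exact ⟨m, f, pos m z, hf, fun x => by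
      rw [Set.mem_ofPred_eq, hf.leaf_eq (x := x) rfl, hF _ _ _ (hz x)]⟩
  have hcut4 : ∀ j, IsCut pos {i | ¬ B i j} := fun i => isCut_of_pivot hpos fun l => by
    obtain ⟨m, f, z, hf, rfl, hz⟩ := hright i l
    exact ⟨m, f, pos m z + 1, hf, fun x => by
      rw [Set.mem_ofPred_eq, hf.leaf_eq (x := x) rfl, hB _ _ _ (hz x), Nat.lt_succ_iff, not_lt]⟩
  have hFc : ∀ i j i' j', F i j → F i' j' := by
    intro i j i' j' h
    have h1 : F i j' := by
      rcases hind _ (hcut2 i) with h' | h'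
      · exact not_not.1 (h' j')
      · exact (h' j h).elim
    rcases hind _ (hcut3 j') with h' | h'
    · exact (h' i h1).elim
    · exact h' i'
  have hBc : ∀ i j i' j', B i j → B i' j' := by
    intro i j i' j' h
    have h1 : B i j' := by
      rcases hind _ (hcut1 i) with h' | h'
      · exact (h' j h).elim
      · exact h' j'
    rcases hind _ (hcut4 j') with h' | h'
    · exact not_not.1 (h' i')
    · exact (h' i h1).elim
  obtain ⟨i₀⟩ := nonempty_leaf (list a)
  by_cases hF₀ : F i₀ i₀
  · exact .inr (.inl fun l x y h => (hF l x y h).1 (hFc _ _ _ _ hF₀))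
  by_cases hB₀ : B i₀ i₀
  · exact .inr (.inr fun l x y h => (hB l x y h).1 (hBc _ _ _ _ hB₀))
  refine .inl fun l x y => ?_
  have heq : ∀ (m : (list a).Elem) (x y : Univ m), x.1 < y.1 → pos m x = pos m y := fun m x y h =>
    le_antisymm (not_lt.1 fun h' => hB₀ (hBc _ _ _ _ ((hB m x y h).2 h')))
      (not_lt.1 fun h' => hF₀ (hFc _ _ _ _ ((hF m x y h).2 h')))
  -- `x` and `y` may lie in the same item, so both are compared with a new first item.
  obtain ⟨m, f, z, hf, -, hz⟩ := hleft i₀ l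
  have h1 : pos m (f x) = pos m (f y) := (heq m z _ (hz x)).symm.trans (heq m z _ (hz y))
  exact le_antisymm ((hpos _ _ _ hf _ _ _ _ rfl rfl).2 h1.le)
    ((hpos _ _ _ hf _ _ _ _ rfl rfl).2 h1.ge)

end list

/-! ### Completeness for outputs in `one`, sums and products -/

/-- Either some factor is `one` and can be projected to, or all factors are lists and can be empty.
-/
theorem Normal.derivable_one_or_isEmpty (ha : Normal false a) :
    (∃ f : a.Elem → ListType.one.Elem, Derivable f) ∨ ∃ v : a.Elem, IsEmpty (Univ v) := by
  generalize hk : false = k at ha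
  induction ha with
  | one => exact .inl ⟨_, .id⟩
  | @list a _ _ => exact .inr ⟨([] : List (Item a)), ⟨fun u => u.1.elim0⟩⟩
  | prod _ _ ih ih' =>
    rcases ih hk with ⟨f, hf⟩ | ⟨v, hv⟩
    · exact .inl ⟨_, Derivable.fst.comp hf⟩
    rcases ih' hk with ⟨f, hf⟩ | ⟨w, hw⟩
    · exact .inl ⟨_, Derivable.snd.comp hf⟩
    · exact .inr ⟨(v, w), ⟨fun u => Sum.casesOn u hv.false hw.false⟩⟩
  | base => cases hk
  | sum => cases hk

theorem Lifts.mem_range_iff {k : Bool} (ha : Normal k a) {f : a.Elem → b.Elem}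
    {e : ∀ v, Univ (f v) → Univ v} (hf : Lifts f e) {v w : a.Elem} {x : Univ v} {y : Univ w}
    (h : leaf v x = leaf w y) : x ∈ Set.range (e v) ↔ y ∈ Set.range (e w) :=
  hf.2 _ _ _ _ _ (ha.pIso_singleton h) ⟨rfl, rfl⟩

theorem Lifts.exists_eq_of_isEmpty (ha : Normal false a) {f : a.Elem → b.Elem}
    {e : ∀ v, Univ (f v) → Univ v} (hf : Lifts f e) (h : ∀ v, IsEmpty (Univ (f v))) :
    ∃ w : b.Elem, IsEmpty (Univ w) ∧ ∀ v, f v = w := by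
  obtain ⟨v₀⟩ := nonempty_elem a
  exact ⟨f v₀, h v₀, fun v => (hf.1 _ _ _ (ha.pIso_bot v v₀)).eq_of_total
    (fun x => (h v).elim x) fun y => (h v₀).elim y⟩

/-- All functions from `a` to `c` that can be lifted are derivable. -/
def Complete (a c : ListType) : Prop :=
  ∀ f : a.Elem → c.Elem, (∃ e, Lifts f e) → Derivable f

/-- The substitute for copying the input: `f` and `g` use disjoint sets of leaves, so each is
applied to its own half of a split. -/
theorem Lifts.derivable_pair (ha : Normal false a) {f : a.Elem → c.Elem} {g : a.Elem → d.Elem}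
    {e : ∀ v, Univ (f v) → Univ v} {e' : ∀ v, Univ (g v) → Univ v} (hf : Lifts f e)
    (hg : Lifts g e') {S : Set a.Leaf} (hS : ∀ v x, leaf v (e v x) ∈ S)
    (hS' : ∀ v x, leaf v (e' v x) ∉ S) (h : ¬ ∀ i, i ∉ S) (h' : ¬ ∀ i, i ∈ S)
    (hc : ∀ b, Normal false b → size b < size a → Complete b c)
    (hd : ∀ b, Normal false b → size b < size a → Complete b d) :
    Derivable (b := prod c d) fun v => (f v, g v) := by
  obtain ⟨b, b', p, q, hb, hb', hs, hs', hp, hq, hpq⟩ :=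
    ((ha.splits S).resolve_left h).resolve_left h'
  obtain ⟨f', hf', hfp⟩ := hf.exists_factor hp hS
  obtain ⟨g', hg', hgq⟩ := hg.exists_factor hq hS'
  refine (hpq.comp ((hc b hb hs f' hf').prodMap (hd b' hb' hs' g' hg'))).congr fun v => ?_
  exact Prod.ext (hfp v).symm (hgq v).symm

theorem complete_one (ha : Normal false a) : Complete a one := by
  rintro f ⟨e, -⟩
  rcases ha.derivable_one_or_isEmpty with ⟨g, hg⟩ | ⟨v, hv⟩
  · exact hg.congr fun _ => rfl
  · exact (hv.false (e v ())).elim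

/-- All inputs are related by the empty partial isomorphism, so all outputs lie on the same side. -/
theorem complete_sum (ha : Normal false a) (hc : Complete a c) (hd : Complete a d) :
    Complete a (sum c d) := by
  rintro f ⟨e, hf⟩
  obtain ⟨v₀⟩ := nonempty_elem a
  have h := fun v => hf.1 _ _ _ (ha.pIso_bot v v₀)
  obtain ⟨y, hy⟩ | ⟨y, hy⟩ : (∃ y : c.Elem, f v₀ = inl y) ∨ ∃ y : d.Elem, f v₀ = inr y := by
    rcases f v₀ with y | y
    exacts [.inl ⟨y, rfl⟩, .inr ⟨y, rfl⟩]
  · have h' : ∀ v, ∃ x : c.Elem, f v = inl x := by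
      intro v
      have := (h v).mono (r := fun _ _ => False) fun _ _ => False.elim
      rw [hy] at this
      generalize f v = z at this
      rcases z with x | x
      exacts [⟨x, rfl⟩, this.elim]
    choose g hg using h'
    obtain rfl : f = fun v => inl (g v) := funext hg
    exact (hc g ⟨e, hf⟩).comp .inl
  · have h' : ∀ v, ∃ x : d.Elem, f v = inr x := by
      intro v
      have := (h v).mono (r := fun _ _ => False) fun _ _ => False.elim
      rw [hy] at this
      generalize f v = z at this
      rcases z with x | x
      exacts [this.elim, ⟨x, rfl⟩]
    choose g hg using h'
    obtain rfl : f = fun v => inr (g v) := funext hg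
    exact (hd g ⟨e, hf⟩).comp .inr

/-- Membership in the image of a component depends on the leaf only, and the two images are
disjoint, so no leaf serves both. A component whose values all have empty universe is constant and
is adjoined separately. -/
theorem complete_prod (hc : ∀ b, Normal false b → Complete b c)
    (hd : ∀ b, Normal false b → Complete b d) (ha : Normal false a) : Complete a (prod c d) := by
  rintro f ⟨e, hf⟩
  have h1 := hf.comp lifts_fst
  have h2 := hf.comp lifts_snd
  by_cases h : ∀ v, IsEmpty (Univ (fst (f v)))
  · obtain ⟨w, hw, hfw⟩ := h1.exists_eq_of_isEmpty ha h
    exact (((hd a ha _ ⟨_, h2⟩).comp (.pairConst hw)).comp .prodComm).congr fun v =>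
      Prod.ext (hfw v).symm rfl
  by_cases h' : ∀ v, IsEmpty (Univ (snd (f v)))
  · obtain ⟨w, hw, hfw⟩ := h2.exists_eq_of_isEmpty ha h'
    exact ((hc a ha _ ⟨_, h1⟩).comp (.pairConst hw)).congr fun v => Prod.ext rfl (hfw v).symm
  push Not at h h'
  obtain ⟨v, ⟨x⟩⟩ := h
  obtain ⟨w, ⟨y⟩⟩ := h'
  have hdisj : ∀ v x w y, leaf v (e v (Sum.inl x)) ≠ leaf w (e w (Sum.inr y)) := by
    intro v x w y hxy
    obtain ⟨z, hz⟩ := (h1.mem_range_iff ha hxy).1 ⟨x, rfl⟩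
    exact Sum.inl_ne_inr (hf.injective .refl w hz)
  refine h1.derivable_pair ha h2 (S := {i | ∃ v x, leaf v (e v (Sum.inl x)) = i})
    (fun v x => ⟨v, x, rfl⟩) (fun w y ⟨v, x, h⟩ => hdisj v x w y h) (fun h => h _ ⟨v, x, rfl⟩)
    (fun h => ?_) (fun b hb _ => hc b hb) fun b hb _ => hd b hb
  obtain ⟨v, x, h⟩ := h (leaf w (e w (Sum.inr y)))
  exact hdisj _ _ _ _ h

/-! Positions of the elements in the output of a function to lists -/

theorem range_reindex {J K : Type} {p : J → Item a} {q : K → Item a} {f : K → J}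
    (h : ∀ k, q k = p (f k)) (x : FamUniv p) :
    x ∈ Set.range (reindex f h) ↔ x.1 ∈ Set.range f := by
  constructor
  · rintro ⟨y, rfl⟩
    exact ⟨y.1, rfl⟩
  · obtain ⟨j, x⟩ := x
    rintro ⟨k, rfl⟩
    obtain ⟨y, rfl⟩ := castUniv_surjective (congrArg Subtype.val (h k)) x
    exact ⟨⟨k, y⟩, rfl⟩

/-- The first `k` items. -/
def takeList (k : ℕ) (l : (list a).Elem) : (list a).Elem := ofItems ((items l).take k)

/-- All but the first `k` items. -/
def dropList (k : ℕ) (l : (list a).Elem) : (list a).Elem := ofItems ((items l).drop k)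

theorem appendLists_take_drop (k : ℕ) (l : (list a).Elem) :
    appendLists (takeList k l, dropList k l) = l :=
  List.take_append_drop k (items l)

/-- `m` is given by the items of `l` at the positions in `S`. -/
def IsSublist (S : Set ℕ) (m l : (list a).Elem) (ι : Univ m → Univ l) : Prop :=
  (∀ x, x ∈ Set.range ι ↔ x.1.1 ∈ S) ∧
    (∀ n r, PIso (list a) n l r → PIso (list a) n m fun x y => r x (ι y)) ∧
    ∀ n r, PIso (list a) l n r → PIso (list a) m n fun x y => r (ι x) y

theorem isSublist_reindex {m l : (list a).Elem} {f : Fin (List.length m) → Fin (List.length l)}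
    (h : ∀ k, List.get m k = List.get l (f k)) (hf : ∀ i j, i ≤ j ↔ f i ≤ f j) {S : Set ℕ}
    (hS : ∀ j, j ∈ Set.range f ↔ j.1 ∈ S) : IsSublist S m l (reindex f h) := by
  refine ⟨fun x => (range_reindex h x).trans (hS _), fun n r hr => ?_, fun n r hr => ?_⟩
  · exact FamIso.reindex hr (q := List.get n) (f := id) (fun _ => rfl) h (fun _ _ => Iff.rfl) hf
  · exact FamIso.reindex hr (q' := List.get n) (f' := id) h (fun _ => rfl) hf fun _ _ => Iff.rfl

theorem exists_isSublist_take (k : ℕ) (l : (list a).Elem) :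
    ∃ ι, IsSublist {i | i < k} (takeList k l) l ι := by
  have hlen : List.length (takeList k l) = min k (List.length l) := List.length_take
  refine ⟨_, isSublist_reindex (f := fun i => ⟨i.1, (i.2.trans_eq hlen).trans_le (min_le_right _ _)⟩)
    (fun i => List.getElem_take) (fun _ _ => Iff.rfl) fun j => ⟨?_, fun h => ?_⟩⟩
  · rintro ⟨i, rfl⟩
    exact (i.2.trans_eq hlen).trans_le (min_le_left _ _)
  · change j.1 < k at h
    exact ⟨⟨j.1, (lt_min h j.2).trans_eq hlen.symm⟩, rfl⟩

theorem exists_isSublist_drop (k : ℕ) (l : (list a).Elem) :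
    ∃ ι, IsSublist {i | k ≤ i} (dropList k l) l ι := by
  have hlen : List.length (dropList k l) = List.length l - k := List.length_drop
  refine ⟨_, isSublist_reindex (f := fun i => ⟨k + i.1, Nat.add_lt_of_lt_sub' (i.2.trans_eq hlen)⟩)
    (fun i => List.getElem_drop) (fun i j => ?_) fun j => ⟨?_, fun h => ?_⟩⟩
  · simp only [Fin.le_def]
    omega
  · rintro ⟨i, rfl⟩
    exact Nat.le_add_right k i.1
  · change k ≤ j.1 at h
    exact ⟨⟨j.1 - k, (Nat.sub_lt_sub_right h j.2).trans_eq hlen.symm⟩, Fin.ext (Nat.add_sub_of_le h)⟩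

/-- The strict inequality keeps `T` and its complement from sharing an item, so `T` consists of the
points of a prefix. -/
theorem exists_forall_mem_iff_lt {l : (list a).Elem} {T : Set (Univ l)}
    (h : ∀ x y, x ∈ T → y ∉ T → x.1.1 < y.1.1) : ∃ k, ∀ x, x ∈ T ↔ x.1.1 < k := by
  classical
  have hex : ∃ k, ∀ x ∈ T, x.1.1 < k := ⟨List.length l, fun x _ => x.1.2⟩
  refine ⟨Nat.find hex, fun x => ⟨Nat.find_spec hex x, fun hx => ?_⟩⟩
  by_contra hxT
  exact Nat.find_min hex hx fun y hy => h y x hy hxT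

/-- A choice of numerical positions is not invariant by itself; it becomes so because `hL` describes
it by leaves. -/
theorem Lifts.of_isSublist {f g : a.Elem → (list c).Elem} {e : ∀ v, Univ (f v) → Univ v}
    (hf : Lifts f e) {S : a.Elem → Set ℕ} {ι : ∀ v, Univ (g v) → Univ (f v)}
    (hι : ∀ v, IsSublist (S v) (g v) (f v) (ι v)) {L : Set a.Leaf}
    (hL : ∀ v x, x.1.1 ∈ S v ↔ leaf v (e v x) ∈ L) : Lifts g fun v x => e v (ι v x) := by
  refine ⟨fun v w r h => (hι v).2.2 _ _ ((hι w).2.1 _ _ (hf.1 v w r h)),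
    fun v w r x y h hxy => ?_⟩
  have key : ∀ v x, x ∈ Set.range (fun u => e v (ι v u)) ↔ x ∈ Set.range (e v) ∧ leaf v x ∈ L := by
    intro v x
    constructor
    · rintro ⟨u, rfl⟩
      exact ⟨⟨_, rfl⟩, (hL _ _).1 (((hι v).1 _).1 ⟨u, rfl⟩)⟩
    · rintro ⟨⟨u, rfl⟩, hx⟩
      obtain ⟨u, rfl⟩ := ((hι v).1 u).2 ((hL _ _).2 hx)
      exact ⟨u, rfl⟩
  rw [key, key, hf.2 v w r x y h hxy, h.leaf_eq hxy]

/-- The position in the output of an element of the input. -/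
def outPos (f : a.Elem → (list c).Elem) (F : ∀ v, Univ v → Univ (f v)) (v : a.Elem)
    (x : Univ v) : ℕ :=
  (F v x).1.1

section outPos

variable {f : a.Elem → (list c).Elem} {e : ∀ v, Univ (f v) → Univ v}
  {F : ∀ v, Univ v → Univ (f v)}

theorem Lifts.posInvariant (hf : Lifts f e) (hF : ∀ v x, e v (F v x) = x) :
    PosInvariant (outPos f F) := by
  intro v w r h x y x' y' hx hy
  exact (hf.1 v w r h).1 (F v x) (F v y) (F w x') (F w y') (by beta_reduce; rwa [hF, hF])
    (by beta_reduce; rwa [hF, hF])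

theorem Lifts.right_inv (hf : Lifts f e) (hF : ∀ v x, e v (F v x) = x) (v : a.Elem)
    (u : Univ (f v)) : F v (e v u) = u :=
  hf.injective .refl v (hF v _)

theorem Lifts.derivable_of_cut (ha : Normal false a) (hf : Lifts f e)
    (hF : ∀ v x, e v (F v x) = x) (ih : ∀ b, Normal false b → size b < size a → Complete b (list c))
    {L : Set a.Leaf} (hL : IsCut (outPos f F) L) (h : ¬ ∀ i, i ∉ L) (h' : ¬ ∀ i, i ∈ L) :
    Derivable f := by
  have hk : ∀ v, ∃ k, ∀ x, leaf v (e v x) ∈ L ↔ x.1.1 < k := fun v =>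
    exists_forall_mem_iff_lt (T := {x | leaf v (e v x) ∈ L}) fun x y hx hy => by
      have := hL v _ _ hx hy
      rwa [outPos, outPos, hf.right_inv hF, hf.right_inv hF] at this
  choose k hk using hk
  choose ι hι using fun v => exists_isSublist_take (k v) (f v)
  choose κ hκ using fun v => exists_isSublist_drop (k v) (f v)
  have h1 := hf.of_isSublist hι fun v x => (hk v x).symm
  have h2 := hf.of_isSublist hκ (L := Lᶜ) fun v x => not_lt.symm.trans (not_congr (hk v x).symm)
  refine ((h1.derivable_pair ha h2 (S := L) (fun v x => ?_) (fun v x => ?_) h h' ih ih).comp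
    .appendLists).congr fun v => appendLists_take_drop (k v) (f v)
  · exact (hk v _).2 (((hι v).1 _).1 ⟨x, rfl⟩)
  · exact fun hx => (((hκ v).1 _).1 ⟨x, rfl⟩).not_gt ((hk v _).1 hx)

/-- `m` and `n` are complementary substructures of `l`, the first placed before the second in the
output. So `f m` and `f n` are isomorphic to a prefix of `f l` and to the remaining suffix, hence
equal to them. -/
theorem Lifts.eq_append (hf : Lifts f e) (hF : ∀ v x, e v (F v x) = x) {l m n : a.Elem}
    {ι : Univ m → Univ l} {κ : Univ n → Univ l} (hι : PIso a m l fun x y => ι x = y)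
    (hκ : PIso a n l fun x y => κ x = y) (hcov : ∀ z, (∃ x, ι x = z) ∨ ∃ y, κ y = z)
    (hlt : ∀ x y, outPos f F l (ι x) < outPos f F l (κ y)) :
    f l = appendLists (f m, f n) := by
  obtain ⟨k, hk⟩ := exists_forall_mem_iff_lt (T := {z | e l z ∈ Set.range ι}) fun x y hx hy => by
    obtain ⟨x', hx'⟩ := hx
    obtain ⟨y', hy'⟩ := (hcov (e l y)).resolve_left hy
    have := hlt x' y'
    rwa [hx', hy', outPos, outPos, hf.right_inv hF, hf.right_inv hF] at this
  obtain ⟨s, hs⟩ := exists_isSublist_take k (f l)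
  obtain ⟨t, ht⟩ := exists_isSublist_drop k (f l)
  have h1 : f m = takeList k (f l) := by
    refine PIso.eq_of_total (hs.2.1 _ _ (hf.1 _ _ _ hι)) (fun x => ?_) fun y => ?_
    · obtain ⟨y, hy⟩ := (hs.1 (F l (ι (e m x)))).2
        ((hk _).1 (by change e l _ ∈ Set.range ι; rw [hF]; exact ⟨_, rfl⟩))
      exact ⟨y, by rw [hy, hF]⟩
    · obtain ⟨x, hx⟩ := (hk _).2 ((hs.1 _).1 ⟨y, rfl⟩)
      exact ⟨F m x, by rw [hF, hx]⟩
  have h2 : f n = dropList k (f l) := by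
    refine PIso.eq_of_total (ht.2.1 _ _ (hf.1 _ _ _ hκ)) (fun x => ?_) fun y => ?_
    · obtain ⟨y, hy⟩ := (ht.1 (F l (κ (e n x)))).2 (not_lt.1 fun h => by
        obtain ⟨z, hz⟩ := (hk _).2 h
        rw [hF] at hz
        have := hlt z (e n x)
        rw [hz] at this
        exact this.false)
      exact ⟨y, by rw [hy, hF]⟩
    · obtain ⟨x, hx⟩ := (hcov (e l (t y))).resolve_left fun h =>
        (((ht.1 _).1 ⟨y, rfl⟩ : k ≤ (t y).1.1)).not_gt ((hk _).1 h)
      exact ⟨F n x, by rw [hF, hx]⟩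
  rw [h1, h2, appendLists_take_drop]

end outPos

/-! ### Functions whose output list has at most one item -/

/-- An empty universe is possible only if every factor is a list, and then any leaf can be repeated
in two items. -/
theorem Normal.exists_leaf_eq_leaf (ha : Normal false a) {v₀ : a.Elem} (h : IsEmpty (Univ v₀))
    (i : a.Leaf) : ∃ (v : a.Elem) (x y : Univ v), x ≠ y ∧ leaf v x = i ∧ leaf v y = i := by
  generalize hk : false = k at ha
  induction ha with
  | one => exact (h.false ()).elim
  | @list a _ _ =>
    obtain ⟨w, u, hu⟩ := exists_leaf_eq (a := a) i
    let l : List (Item a) := [⟨w, ⟨u⟩⟩, ⟨w, ⟨u⟩⟩]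
    refine ⟨l, ⟨⟨0, Nat.two_pos⟩, u⟩, ⟨⟨1, Nat.one_lt_two⟩, u⟩, fun h => ?_, hu, hu⟩
    have := congrArg (fun z : FamUniv (List.get l) => z.1.1) h
    exact Nat.zero_ne_one this
  | @prod a b _ _ ih ih' =>
    rcases v₀ with ⟨v₁, v₂⟩
    rcases i with i | i
    · obtain ⟨v, x, y, hxy, hx, hy⟩ := ih (v₀ := v₁) ⟨fun u => h.false (Sum.inl u)⟩ i hk
      exact ⟨(v, v₂), Sum.inl x, Sum.inl y, fun h => hxy (Sum.inl_injective h),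
        congrArg Sum.inl hx, congrArg Sum.inl hy⟩
    · obtain ⟨v, x, y, hxy, hx, hy⟩ := ih' (v₀ := v₂) ⟨fun u => h.false (Sum.inr u)⟩ i hk
      exact ⟨(v₁, v), Sum.inr x, Sum.inr y, fun h => hxy (Sum.inr_injective h),
        congrArg Sum.inr hx, congrArg Sum.inr hy⟩
  | base => cases hk
  | sum => cases hk

/-- The point of the second alternative comes from a `one` that is present in `v` outside all lists.
If there is none, emptying the lists keeps the nullary relations. -/
theorem exists_isEmpty_or_unique (v : a.Elem) :
    (∃ w : a.Elem, IsEmpty (Univ w) ∧ PIso a w v fun _ _ => False) ∨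
      ∃ x : Univ v, ∀ (w : a.Elem) (y y' : Univ w), PIso a v w (fun s t => s = x ∧ t = y) →
        PIso a v w (fun s t => s = x ∧ t = y') → y = y' := by
  induction a with
  | one => exact .inr ⟨(), fun _ _ _ _ _ => rfl⟩
  | sum a b iha ihb =>
    rcases v with v | v
    · rcases iha v with ⟨w, hw⟩ | ⟨x, hx⟩
      · exact .inl ⟨Sum.inl w, hw⟩
      · refine .inr ⟨x, ?_⟩
        rintro (w | w) y y' h h'
        exacts [hx w y y' h h', h.elim]
    · rcases ihb v with ⟨w, hw⟩ | ⟨x, hx⟩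
      · exact .inl ⟨Sum.inr w, hw⟩
      · refine .inr ⟨x, ?_⟩
        rintro (w | w) y y' h h'
        exacts [h.elim, hx w y y' h h']
  | prod a b iha ihb =>
    rcases v with ⟨v, v'⟩
    rcases iha v with ⟨w, hw, h⟩ | ⟨x, hx⟩
    · rcases ihb v' with ⟨w', hw', h'⟩ | ⟨x, hx⟩
      · exact .inl ⟨(w, w'), ⟨fun u => Sum.casesOn u hw.false hw'.false⟩, fun _ _ => id,
          fun _ _ => id, h, h'⟩
      · refine .inr ⟨Sum.inr x, ?_⟩
        rintro ⟨w, w'⟩ (y | y) (y' | y') h h'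
        · exact (h.2.1 _ _ ⟨rfl, rfl⟩).elim
        · exact (h.2.1 _ _ ⟨rfl, rfl⟩).elim
        · exact (h'.2.1 _ _ ⟨rfl, rfl⟩).elim
        · refine congrArg Sum.inr (hx w' y y' (h.2.2.2.mono ?_) (h'.2.2.2.mono ?_))
          · rintro _ _ ⟨rfl, rfl⟩
            exact ⟨rfl, rfl⟩
          · rintro _ _ ⟨rfl, rfl⟩
            exact ⟨rfl, rfl⟩
    · refine .inr ⟨Sum.inl x, ?_⟩
      rintro ⟨w, w'⟩ (y | y) (y' | y') h h'
      · refine congrArg Sum.inl (hx w y y' (h.2.2.1.mono ?_) (h'.2.2.1.mono ?_))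
        · rintro _ _ ⟨rfl, rfl⟩
          exact ⟨rfl, rfl⟩
        · rintro _ _ ⟨rfl, rfl⟩
          exact ⟨rfl, rfl⟩
      · exact (h'.1 _ _ ⟨rfl, rfl⟩).elim
      · exact (h.1 _ _ ⟨rfl, rfl⟩).elim
      · exact (h.1 _ _ ⟨rfl, rfl⟩).elim
  | list a _ =>
    exact .inl ⟨([] : List (Item a)), ⟨fun u => u.1.elim0⟩, fun _ _ _ _ h => h.elim,
      fun _ _ h => h.elim⟩

theorem single_item (y : Item a) : single y.1 = [y] := dif_pos y.2

theorem exists_eq_single {l : (list a).Elem} (h : ∀ x y : Univ l, x.1 = y.1) (hl : Nonempty (Univ l)) :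
    ∃ y : a.Elem, l = ofItems (single y) := by
  rcases l with _ | ⟨y, _ | ⟨z, l⟩⟩
  · exact hl.elim fun u => u.1.elim0
  · exact ⟨y.1, (single_item y).symm⟩
  · have := h ⟨⟨0, Nat.succ_pos _⟩, y.2.some⟩ ⟨⟨1, Nat.succ_lt_succ (Nat.succ_pos _)⟩, z.2.some⟩
    exact (Nat.zero_ne_one (congrArg Fin.val this)).elim

section outPos

variable {f : a.Elem → (list c).Elem} {e : ∀ v, Univ (f v) → Univ v}
  {F : ∀ v, Univ v → Univ (f v)}

/-- An empty output list determines no item, so for such inputs a value `y` with empty universe must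
be supplied that satisfies the same nullary relations as the other items; otherwise `f` would not
factor through a function that lifts. -/
theorem Lifts.exists_single (ha : Normal false a) (hf : Lifts f e) (hF : ∀ v x, e v (F v x) = x)
    (heq : ∀ v x y, outPos f F v x = outPos f F v y) :
    ∃ w : c.Elem, ∀ v, ∃ y : c.Elem, f v = ofItems (single y) ∧ PIso c y w fun _ _ => False := by
  have hsing : ∀ v, Nonempty (Univ v) → ∃ y : c.Elem, f v = ofItems (single y) := fun v ⟨x⟩ =>
    exists_eq_single (fun x y => Fin.ext (by
      have := heq v (e v x) (e v y)
      rwa [outPos, outPos, hf.right_inv hF, hf.right_inv hF] at this)) ⟨F v x⟩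
  have hpair : ∀ {v w : a.Elem} {x : Univ v} {y : Univ w} {s t : c.Elem} (_ : leaf v x = leaf w y)
      (hs : f v = ofItems (single s)) (ht : f w = ofItems (single t)),
      PIso c s t fun p q => p = singleLift s (castUniv hs (F v x)) ∧
        q = singleLift t (castUniv ht (F w y)) := by
    intro v w x y s t h hs ht
    have h1 : PIso (list c) (f v) (f w) fun p q => castUniv hs p = castUniv hs (F v x) ∧
        castUniv ht q = castUniv ht (F w y) := by
      refine (hf.1 _ _ _ (ha.pIso_singleton h)).mono ?_
      rintro p q ⟨hp, hq⟩
      exact ⟨(congrArg (e v) (castUniv_injective hs hp)).trans (hF v x),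
        (congrArg (e w) (castUniv_injective ht hq)).trans (hF w y)⟩
    refine (pIso_of_single ((pIso_castUniv hs ht (r := fun p q => p = castUniv hs (F v x) ∧
      q = castUniv ht (F w y))).1 h1) ⟨rfl, rfl⟩).mono ?_
    rintro _ _ ⟨rfl, rfl⟩
    exact ⟨_, _, ⟨rfl, rfl⟩, rfl, rfl⟩
  obtain ⟨v₀, hv₀⟩ := ha.exists_forall_leaf
  obtain ⟨x₀, -⟩ := hv₀ (Classical.arbitrary _)
  obtain ⟨w₀, hw₀⟩ := hsing v₀ ⟨x₀⟩
  refine ⟨w₀, fun v => ?_⟩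
  by_cases hv : Nonempty (Univ v)
  · obtain ⟨y, hy⟩ := hsing v hv
    obtain ⟨x⟩ := hv
    obtain ⟨x', hx'⟩ := hv₀ (leaf v x)
    exact ⟨y, hy, (hpair hx'.symm hy hw₀).mono fun _ _ => False.elim⟩
  · rcases exists_isEmpty_or_unique w₀ with ⟨y, hy, hyw⟩ | ⟨u, hu⟩
    · refine ⟨y, ?_, hyw⟩
      rw [single, dif_neg (not_nonempty_iff.2 hy)]
      exact eq_nil_of_isEmpty fun ⟨u⟩ => hv ⟨e v u⟩
    -- The unique point `u` comes from some leaf of the input. As `v` is empty, another input has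
    -- two points from that leaf, and both would have to correspond to `u`.
    · obtain ⟨t, rfl⟩ := singleLift_surjective w₀ u
      obtain ⟨t, rfl⟩ := castUniv_surjective hw₀ t
      obtain ⟨w, x, y, hxy, hx, hy⟩ :=
        ha.exists_leaf_eq_leaf (not_nonempty_iff.1 hv) (leaf v₀ (e v₀ t))
      obtain ⟨z, hz⟩ := hsing w ⟨x⟩
      have h1 := hpair hx.symm hw₀ hz
      have h2 := hpair hy.symm hw₀ hz
      rw [hf.right_inv hF] at h1 h2
      have h3 := castUniv_injective hz (singleLift_injective z (hu z _ _ h1 h2))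
      exact (hxy (by rw [← hF w x, h3, hF])).elim

theorem Lifts.derivable_of_const (ha : Normal false a) (hf : Lifts f e)
    (hF : ∀ v x, e v (F v x) = x) (heq : ∀ v x y, outPos f F v x = outPos f F v y)
    (hc : Complete a c) : Derivable f := by
  obtain ⟨w, hw⟩ := hf.exists_single ha hF heq
  choose g hg hw using hw
  obtain rfl : f = fun v => ofItems (single (g v)) := funext hg
  choose S hS using fun v => singleLift_surjective (g v)
  refine (hc g ⟨fun v u => e v (S v u), .of_surjective (fun v v' r h => ?_) fun v x => ?_⟩).comp
    .single
  -- If `r` relates no points of the outputs, the one-item lists say nothing about nullary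
  -- relations; the common reference `w` does.
  · by_cases hr : ∃ x y, r (e v x) (e v' y)
    · obtain ⟨x, y, hxy⟩ := hr
      refine (pIso_of_single (hf.1 v v' r h) hxy).mono fun s t hst => ?_
      exact ⟨_, _, hst, hS v s, hS v' t⟩
    · exact ((hw v).bot_trans (hw v').bot_symm).mono fun s t hst => hr ⟨_, _, hst⟩
  · exact ⟨singleLift _ (F v x),
      (congrArg (e v) (singleLift_injective _ (hS v _))).trans (hF v x)⟩

end outPos

theorem derivable_of_normal_true (ha : Normal true a) {f : a.Elem → c.Elem} (hf : ∃ e, Lifts f e)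
    (hc : ∀ b, Normal false b → size b ≤ size a → Complete b c) : Derivable f := by
  induction ha using Normal.induction_true with
  | base a ha => exact hc a ha le_rfl f hf
  | sum a b _ _ ih ih' =>
    obtain ⟨e, hf⟩ := hf
    have h1 := ih (f := fun v => f (inl v)) ⟨_, lifts_inl.comp hf⟩ fun b hb h => hc b hb (by
      simp only [size]; omega)
    have h2 := ih' (f := fun v => f (inr v)) ⟨_, lifts_inr.comp hf⟩ fun b hb h => hc b hb (by
      simp only [size]; omega)
    exact (h1.copair h2).congr fun v => by rcases v with v | v <;> rfl

/-! ### Functions that follow the input list or its reverse -/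

section list

variable {f : (list a).Elem → (list c).Elem} {e : ∀ v, Univ (f v) → Univ v}
  {F : ∀ v, Univ v → Univ (f v)}

/-- The map from the universe of a one-item list to the universe of a list with that first item. -/
def headLift (w : Item a) (l : (list a).Elem) (x : Univ (a := list a) (ofItems [w])) :
    Univ (a := list a) (ofItems (w :: items l)) :=
  reindex (q := List.get [w]) (p := List.get (w :: items l)) (fun _ => ⟨0, Nat.succ_pos _⟩)
    (fun k => congrArg (List.get [w]) (Subsingleton.elim (α := Fin 1) k 0)) x

theorem pIso_headLift (w : Item a) (l : (list a).Elem) :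
    PIso (list a) (ofItems [w]) (ofItems (w :: items l)) fun x y => headLift w l x = y :=
  pIso_reindex _ fun i j => iff_of_true (Subsingleton.elim (α := Fin 1) i j).le le_rfl

theorem exists_headLift_or_consLift (w : Item a) (l : (list a).Elem)
    (z : Univ (a := list a) (ofItems (w :: items l))) :
    (∃ x, headLift w l x = z) ∨ ∃ y, consLift w l y = z := by
  obtain ⟨⟨_ | k, hk⟩, z⟩ := z
  · exact .inl ⟨⟨⟨0, Nat.one_pos⟩, z⟩, rfl⟩
  · exact .inr ⟨⟨⟨k, Nat.lt_of_succ_lt_succ hk⟩, z⟩, rfl⟩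

theorem Lifts.apply_nil (e : ∀ v, Univ (f v) → Univ v) : f (ofItems []) = ofItems [] :=
  eq_nil_of_isEmpty fun ⟨u⟩ => (e _ u).1.elim0

theorem Lifts.eq_bind_of_forward (hf : Lifts f e) (hF : ∀ v x, e v (F v x) = x)
    (h : ∀ (l : (list a).Elem) (x y : Univ l), x.1 < y.1 → outPos f F l x < outPos f F l y)
    (l : (list a).Elem) : bind (fun x => f (ofItems [x])) l = f l := by
  induction l with
  | nil => exact (apply_nil e).symm
  | cons w l ih =>
    refine Eq.trans ?_ (hf.eq_append hF (pIso_headLift w l) (pIso_consLift w l)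
      (exists_headLift_or_consLift w l) fun x y => h _ _ _ (Fin.succ_pos _)).symm
    rw [← ih]
    rfl

theorem Lifts.eq_bind_reverse_of_backward (hf : Lifts f e) (hF : ∀ v x, e v (F v x) = x)
    (h : ∀ (l : (list a).Elem) (x y : Univ l), x.1 < y.1 → outPos f F l y < outPos f F l x)
    (l : (list a).Elem) : bind (fun x => f (ofItems [x])) (reverse l) = f l := by
  induction l with
  | nil => exact (apply_nil e).symm
  | cons w l ih =>
    refine Eq.trans ?_ (hf.eq_append hF (pIso_consLift w l) (pIso_headLift w l)
      (fun z => (exists_headLift_or_consLift w l z).symm) fun x y => h _ _ _ (Fin.succ_pos _)).symm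
    rw [← ih]
    refine (congrArg (List.flatMap _) List.reverse_cons).trans (List.flatMap_append.trans ?_)
    exact congrArg (List.append _) (List.flatMap_singleton _ _)

/-- The item type may be a sum, but it and its summands are smaller than the list type, so the
hypothesis applies to every summand. -/
theorem Lifts.derivable_bind (ha : Normal true a) (hf : Lifts f e)
    (ih : ∀ b, Normal false b → size b < size (ListType.list a) → Complete b (ListType.list c)) :
    Derivable (bind fun x => f (ofItems [x])) := by
  have h1 := derivable_of_normal_true ha ⟨_, lifts_single.comp hf⟩ fun b hb h =>
    ih b hb (Nat.lt_succ_of_le h)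
  refine h1.bind.congr fun l => congrArg (fun g => bind g l) (funext fun x => ?_)
  exact congrArg f (single_item x)

end list

/-! ### Completeness for list outputs and conclusion -/

theorem complete_list (hc : ∀ a, Normal false a → Complete a c) (ha : Normal false a) :
    Complete a (list c) := by
  induction hs : size a using Nat.strong_induction_on generalizing a with
  | _ n ih =>
  subst hs
  replace ih : ∀ b, Normal false b → size b < size a → Complete b (list c) := fun b hb h =>
    ih _ h hb rfl
  rintro f ⟨e, hf⟩
  -- The leaves in use. If there are none, `f` is constant; if all are used, every `e v` is
  -- surjective; otherwise the input is first restricted to `T`.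
  let T : Set a.Leaf := {i | ∃ v x, leaf v (e v x) = i}
  by_cases h : ∀ i, i ∉ T
  · obtain ⟨w, hw, hfw⟩ := hf.exists_eq_of_isEmpty ha fun v => ⟨fun x => h _ ⟨v, x, rfl⟩⟩
    exact (Derivable.const hw).congr fun v => (hfw v).symm
  by_cases h' : ∀ i, i ∈ T
  · have hsurj : ∀ v x, ∃ u, e v u = x := by
      intro v x
      obtain ⟨w, y, hy⟩ := h' (leaf v x)
      exact (hf.mem_range_iff ha hy).1 ⟨y, rfl⟩
    choose F hF using hsurj
    by_cases hind : Indecomposable (outPos f F)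
    · have hpos := hf.posInvariant hF
      cases ha with
      | one => exact hf.derivable_of_const .one hF (fun _ _ _ => rfl) (hc _ .one)
      | prod ha hb =>
        exact hf.derivable_of_const (ha.prod hb) hF (hpos.eq_of_prod hind ha hb) (hc _ (ha.prod hb))
      | list ha =>
        rcases hpos.trichotomy_of_list hind ha with h | h | h
        · exact hf.derivable_of_const (.list ha) hF h (hc _ (.list ha))
        · exact (hf.derivable_bind ha ih).congr (hf.eq_bind_of_forward hF h)
        · exact (Derivable.reverse.comp (hf.derivable_bind ha ih)).congr
            (hf.eq_bind_reverse_of_backward hF h)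
    · unfold Indecomposable at hind
      push Not at hind
      obtain ⟨L, hL, ⟨i, hi⟩, ⟨j, hj⟩⟩ := hind
      exact hf.derivable_of_cut ha hF ih hL (fun h => h i hi) fun h => hj (h j)
  · obtain ⟨b, b', p, q, hb, -, hs, -, hp, -, hpq⟩ := ((ha.splits T).resolve_left h).resolve_left h'
    obtain ⟨g, hg, hfg⟩ := hf.exists_factor hp fun v x => ⟨v, x, rfl⟩
    exact ((hpq.comp .fst).comp (ih b hb hs g hg)).congr fun v => (hfg v).symm

theorem Normal.complete (ha : Normal false a) : Complete a c := by
  induction c generalizing a with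
  | one => exact complete_one ha
  | prod c d ihc ihd => exact complete_prod (fun _ => ihc) (fun _ => ihd) ha
  | sum c d ihc ihd => exact complete_sum ha (ihc ha) (ihd ha)
  | list c ih => exact complete_list (fun _ => ih) ha

/-- With `a` a retract of a normal type by `s` and `r`, the function `f` is `f ∘ r`, which has a
normal domain, after `s`. -/
theorem derivable_iff_exists_lifts {f : a.Elem → c.Elem} : Derivable f ↔ ∃ e, Lifts f e := by
  refine ⟨Derivable.exists_lifts, fun ⟨e, hf⟩ => ?_⟩
  obtain ⟨b, hb, s, r, hs, hr, h⟩ := exists_retract_normal a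
  obtain ⟨e', he'⟩ := hr.exists_lifts
  exact (hs.comp (derivable_of_normal_true hb ⟨_, he'.comp hf⟩ fun _ hb _ => hb.complete)).congr
    fun x => congrArg f (h x)

end ListType

theorem theorem2 (a b : ListType) (f : a.Elem → b.Elem) :
    IsQFInterpretation f ↔ Derivable f :=
  isQFInterpretation_iff_exists_lifts.trans ListType.derivable_iff_exists_lifts.symm
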